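/- Fix real numbers $r\ge 0$, $\omega>r^2$, $\pi_1\in(0,1)$, and $\delta\in(0,1)$. There is a constant $M=M(r,\omega,\pi_1,\delta)>0$ such that the following holds for every sequence $\lambda_n>0$ with $\lambda_n\ge C\log^2 n$ for some $C>0$ and all large $n$, and for every $n\ge 1$. Model. Let $\bar n_1$ be an integer with $|\bar n_1-\pi_1 n|<1$ (so $\bar n_1=\pi_1 n$ if this is an integer), and let $c\in\{-1,1\}^n$ be the true label vector, with $c_i=1$ for $i\le \bar n_1$ (community 1) and $c_i=-1$ for $i>\bar n_1$ (community 2). Let $A$ be the adjacency matrix of the two-community stochastic block model with probability matrix $$P=\frac{\lambda_n}{n}\begin{pmatrix}1& r\\ r&\omega\end{pmatrix},$$ whose entries are assumed to be at most $1$: $A$ is symmetric with entries in $\{0,1\}$, the entries $A_{ij}$ with $i\ge j$ are independent, and for $i>j$ the entry $A_{ij}$ is Bernoulli with parameter $P_{c_ic_j}$. The diagonal is either zero (no self-loops) or follows the same rule; the result holds in both cases. Method. For $e\in\{-1,1\}^n$ and $k,l\in\{1,-1\}$ let $n_k(e)$ be the number of $i$ with $e_i=k$, let $O_{kl}(e)=\sum_{i,j}A_{ij}\mathbf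 1\{e_i=k,e_j=l\}$, and let $$Q_{BM}(e)=\sum_{k,l}O_{kl}\log\frac{O_{kl}}{n_kn_l}\qquad(0\log 0=0)$$ be the profile log-likelihood. For a real $2\times n$ matrix $U$ let $\mathcal E_U$ be the set of $e\in\{-1,1\}^n$ for which $Ue$ is an extreme point of the projected cube $U[-1,1]^n$. Let $U_{\mathbb E[A]}$ be a $2\times n$ matrix whose rows are two leading eigenvectors of $\mathbb E[A]$, that is, orthonormal eigenvectors for its two largest eigenvalues. Write $\|\cdot\|$ for the Euclidean norm of vectors and the spectral norm of matrices. Claim. With probability at least $1-n^{-\delta}$, simultaneously for all real $2\times n$ matrices $U_A$ (which may thus be computed from $A$ in any way) and all maximizers $e^*$ of $Q_{BM}$ over $\mathcal E_{U_A}$, the following two statements hold. (i) $$\frac1n\min_{s\in\{1,-1\}}\|c-s\,e^*\|^2\le M\log n\,\bigl(\lambda_n^{-1/2}+\|U_A-U_{\mathbb E[A]}\|\bigr).$$ (ii) If the rows of $U_A$ are two leading eigenvectors of $A$ (orthonormal eigenvectors for its two largest eigenvalues), then the fraction of mis-clustered nodes, $\frac1n\min_{s\in\{1,-1\}}\#\{i: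 s\,e^*_i\ne c_i\}$, is at most $M\log n/\sqrt{\lambda_n}$. -/

import Mathlib

open MeasureTheory ProbabilityTheory Filter
open scoped Matrix Matrix.Norms.L2Operator

namespace CommunityDetection

/-- A label vector: every node carries a label in `{1, -1}`. -/
abbrev Labels (n : ℕ) : Type := Fin n → ℤˣ

/-- A label vector as a point of the cube `[-1,1]^n`. -/
def Labels.toVec {n : ℕ} (e : Labels n) : Fin n → ℝ := fun i => ((e i : ℤ) : ℝ)

/-- The true labels: the first `n₁` nodes form community `1`, the others form community `2`
(which has the label `-1`). -/
def trueLabels (n n₁ : ℕ) : Labels n := fun i => if i.val < n₁ then 1 else -1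

/-- The probability matrix `ρ * (1, r; r, w)`, indexed by labels. -/
def blockProb (ρ r w : ℝ) (k l : ℤˣ) : ℝ :=
  ρ * (if k = 1 then (if l = 1 then 1 else r) else (if l = 1 then r else w))

/-- Edge probabilities of the stochastic block model with labels `c`. If `loops` is `true`, then
the diagonal follows the same rule as the other entries, so that the expected adjacency matrix is
constant on blocks; if `loops` is `false`, then the diagonal is zero (no self-loops). -/
def edgeProb {n : ℕ} (loops : Bool) (c : Labels n) (P : ℤˣ → ℤˣ → ℝ) (i j : Fin n) : ℝ :=
  if i = j ∧ loops = false then 0 else P (c i) (c j)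

/-- `A` is the adjacency matrix of a random undirected graph on `n` nodes with independent edges:
it is symmetric with entries in `{0,1}`, the entries on and below the diagonal are independent,
and `A i j` is Bernoulli with parameter `p i j`. -/
structure IsRandomAdjacency {Ω : Type*} [MeasurableSpace Ω] (μ : Measure Ω) {n : ℕ}
    (A : Ω → Matrix (Fin n) (Fin n) ℝ) (p : Fin n → Fin n → ℝ) : Prop where
  measurable : ∀ i j, Measurable fun x => A x i j
  zero_or_one : ∀ x i j, A x i j = 0 ∨ A x i j = 1
  isSymm : ∀ x, (A x).IsSymm
  indep : iIndepFun (fun (q : {q : Fin n × Fin n // q.2 ≤ q.1}) (x : Ω) => A x q.1.1 q.1.2) μ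
  prob_one : ∀ i j, μ.real {x | A x i j = 1} = p i j

/-- The entrywise expectation of a random matrix. -/
noncomputable def expectedMatrix {Ω : Type*} [MeasurableSpace Ω] (μ : Measure Ω) {n : ℕ}
    (A : Ω → Matrix (Fin n) (Fin n) ℝ) : Matrix (Fin n) (Fin n) ℝ :=
  Matrix.of fun i j => ∫ x, A x i j ∂μ

/-- The rows of the `2 × n` matrix `U` are two leading eigenvectors of the symmetric matrix `B`:
they are orthonormal eigenvectors, and their eigenvalues are the two largest ones, counted with
multiplicity (no eigenvector orthogonal to both rows has a larger eigenvalue). -/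
def IsLeadingEigenvectors {n : ℕ} (B : Matrix (Fin n) (Fin n) ℝ)
    (U : Matrix (Fin 2) (Fin n) ℝ) : Prop :=
  U * Uᵀ = 1 ∧
  ∃ ρ : Fin 2 → ℝ, (∀ k, B *ᵥ U k = ρ k • U k) ∧
    ∀ (v : Fin n → ℝ) (ν : ℝ), v ≠ 0 → U *ᵥ v = 0 → B *ᵥ v = ν • v → ∀ k, ν ≤ ρ k

/-- The number of nodes with label `k`. -/
def nodeCount {n : ℕ} (e : Labels n) (k : ℤˣ) : ℝ := ∑ i, if e i = k then 1 else 0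

/-- `O_{kl}(e) = ∑_{i,j} A_{ij} 1{e_i = k, e_j = l}`. -/
def edgeCount {n : ℕ} (A : Matrix (Fin n) (Fin n) ℝ) (e : Labels n) (k l : ℤˣ) : ℝ :=
  ∑ i, ∑ j, if e i = k ∧ e j = l then A i j else 0

/-- The profile log-likelihood of the stochastic block model,
`Q_BM(e) = ∑_{k,l} O_{kl} log (O_{kl} / (n_k n_l))`, with the convention `0 log 0 = 0`
(`O_{kl} = 0` whenever `n_k n_l = 0`). -/
noncomputable def profileLogLik {n : ℕ} (A : Matrix (Fin n) (Fin n) ℝ) (e : Labels n) : ℝ :=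
  ∑ k : ℤˣ, ∑ l : ℤˣ,
    edgeCount A e k l * Real.log (edgeCount A e k l / (nodeCount e k * nodeCount e l))

/-- The label vectors whose projections are extreme points of the projected cube `U [-1,1]^n`. -/
def extremeLabels {n : ℕ} (U : Matrix (Fin 2) (Fin n) ℝ) : Set (Labels n) :=
  {e | U *ᵥ e.toVec ∈
    Set.extremePoints ℝ ((fun v : Fin n → ℝ => U *ᵥ v) '' Set.Icc (-1 : Fin n → ℝ) 1)}

/-- `e` is the output of the method for the matrix `A` and the projection `U`: it maximizes
`Q_BM` over the labels that correspond to extreme points. -/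
def IsProjectionMaximizer {n : ℕ} (A : Matrix (Fin n) (Fin n) ℝ) (U : Matrix (Fin 2) (Fin n) ℝ)
    (e : Labels n) : Prop :=
  e ∈ extremeLabels U ∧ ∀ e' ∈ extremeLabels U, profileLogLik A e' ≤ profileLogLik A e

/-- The squared Euclidean distance `‖c - e‖²` of two label vectors, up to the simultaneous
change of all signs in `e`, i.e. up to exchanging the names of the two communities. -/
noncomputable def sqDist {n : ℕ} (c e : Labels n) : ℝ :=
  min (‖WithLp.toLp 2 (c.toVec - e.toVec)‖ ^ 2) (‖WithLp.toLp 2 (c.toVec + e.toVec)‖ ^ 2)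

/-- The fraction of mis-clustered nodes, up to exchanging the names of the two communities. -/
noncomputable def misclusteredFraction {n : ℕ} (c e : Labels n) : ℝ :=
  (min (Finset.univ.filter fun i => e i ≠ c i).card
    (Finset.univ.filter fun i => -e i ≠ c i).card : ℕ) / (n : ℝ)

end CommunityDetection

/-! The labels `c` need not be an extreme point themselves, so the argument finds a competitor e' in
the search set that is close to `c`, and shows that no maximizer can be much worse than e'.

Competitor. The block matrix P with entries P_{c_i c_j} is positive semidefinite of rank at most two
(since ω > r²), and c = P y with ‖y‖ of order √n/λ. A Davis–Kahan type argument (`proj_residual_le`)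
then gives a bound of order n s²/λ² for the squared distance of c to the row space of leading
eigenvectors U of any S with ‖S − P‖ ≤ s. The linear functional with coefficients U c, applied after
U', is maximized over the projected cube at an extreme vertex e'. Since c and e' have the same norm,
‖c − e'‖² = 2⟨c, c − e'⟩, and this bounds the errors of e' by the squared residual plus n‖U' − U‖²
(`exists_extremeLabels_card_ne_le`). Statement (i) takes S = E[A], which differs from P only on the
diagonal; statement (ii) takes S = A and U' = U, so that no comparison of eigenvectors is needed.

Likelihood. After rescaling, and up to a term that does not depend on e, Q_BM(e) is close to a
population functional of the confusion matrix of e and c. The population loss of e' is O(log n)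
times its fraction of errors (`trueLik_sub_populationLik_le`). Conversely, a convexity bound makes
the loss of e at least a constant times its fraction of mis-clustered nodes
(`sum_min_mul_le_trueLik_sub_populationLik`, `misclusteredFraction_mul_le`); the constant is
positive because the rows of the probability matrix differ. Maximality links the two losses
(`misclusteredFraction_le`).

Randomness. Two events of total failure probability at most 1/n suffice. All block counts are within
O(n√λ) of their means, by a Chernoff bound and a union bound over the 2^n labellings. Also ‖A −
E[A]‖ = O(√(λ log n)), by moments of the trace: resampling one edge at a time acts as integration by
parts, and moments of order log n cost only constants. On these events everything is deterministic,
so U_A may depend on A in any way. -/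

namespace CommunityDetection

/-! ### Expectations over independent Bernoulli variables as finite sums. -/

section Bernoulli

variable {ι : Type*} [Fintype ι]

/-- The probability of the outcome `b` of independent Bernoulli variables with parameters `p`. -/
noncomputable def bernWeight (p : ι → ℝ) (b : ι → Bool) : ℝ :=
  ∏ e, if b e then p e else 1 - p e

/-- The expectation of a function of independent Bernoulli variables with parameters `p`. -/
noncomputable def bernExp [DecidableEq ι] (p : ι → ℝ) (f : (ι → Bool) → ℝ) : ℝ :=
  ∑ b, bernWeight p b * f b

/-- A Boolean as a real number. -/
def boolVal (t : Bool) : ℝ := if t then 1 else 0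

lemma boolVal_nonneg (t : Bool) : 0 ≤ boolVal t := by cases t <;> simp [boolVal]

lemma bernWeight_nonneg {p : ι → ℝ} (h0 : ∀ e, 0 ≤ p e) (h1 : ∀ e, p e ≤ 1) (b : ι → Bool) :
    0 ≤ bernWeight p b := by
  refine Finset.prod_nonneg fun e _ => ?_
  split_ifs
  · exact h0 e
  · linarith [h1 e]

variable [DecidableEq ι]

lemma bernExp_prod (p : ι → ℝ) (g : ι → Bool → ℝ) :
    bernExp p (fun b => ∏ e, g e (b e)) = ∏ e, (p e * g e true + (1 - p e) * g e false) := by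
  have h := Finset.prod_univ_sum (fun _ : ι => (Finset.univ : Finset Bool))
    (fun e t => (if t then p e else 1 - p e) * g e t)
  simp only [Fintype.univ_bool, Finset.mem_singleton, Bool.true_eq_false, not_false_eq_true,
    Finset.sum_insert, Finset.sum_singleton, if_true, Bool.false_eq_true, if_false] at h
  rw [h, bernExp, ← Fintype.univ_bool, Fintype.piFinset_univ]
  refine Finset.sum_congr rfl fun b _ => ?_
  rw [bernWeight, ← Finset.prod_mul_distrib]

lemma bernExp_const (p : ι → ℝ) (a : ℝ) : bernExp p (fun _ => a) = a := by
  have h := bernExp_prod p (fun _ _ => 1)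
  simp only [Finset.prod_const_one, mul_one, add_sub_cancel] at h
  simp only [bernExp, mul_one] at h ⊢
  rw [← Finset.sum_mul, h, one_mul]

lemma bernExp_mono {p : ι → ℝ} (h0 : ∀ e, 0 ≤ p e) (h1 : ∀ e, p e ≤ 1)
    {f g : (ι → Bool) → ℝ} (h : ∀ b, f b ≤ g b) : bernExp p f ≤ bernExp p g :=
  Finset.sum_le_sum fun b _ => mul_le_mul_of_nonneg_left (h b) (bernWeight_nonneg h0 h1 b)

lemma bernExp_add (p : ι → ℝ) (f g : (ι → Bool) → ℝ) :
    bernExp p (fun b => f b + g b) = bernExp p f + bernExp p g := by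
  simp only [bernExp, mul_add, Finset.sum_add_distrib]

lemma bernExp_const_mul (p : ι → ℝ) (a : ℝ) (f : (ι → Bool) → ℝ) :
    bernExp p (fun b => a * f b) = a * bernExp p f := by
  simp only [bernExp, Finset.mul_sum]
  exact Finset.sum_congr rfl fun b _ => by ring

lemma bernExp_sum {κ : Type*} (p : ι → ℝ) (s : Finset κ) (f : κ → (ι → Bool) → ℝ) :
    bernExp p (fun b => ∑ k ∈ s, f k b) = ∑ k ∈ s, bernExp p (f k) := by
  simp only [bernExp, Finset.mul_sum]
  exact Finset.sum_comm

lemma bernWeight_update (p : ι → ℝ) (b : ι → Bool) (e : ι) (t : Bool) :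
    bernWeight p (Function.update b e t) =
      (if t then p e else 1 - p e) * ∏ e' ∈ Finset.univ.erase e, if b e' then p e' else 1 - p e' := by
  rw [bernWeight, ← Finset.mul_prod_erase _ _ (Finset.mem_univ e), Function.update_self]
  congr 1
  refine Finset.prod_congr rfl fun e' he' => ?_
  rw [Function.update_of_ne (Finset.ne_of_mem_erase he')]

/-- Resampling one coordinate does not change the expectation. -/
lemma bernExp_resample (p : ι → ℝ) (f : (ι → Bool) → ℝ) (e : ι) :
    bernExp p f = bernExp p fun b =>
      p e * f (Function.update b e true) + (1 - p e) * f (Function.update b e false) := by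
  -- Flipping the coordinate `e` is an involution, so pairing `b` with its flip counts every
  -- configuration twice.
  have key : ∀ g : (ι → Bool) → ℝ, ∑ b, g b = (1 / 2) * ∑ b : ι → Bool,
      (g (Function.update b e true) + g (Function.update b e false)) := by
    intro g
    let φ : Equiv.Perm (ι → Bool) := Function.Involutive.toPerm
      (fun b => Function.update b e (!b e)) (fun b => by ext e'; simp)
    have h1 : ∑ b, g (φ b) = ∑ b, g b := Equiv.sum_comp φ g
    have h2 : ∀ b, g (Function.update b e true) + g (Function.update b e false)
        = g b + g (φ b) := by
      intro b
      have h3 : φ b = Function.update b e (!b e) := rfl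
      rw [h3]
      rcases hb : b e with _ | _
      · have : Function.update b e false = b := by rw [← hb]; simp
        rw [this]; simp [add_comm]
      · have : Function.update b e true = b := by rw [← hb]; simp
        rw [this]; simp
    simp only [h2, Finset.sum_add_distrib, h1]
    ring
  refine (key _).trans (Eq.trans ?_ (key _).symm)
  congr 1
  refine Finset.sum_congr rfl fun b _ => ?_
  simp only [bernWeight_update, Function.update_idem, if_true, Bool.false_eq_true, if_false]
  ring

/-- From exp a ≤ 1 + a + a² for |a| ≤ 1 and 1 + x ≤ exp x: the centering cancels the linear term p a
and only p a² remains. -/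
lemma bern_mgf_le {p a : ℝ} (h0 : 0 ≤ p) (ha : |a| ≤ 1) :
    p * Real.exp (a * (1 - p)) + (1 - p) * Real.exp (a * (0 - p)) ≤ Real.exp (p * a ^ 2) := by
  have h2 : Real.exp a ≤ 1 + a + a ^ 2 := by
    have := (abs_le.1 (Real.abs_exp_sub_one_sub_id_le ha)).2
    linarith
  have h3 : p * Real.exp (a * (1 - p)) + (1 - p) * Real.exp (a * (0 - p))
      = (1 + p * (Real.exp a - 1)) * Real.exp (-(a * p)) := by
    have h4 : a * (1 - p) = a + -(a * p) := by ring
    have h5 : a * (0 - p) = -(a * p) := by ring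
    rw [h4, h5, Real.exp_add]; ring
  rw [h3]
  have h6 : 1 + p * (Real.exp a - 1) ≤ Real.exp (p * (a + a ^ 2)) := by
    have := Real.add_one_le_exp (p * (a + a ^ 2))
    nlinarith
  calc _ ≤ Real.exp (p * (a + a ^ 2)) * Real.exp (-(a * p)) :=
        mul_le_mul_of_nonneg_right h6 (Real.exp_pos _).le
    _ = _ := by rw [← Real.exp_add]; congr 1; ring

lemma bernExp_exp_le {p : ι → ℝ} (h0 : ∀ e, 0 ≤ p e) (h1 : ∀ e, p e ≤ 1) {a : ι → ℝ}
    (ha : ∀ e, |a e| ≤ 1) :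
    bernExp p (fun b => Real.exp (∑ e, a e * (boolVal (b e) - p e)))
      ≤ Real.exp (∑ e, p e * a e ^ 2) := by
  have h := bernExp_prod p (fun e t => Real.exp (a e * (boolVal t - p e)))
  simp only [← Real.exp_sum] at h
  rw [h, Real.exp_sum]
  refine Finset.prod_le_prod (fun e _ => ?_) fun e _ => ?_
  · have := h0 e
    have := h1 e
    have : 0 ≤ 1 - p e := by linarith
    positivity
  · simpa [boolVal] using bern_mgf_le (h0 e) (ha e)

/-- The probability that independent Bernoulli variables have a property, in terms of `bernExp`. -/
lemma measureReal_eq_bernExp {Ω : Type*} [MeasurableSpace Ω] {μ : Measure Ω}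
    [IsProbabilityMeasure μ] {p : ι → ℝ} {Y : ι → Ω → ℝ} (hm : ∀ e, Measurable (Y e))
    (hind : iIndepFun Y μ) (hp : ∀ e, μ.real {x | Y e x = 1} = p e)
    (G : (ι → Bool) → Prop) [DecidablePred G] :
    μ.real {x | G fun e => decide (Y e x = 1)} = bernExp p (fun b => if G b then 1 else 0) := by
  classical
  let S : (ι → Bool) → Set Ω := fun b => {x | (fun e => decide (Y e x = 1)) = b}
  have hS : ∀ b, S b = ⋂ e, Y e ⁻¹' (if b e then {1} else {1}ᶜ) := by
    intro b
    ext x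
    simp only [S, Set.mem_ofPred_eq, Set.mem_iInter, funext_iff]
    refine forall_congr' fun e => ?_
    cases b e <;> simp
  have hSm : ∀ b, MeasurableSet (S b) := by
    intro b
    rw [hS]
    refine MeasurableSet.iInter fun e => hm e ?_
    split_ifs
    · exact measurableSet_singleton _
    · exact (measurableSet_singleton _).compl
  have hSμ : ∀ b, μ.real (S b) = bernWeight p b := by
    intro b
    rw [hS, measureReal_def, hind.meas_iInter, ENNReal.toReal_prod, bernWeight]
    · refine Finset.prod_congr rfl fun e _ => ?_
      rw [← measureReal_def]
      split_ifs
      · exact hp e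
      · rw [Set.preimage_compl, probReal_compl_eq_one_sub (hm e (measurableSet_singleton _))]
        congr 1
        exact hp e
    · intro e
      refine ⟨_, ?_, rfl⟩
      split_ifs
      · exact measurableSet_singleton _
      · exact (measurableSet_singleton _).compl
  have hU : {x | G fun e => decide (Y e x = 1)}
      = ⋃ b ∈ Finset.univ.filter G, S b := by
    ext x
    simp [S]
  rw [hU, measureReal_biUnion_finset]
  · simp only [hSμ, bernExp, mul_ite, mul_one, mul_zero, Finset.sum_filter]
  · intro b _ b' _ hbb
    refine Set.disjoint_left.2 fun x hx hx' => hbb ?_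
    exact hx.symm.trans hx'
  · exact fun b _ => hSm b

end Bernoulli

/-! ### Trace moments and a spectral bound for Bernoulli matrix series. -/

section SpectralMoment

set_option linter.unusedSectionVars false

variable {m : Type*} [Fintype m] [DecidableEq m]

/-- One pair `U`, `d` serves all powers, so traces that mix powers of two matrices can be expanded
in the two eigenbases. -/
lemma exists_orthogonal_diagonalization {X : Matrix m m ℝ} (hX : X.IsSymm) :
    ∃ (U : Matrix m m ℝ) (d : m → ℝ), U * Uᵀ = 1 ∧ Uᵀ * U = 1 ∧
      ∀ N : ℕ, X ^ N = U * Matrix.diagonal (fun k => d k ^ N) * Uᵀ := by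
  have hH : X.IsHermitian := by
    rw [Matrix.IsHermitian, Matrix.conjTranspose_eq_transpose_of_trivial]; exact hX
  obtain ⟨V, hV⟩ : ∃ V, V = hH.eigenvectorUnitary := ⟨_, rfl⟩
  have hst : (star (V : Matrix m m ℝ)) = (V : Matrix m m ℝ)ᵀ := by
    rw [Matrix.star_eq_conjTranspose, Matrix.conjTranspose_eq_transpose_of_trivial]
  have h1 : (V : Matrix m m ℝ) * (V : Matrix m m ℝ)ᵀ = 1 := by
    rw [← hst]; exact Unitary.coe_mul_star_self V
  have h2 : (V : Matrix m m ℝ)ᵀ * (V : Matrix m m ℝ) = 1 := by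
    rw [← hst]; exact Unitary.coe_star_mul_self V
  refine ⟨V, hH.eigenvalues, h1, h2, fun N => ?_⟩
  have h3 : X = (V : Matrix m m ℝ) * Matrix.diagonal hH.eigenvalues * (V : Matrix m m ℝ)ᵀ := by
    have := hH.spectral_theorem
    rw [← hV, Unitary.conjStarAlgAut_apply] at this
    rw [← hst]
    exact this
  induction N with
  | zero => simp [h1]
  | succ N ih =>
    have h4 : X ^ (N + 1) = (V : Matrix m m ℝ) * Matrix.diagonal (fun k => hH.eigenvalues k ^ N) *
        (V : Matrix m m ℝ)ᵀ *
          ((V : Matrix m m ℝ) * Matrix.diagonal hH.eigenvalues * (V : Matrix m m ℝ)ᵀ) := by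
      rw [pow_succ, ih, ← h3]
    rw [h4]
    calc _ = (V : Matrix m m ℝ) * Matrix.diagonal (fun k => hH.eigenvalues k ^ N) *
          ((V : Matrix m m ℝ)ᵀ * (V : Matrix m m ℝ)) * Matrix.diagonal hH.eigenvalues *
          (V : Matrix m m ℝ)ᵀ := by simp only [Matrix.mul_assoc]
      _ = _ := by
        rw [h2, Matrix.mul_one, Matrix.mul_assoc (V : Matrix m m ℝ), Matrix.diagonal_mul_diagonal]
        simp only [pow_succ]

lemma diag_pow_eq {X U : Matrix m m ℝ} {d : m → ℝ} {N : ℕ}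
    (h : X ^ N = U * Matrix.diagonal (fun k => d k ^ N) * Uᵀ) (i : m) :
    (X ^ N) i i = ∑ k, U i k ^ 2 * d k ^ N := by
  rw [h, Matrix.mul_apply]
  refine Finset.sum_congr rfl fun k _ => ?_
  rw [Matrix.mul_diagonal, Matrix.transpose_apply]; ring

lemma sum_sq_row_eq_one {U : Matrix m m ℝ} (h : U * Uᵀ = 1) (i : m) : ∑ k, U i k ^ 2 = 1 := by
  have := congrFun (congrFun h i) i
  simp only [Matrix.mul_apply, Matrix.transpose_apply, Matrix.one_apply_eq] at this
  simpa only [sq] using this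

/-- The weights are squares and depend on neither exponent, so scalar inequalities between monomials
in the eigenvalues pass to traces of non-commuting products. -/
lemma trace_mul_pow_mul_pow {X Y E U V : Matrix m m ℝ} {d d' : m → ℝ} (hE : E.IsSymm)
    (hX : ∀ N : ℕ, X ^ N = U * Matrix.diagonal (fun k => d k ^ N) * Uᵀ)
    (hY : ∀ N : ℕ, Y ^ N = V * Matrix.diagonal (fun k => d' k ^ N) * Vᵀ) (q r : ℕ) :
    (E * X ^ q * E * Y ^ r).trace = ∑ l, ∑ k, (Uᵀ * E * V) k l ^ 2 * (d k ^ q * d' l ^ r) := by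
  set P := Uᵀ * E * V with hP
  have hPt : Pᵀ = Vᵀ * E * U := by
    rw [hP, Matrix.transpose_mul, Matrix.transpose_mul, Matrix.transpose_transpose, hE.eq,
      Matrix.mul_assoc]
  have h1 : (E * X ^ q * E * Y ^ r).trace
      = (Pᵀ * Matrix.diagonal (fun k => d k ^ q) * P * Matrix.diagonal (fun k => d' k ^ r)).trace := by
    rw [hX, hY, hPt, hP]
    have : E * (U * Matrix.diagonal (fun k => d k ^ q) * Uᵀ) * E *
        (V * Matrix.diagonal (fun k => d' k ^ r) * Vᵀ)
        = (E * U * Matrix.diagonal (fun k => d k ^ q) * (Uᵀ * E * V) *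
          Matrix.diagonal (fun k => d' k ^ r)) * Vᵀ := by simp only [Matrix.mul_assoc]
    rw [this, Matrix.trace_mul_comm]
    simp only [Matrix.mul_assoc]
  rw [h1, Matrix.trace]
  refine Finset.sum_congr rfl fun l _ => ?_
  rw [Matrix.diag_apply, Matrix.mul_diagonal, Matrix.mul_apply, Finset.sum_mul]
  refine Finset.sum_congr rfl fun k _ => ?_
  rw [Matrix.mul_diagonal, Matrix.transpose_apply]
  ring

lemma pow_mul_pow_le_add_pow (x y : ℝ) {q r N : ℕ} (hN : Even N) (h : q + r = N) :
    x ^ q * y ^ r ≤ x ^ N + y ^ N := by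
  rw [← hN.pow_abs x, ← hN.pow_abs y]
  calc x ^ q * y ^ r ≤ |x| ^ q * |y| ^ r := by
        rw [← abs_pow, ← abs_pow, ← abs_mul]; exact le_abs_self _
    _ ≤ max |x| |y| ^ q * max |x| |y| ^ r := by
        gcongr
        · exact le_max_left _ _
        · exact le_max_right _ _
    _ = max |x| |y| ^ N := by rw [← pow_add, h]
    _ ≤ _ := by
        have := pow_nonneg (abs_nonneg x) N
        have := pow_nonneg (abs_nonneg y) N
        rcases max_cases |x| |y| with h | h <;> rw [h.1] <;> linarith

lemma trace_mul_pow_mul_pow_le {X Y E : Matrix m m ℝ} (hE : E.IsSymm) (hX : X.IsSymm)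
    (hY : Y.IsSymm) {q r N : ℕ} (hN : Even N) (h : q + r = N) :
    (E * X ^ q * E * Y ^ r).trace ≤ (E * E * X ^ N).trace + (E * E * Y ^ N).trace := by
  obtain ⟨U, d, -, -, hU⟩ := exists_orthogonal_diagonalization hX
  obtain ⟨V, d', -, -, hV⟩ := exists_orthogonal_diagonalization hY
  have h1 : (E * E * X ^ N).trace = (E * X ^ N * E * Y ^ 0).trace := by
    rw [pow_zero, Matrix.mul_one, Matrix.mul_assoc, Matrix.trace_mul_comm]
  have h2 : (E * E * Y ^ N).trace = (E * X ^ 0 * E * Y ^ N).trace := by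
    rw [pow_zero, Matrix.mul_one]
  rw [h1, h2, trace_mul_pow_mul_pow hE hU hV, trace_mul_pow_mul_pow hE hU hV,
    trace_mul_pow_mul_pow hE hU hV, ← Finset.sum_add_distrib]
  refine Finset.sum_le_sum fun l _ => ?_
  rw [← Finset.sum_add_distrib]
  refine Finset.sum_le_sum fun k _ => ?_
  rw [← mul_add, pow_zero, pow_zero, mul_one, one_mul]
  exact mul_le_mul_of_nonneg_left (pow_mul_pow_le_add_pow _ _ hN h) (sq_nonneg _)

lemma trace_sq_mul_pow_nonneg {X E : Matrix m m ℝ} (hE : E.IsSymm) (hX : X.IsSymm) {N : ℕ}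
    (hN : Even N) : 0 ≤ (E * E * X ^ N).trace := by
  obtain ⟨U, d, -, -, hU⟩ := exists_orthogonal_diagonalization hX
  have h1 : (E * E * X ^ N).trace = (E * X ^ N * E * X ^ 0).trace := by
    rw [pow_zero, Matrix.mul_one, Matrix.mul_assoc, Matrix.trace_mul_comm]
  rw [h1, trace_mul_pow_mul_pow hE hU hU]
  refine Finset.sum_nonneg fun l _ => Finset.sum_nonneg fun k _ => ?_
  rw [pow_zero, mul_one]
  exact mul_nonneg (sq_nonneg _) (hN.pow_nonneg _)

lemma pow_sub_pow_eq_sum (X Y : Matrix m m ℝ) (K : ℕ) :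
    X ^ K - Y ^ K = ∑ q ∈ Finset.range K, X ^ q * (X - Y) * Y ^ (K - 1 - q) := by
  induction K with
  | zero => simp
  | succ K ih =>
    have h : X ^ (K + 1) - Y ^ (K + 1) = (X ^ K - Y ^ K) * Y + X ^ K * (X - Y) := by
      rw [pow_succ, pow_succ]; noncomm_ring
    rw [h, ih, Finset.sum_range_succ, Finset.sum_mul]
    congr 1
    · refine Finset.sum_congr rfl fun q hq => ?_
      have hq' : K + 1 - 1 - q = (K - 1 - q) + 1 := by
        have := Finset.mem_range.1 hq; omega
      rw [hq', pow_succ]; simp only [Matrix.mul_assoc]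
    · simp

/-- The discrete derivative of a power: telescoping yields N + 1 mixed traces, each dominated by the
two pure ones. -/
lemma trace_mul_pow_sub_pow_le {X Y E : Matrix m m ℝ} (hE : E.IsSymm) (hX : X.IsSymm)
    (hY : Y.IsSymm) (h : X - Y = E) {N : ℕ} (hN : Even N) :
    (E * X ^ (N + 1)).trace - (E * Y ^ (N + 1)).trace
      ≤ (N + 1) * ((E * E * X ^ N).trace + (E * E * Y ^ N).trace) := by
  rw [← Matrix.trace_sub, ← Matrix.mul_sub, pow_sub_pow_eq_sum, h, Finset.mul_sum,
    Matrix.trace_sum]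
  have : ((N : ℝ) + 1) * ((E * E * X ^ N).trace + (E * E * Y ^ N).trace)
      = ∑ _q ∈ Finset.range (N + 1), ((E * E * X ^ N).trace + (E * E * Y ^ N).trace) := by
    rw [Finset.sum_const, Finset.card_range, nsmul_eq_mul]; push_cast; ring
  rw [this]
  refine Finset.sum_le_sum fun q hq => ?_
  have hq' := Finset.mem_range.1 hq
  rw [← Matrix.mul_assoc, ← Matrix.mul_assoc]
  exact trace_mul_pow_mul_pow_le hE hX hY hN (by omega)

/-- A Young inequality in the eigenbasis: for each eigenvalue d, either a ≤ θ d² and the first term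
suffices, or d² ≤ a/θ and the second does. It lets a lower moment be absorbed into a higher one. -/
lemma mul_diag_pow_le {X : Matrix m m ℝ} (hX : X.IsSymm) (i : m) {a θ : ℝ} (ha : 0 ≤ a)
    (hθ : 0 < θ) (k : ℕ) :
    a * (X ^ (2 * k)) i i ≤ θ * (X ^ (2 * k + 2)) i i + a ^ (k + 1) / θ ^ k := by
  obtain ⟨U, d, hU1, -, hU⟩ := exists_orthogonal_diagonalization hX
  have h1 := sum_sq_row_eq_one hU1 i
  have h2 : a ^ (k + 1) / θ ^ k = ∑ l, U i l ^ 2 * (a ^ (k + 1) / θ ^ k) := by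
    rw [← Finset.sum_mul, h1, one_mul]
  rw [diag_pow_eq (hU _), diag_pow_eq (hU _), h2, Finset.mul_sum, Finset.mul_sum,
    ← Finset.sum_add_distrib]
  refine Finset.sum_le_sum fun l _ => ?_
  have h3 : a * d l ^ (2 * k) ≤ θ * d l ^ (2 * k + 2) + a ^ (k + 1) / θ ^ k := by
    have e1 : d l ^ (2 * k) = (d l ^ 2) ^ k := by rw [pow_mul]
    have e2 : d l ^ (2 * k + 2) = (d l ^ 2) ^ k * d l ^ 2 := by rw [pow_add, pow_mul]
    rw [e1, e2]
    generalize hs : d l ^ 2 = s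
    have hs0 : 0 ≤ s := hs ▸ sq_nonneg _
    rcases le_total a (θ * s) with h | h
    · have : 0 ≤ a ^ (k + 1) / θ ^ k := by positivity
      have : a * s ^ k ≤ (θ * s) * s ^ k := by gcongr
      nlinarith
    · have h4 : s ≤ a / θ := by rw [le_div_iff₀ hθ]; linarith
      have h5 : a * s ^ k ≤ a * (a / θ) ^ k := by gcongr
      have h6 : a * (a / θ) ^ k = a ^ (k + 1) / θ ^ k := by rw [div_pow, pow_succ]; ring
      have : 0 ≤ θ * (s ^ k * s) := by positivity
      linarith
  have := mul_le_mul_of_nonneg_left h3 (sq_nonneg (U i l))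
  nlinarith

/-- The trace of an even power dominates that power of each single eigenvalue. -/
lemma abs_quadForm_le_of_trace_pow_le {X : Matrix m m ℝ} (hX : X.IsSymm) {t : ℝ} (ht : 0 ≤ t)
    {k : ℕ} (hk : k ≠ 0) (h : (X ^ (2 * k)).trace ≤ t ^ (2 * k)) (x : m → ℝ) :
    |x ⬝ᵥ (X *ᵥ x)| ≤ t * (x ⬝ᵥ x) := by
  obtain ⟨U, d, hU1, hU2, hU⟩ := exists_orthogonal_diagonalization hX
  have htr : (X ^ (2 * k)).trace = ∑ l, d l ^ (2 * k) := by
    rw [hU, Matrix.trace_mul_comm, ← Matrix.mul_assoc, hU2, Matrix.one_mul, Matrix.trace_diagonal]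
  have hd : ∀ l, |d l| ≤ t := by
    intro l
    refine le_of_pow_le_pow_left₀ (n := 2 * k) (by omega) ht ?_
    rw [(even_two_mul k).pow_abs]
    refine le_trans ?_ (htr ▸ h)
    exact Finset.single_le_sum (f := fun l => d l ^ (2 * k))
      (fun l _ => (even_two_mul k).pow_nonneg _) (Finset.mem_univ l)
  have h1 : X = U * Matrix.diagonal d * Uᵀ := by simpa using hU 1
  have h2 : x ⬝ᵥ (X *ᵥ x) = ∑ l, d l * (Uᵀ *ᵥ x) l ^ 2 := by
    rw [h1, ← Matrix.mulVec_mulVec, ← Matrix.mulVec_mulVec, Matrix.dotProduct_mulVec,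
      ← Matrix.mulVec_transpose, dotProduct]
    refine Finset.sum_congr rfl fun l _ => ?_
    rw [Matrix.mulVec_diagonal]; ring
  have h3 : x ⬝ᵥ x = ∑ l, (Uᵀ *ᵥ x) l ^ 2 := by
    have : x ⬝ᵥ x = x ⬝ᵥ ((U * Uᵀ) *ᵥ x) := by rw [hU1, Matrix.one_mulVec]
    rw [this, ← Matrix.mulVec_mulVec, Matrix.dotProduct_mulVec, ← Matrix.mulVec_transpose,
      dotProduct]
    exact Finset.sum_congr rfl fun l _ => (sq _).symm
  rw [h2, h3, Finset.mul_sum]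
  refine (Finset.abs_sum_le_sum_abs _ _).trans (Finset.sum_le_sum fun l _ => ?_)
  rw [abs_mul, abs_of_nonneg (sq_nonneg ((Uᵀ *ᵥ x) l))]
  exact mul_le_mul_of_nonneg_right (hd l) (sq_nonneg _)

variable {ι : Type*} [Fintype ι] [DecidableEq ι]

/-- A centered linear combination of matrices with Bernoulli coefficients. -/
noncomputable def bernSeries (p : ι → ℝ) (E : ι → Matrix m m ℝ) (b : ι → Bool) : Matrix m m ℝ :=
  ∑ e, (boolVal (b e) - p e) • E e

lemma bernSeries_isSymm {p : ι → ℝ} {E : ι → Matrix m m ℝ} (hE : ∀ e, (E e).IsSymm)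
    (b : ι → Bool) : (bernSeries p E b).IsSymm := by
  rw [Matrix.IsSymm, bernSeries, Matrix.transpose_sum]
  exact Finset.sum_congr rfl fun e _ => by rw [Matrix.transpose_smul, (hE e).eq]

lemma bernSeries_update_sub (p : ι → ℝ) (E : ι → Matrix m m ℝ) (b : ι → Bool) (e : ι) :
    bernSeries p E (Function.update b e true) - bernSeries p E (Function.update b e false) = E e := by
  rw [bernSeries, bernSeries, ← Finset.sum_sub_distrib, Finset.sum_eq_single e]
  · rw [← sub_smul]; simp [boolVal]
  · intro e' _ he'
    rw [Function.update_of_ne he', Function.update_of_ne he', sub_self]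
  · simp

/-- An integration by parts. One factor of the power is expanded into its summands; resampling the
coordinate `e` turns the centered coefficient into p(1 − p) times a difference of tr(E X^(N+1)) at
the two values of that coordinate, and the discrete derivative bound applies. -/
lemma bernExp_trace_pow_le {p : ι → ℝ} (h0 : ∀ e, 0 ≤ p e) (h1 : ∀ e, p e ≤ 1)
    {E : ι → Matrix m m ℝ} (hE : ∀ e, (E e).IsSymm) {N : ℕ} (hN : Even N) :
    bernExp p (fun b => (bernSeries p E b ^ (N + 2)).trace) ≤ (N + 1) * bernExp p (fun b =>
      ∑ e, (boolVal (b e) + p e) * (E e * E e * bernSeries p E b ^ N).trace) := by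
  have hl : ∀ b, (bernSeries p E b ^ (N + 2)).trace
      = ∑ e, (boolVal (b e) - p e) * (E e * bernSeries p E b ^ (N + 1)).trace := by
    intro b
    rw [pow_succ']
    nth_rewrite 1 [bernSeries]
    rw [Finset.sum_mul, Matrix.trace_sum]
    refine Finset.sum_congr rfl fun e _ => ?_
    rw [Matrix.smul_mul, Matrix.trace_smul, smul_eq_mul]
  simp only [hl]
  rw [bernExp_sum, bernExp_sum, Finset.mul_sum]
  refine Finset.sum_le_sum fun e _ => ?_
  rw [bernExp_resample p _ e, bernExp_resample p (fun b => (boolVal (b e) + p e) * _) e,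
    ← bernExp_const_mul]
  refine bernExp_mono h0 h1 fun b => ?_
  simp only [Function.update_self]
  have hs := trace_mul_pow_sub_pow_le (hE e) (bernSeries_isSymm hE (Function.update b e true))
    (bernSeries_isSymm hE (Function.update b e false)) (bernSeries_update_sub p E b e) hN
  have n1 := trace_sq_mul_pow_nonneg (hE e)
    (bernSeries_isSymm (p := p) hE (Function.update b e true)) hN
  have n0 := trace_sq_mul_pow_nonneg (hE e)
    (bernSeries_isSymm (p := p) hE (Function.update b e false)) hN
  simp only [boolVal, if_true, Bool.false_eq_true, if_false]
  generalize (E e * bernSeries p E (Function.update b e true) ^ (N + 1)).trace = g1 at *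
  generalize (E e * bernSeries p E (Function.update b e false) ^ (N + 1)).trace = g0 at *
  generalize (E e * E e * bernSeries p E (Function.update b e true) ^ N).trace = f1 at *
  generalize (E e * E e * bernSeries p E (Function.update b e false) ^ N).trace = f0 at *
  have hp0 := h0 e
  have hp1 : 0 ≤ 1 - p e := by linarith [h1 e]
  have hpp : 0 ≤ p e * (1 - p e) := mul_nonneg hp0 hp1
  have a1 := mul_le_mul_of_nonneg_left hs hpp
  -- This is exactly the slack between p(1 − p)(f1 + f0) and the resampled right side p(1 + p) f1 +
  -- (1 − p) p f0.
  have a2 : 0 ≤ ((N : ℝ) + 1) * (p e * (2 * p e * f1)) := by positivity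
  nlinarith

/-- When the squares E_e² are diagonal, the previous bound only involves diagonal entries of X^(2k)
weighted by random degrees. Young's inequality moves half of the trace moment to the left side, and
moments of the degrees remain. -/
lemma bernExp_trace_pow_le_sum {p : ι → ℝ} (h0 : ∀ e, 0 ≤ p e) (h1 : ∀ e, p e ≤ 1)
    {E : ι → Matrix m m ℝ} (hE : ∀ e, (E e).IsSymm) {c : ι → m → ℝ} (hc : ∀ e i, 0 ≤ c e i)
    (hEc : ∀ e, E e * E e = Matrix.diagonal (c e)) (k : ℕ) :
    bernExp p (fun b => (bernSeries p E b ^ (2 * (k + 1))).trace) ≤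
      ∑ i, bernExp p (fun b =>
        (4 * (k + 1) * ∑ e, (boolVal (b e) + p e) * c e i) ^ (k + 1)) := by
  have hmain := bernExp_trace_pow_le h0 h1 hE (even_two_mul k)
  rw [← bernExp_const_mul] at hmain
  have hpt : ∀ b, ((2 * k : ℕ) + 1 : ℝ) * ∑ e, (boolVal (b e) + p e) *
      (E e * E e * bernSeries p E b ^ (2 * k)).trace
      ≤ 1 / 2 * (bernSeries p E b ^ (2 * k + 2)).trace +
        1 / 2 * ∑ i, (4 * (k + 1) * ∑ e, (boolVal (b e) + p e) * c e i) ^ (k + 1) := by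
    intro b
    set X := bernSeries p E b with hX
    have hXs : X.IsSymm := bernSeries_isSymm hE b
    have e1 : ∑ e, (boolVal (b e) + p e) * (E e * E e * X ^ (2 * k)).trace
        = ∑ i, (∑ e, (boolVal (b e) + p e) * c e i) * (X ^ (2 * k)) i i := by
      simp only [hEc, Matrix.trace, Matrix.diag_apply, Matrix.diagonal_mul, Finset.mul_sum,
        Finset.sum_mul]
      rw [Finset.sum_comm]
      exact Finset.sum_congr rfl fun i _ => Finset.sum_congr rfl fun e _ => by ring
    rw [e1, Matrix.trace, Finset.mul_sum, Finset.mul_sum, Finset.mul_sum,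
      ← Finset.sum_add_distrib]
    refine Finset.sum_le_sum fun i _ => ?_
    set D := ∑ e, (boolVal (b e) + p e) * c e i
    have hD : 0 ≤ D := Finset.sum_nonneg fun e _ =>
      mul_nonneg (add_nonneg (boolVal_nonneg _) (h0 e)) (hc e i)
    -- Here a = (2k + 2) D exceeds the factor (2k + 1) D at hand, and θ = 1/2 leaves half of the
    -- moment to absorb.
    have hy := mul_diag_pow_le hXs i (a := (4 * (k + 1)) * D / 2) (θ := 1 / 2) (by positivity)
      (by norm_num) k
    rw [Matrix.diag_apply]
    have hnn : 0 ≤ D * (X ^ (2 * k)) i i := by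
      obtain ⟨U, d, -, -, hU⟩ := exists_orthogonal_diagonalization hXs
      rw [diag_pow_eq (hU _)]
      exact mul_nonneg hD (Finset.sum_nonneg fun l _ =>
        mul_nonneg (sq_nonneg _) ((even_two_mul k).pow_nonneg _))
    have e2 : (4 * (k + 1) * D / 2) ^ (k + 1) / (1 / 2 : ℝ) ^ k
        = 1 / 2 * (4 * (k + 1) * D) ^ (k + 1) := by
      rw [div_pow, div_pow, one_pow, pow_succ (2 : ℝ) k]
      field_simp
    rw [e2] at hy
    push_cast
    nlinarith
  have h2 := hmain.trans (bernExp_mono h0 h1 hpt)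
  rw [bernExp_add, bernExp_const_mul, bernExp_const_mul, bernExp_sum] at h2
  have e3 : 2 * (k + 1) = 2 * k + 2 := by ring
  rw [e3]
  linarith

/-- With u = k/λ, the bound D ≤ λ exp(D/λ) gives D^k ≤ λ^k exp(u D). As u ≤ 1, the exponential
moment is available: the doubled mean contributes 2Bk to the exponent and the fluctuation Bk. -/
lemma bernExp_degree_pow_le {p : ι → ℝ} (h0 : ∀ e, 0 ≤ p e) (h1 : ∀ e, p e ≤ 1) {c : ι → ℝ}
    (hc0 : ∀ e, 0 ≤ c e) (hc1 : ∀ e, c e ≤ 1) {lam B : ℝ} (hs : ∑ e, p e * c e ≤ B * lam)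
    (k : ℕ) (hk : (k : ℝ) ≤ lam) (hlam : 0 < lam) :
    bernExp p (fun b => (∑ e, (boolVal (b e) + p e) * c e) ^ k)
      ≤ (lam * Real.exp (3 * B)) ^ k := by
  set u : ℝ := k / lam with hu
  have hu0 : 0 ≤ u := by positivity
  have hu1 : u ≤ 1 := (div_le_one hlam).2 hk
  have hpt : ∀ b : ι → Bool, (∑ e, (boolVal (b e) + p e) * c e) ^ k ≤
      (lam ^ k * Real.exp (2 * u * (B * lam))) *
        Real.exp (∑ e, (u * c e) * (boolVal (b e) - p e)) := by
    intro b
    set D := ∑ e, (boolVal (b e) + p e) * c e with hDdef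
    have hD : 0 ≤ D := Finset.sum_nonneg fun e _ =>
      mul_nonneg (add_nonneg (boolVal_nonneg _) (h0 e)) (hc0 e)
    have a1 : D ≤ lam * Real.exp (D / lam) := by
      have := Real.add_one_le_exp (D / lam)
      calc D = lam * (D / lam) := by field_simp
        _ ≤ _ := by gcongr; linarith
    have a2 : D ^ k ≤ lam ^ k * Real.exp (u * D) := by
      calc D ^ k ≤ (lam * Real.exp (D / lam)) ^ k := by gcongr
        _ = _ := by
          rw [mul_pow, ← Real.exp_nat_mul, hu]; congr 2; ring
    refine a2.trans ?_
    rw [mul_assoc, ← Real.exp_add]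
    gcongr
    have a3 : u * D = ∑ e, (u * c e) * (boolVal (b e) - p e) + 2 * u * ∑ e, p e * c e := by
      rw [hDdef, Finset.mul_sum, Finset.mul_sum, ← Finset.sum_add_distrib]
      exact Finset.sum_congr rfl fun e _ => by ring
    rw [a3]
    have : 2 * u * ∑ e, p e * c e ≤ 2 * u * (B * lam) := by gcongr
    linarith
  refine (bernExp_mono h0 h1 hpt).trans ?_
  rw [bernExp_const_mul]
  have hexp := bernExp_exp_le h0 h1 (a := fun e => u * c e) fun e => by
    rw [abs_of_nonneg (mul_nonneg hu0 (hc0 e))]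
    exact mul_le_one₀ hu1 (hc0 e) (hc1 e)
  have h2 : ∑ e, p e * (u * c e) ^ 2 ≤ u * (B * lam) := by
    refine le_trans ?_ (mul_le_mul_of_nonneg_left hs hu0)
    rw [Finset.mul_sum]
    refine Finset.sum_le_sum fun e _ => ?_
    have : (u * c e) ^ 2 ≤ u * c e := by
      have h3 := mul_le_one₀ hu1 (hc0 e) (hc1 e)
      have h4 := mul_nonneg hu0 (hc0 e)
      nlinarith
    nlinarith [h0 e]
  have h3 := hexp.trans (Real.exp_le_exp.2 h2)
  calc _ ≤ (lam ^ k * Real.exp (2 * u * (B * lam))) * Real.exp (u * (B * lam)) := by gcongr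
    _ = (lam * Real.exp (3 * B)) ^ k := by
      rw [mul_assoc, ← Real.exp_add, mul_pow, ← Real.exp_nat_mul]
      congr 2
      rw [hu]; field_simp; ring

open Classical in
/-- A spectral bound for a matrix series with Bernoulli coefficients, in terms of the row sums. -/
lemma bernExp_quadForm_bound {p : ι → ℝ} (h0 : ∀ e, 0 ≤ p e) (h1 : ∀ e, p e ≤ 1)
    {E : ι → Matrix m m ℝ} (hE : ∀ e, (E e).IsSymm) {c : ι → m → ℝ} (hc0 : ∀ e i, 0 ≤ c e i)
    (hc1 : ∀ e i, c e i ≤ 1) (hEc : ∀ e, E e * E e = Matrix.diagonal (c e)) {lam B : ℝ}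
    (hs : ∀ i, ∑ e, p e * c e i ≤ B * lam) {k : ℕ} (hk0 : k ≠ 0) (hk : (k : ℝ) ≤ lam) :
    bernExp p (fun b => if ¬ ∀ x, |x ⬝ᵥ (bernSeries p E b *ᵥ x)| ≤
        Real.sqrt (4 * k * lam * Real.exp (3 * B + 3)) * (x ⬝ᵥ x) then 1 else 0)
      ≤ Fintype.card m * Real.exp (-3 * k) := by
  obtain ⟨j, rfl⟩ := Nat.exists_eq_succ_of_ne_zero hk0
  have hlam : 0 < lam := lt_of_lt_of_le (by positivity) hk
  set t2 : ℝ := 4 * (j.succ : ℕ) * lam * Real.exp (3 * B + 3) with ht2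
  have ht2pos : 0 < t2 := by positivity
  -- Markov's inequality for the trace moment. The surplus factor exp 3 in `t2`, compared with the
  -- moment bound, produces exp(−3k).
  have hpt : ∀ b, (if ¬ ∀ x, |x ⬝ᵥ (bernSeries p E b *ᵥ x)| ≤ Real.sqrt t2 * (x ⬝ᵥ x)
      then (1 : ℝ) else 0) ≤ (t2 ^ (j + 1))⁻¹ * (bernSeries p E b ^ (2 * (j + 1))).trace := by
    intro b
    have hsym := bernSeries_isSymm (p := p) hE b
    have hnn : 0 ≤ (bernSeries p E b ^ (2 * (j + 1))).trace := by
      have := trace_sq_mul_pow_nonneg (E := 1) Matrix.isSymm_one hsym (even_two_mul (j + 1))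
      simpa using this
    by_cases h : ∀ x, |x ⬝ᵥ (bernSeries p E b *ᵥ x)| ≤ Real.sqrt t2 * (x ⬝ᵥ x)
    · rw [if_neg (not_not.2 h)]
      positivity
    · rw [if_pos h]
      by_contra hcon
      refine h fun x => abs_quadForm_le_of_trace_pow_le hsym (Real.sqrt_nonneg _)
        (Nat.succ_ne_zero j) ?_ x
      rw [pow_mul (Real.sqrt t2), Real.sq_sqrt ht2pos.le]
      rw [not_le, inv_mul_lt_iff₀ (by positivity), mul_one] at hcon
      exact hcon.le
  refine (bernExp_mono h0 h1 hpt).trans ?_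
  rw [bernExp_const_mul]
  have hb := bernExp_trace_pow_le_sum h0 h1 hE hc0 hEc j
  have hdeg : ∀ i, bernExp p (fun b =>
      (4 * (j + 1) * ∑ e, (boolVal (b e) + p e) * c e i) ^ (j + 1))
      ≤ t2 ^ (j + 1) * Real.exp (-3 * (j.succ : ℕ)) := by
    intro i
    simp only [mul_pow _ (∑ e, _)]
    rw [bernExp_const_mul]
    have := bernExp_degree_pow_le h0 h1 (fun e => hc0 e i) (fun e => hc1 e i) (hs i) (j + 1) hk hlam
    calc _ ≤ (4 * ((j : ℝ) + 1)) ^ (j + 1) * (lam * Real.exp (3 * B)) ^ (j + 1) := by gcongr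
      _ = _ := by
        have e3 : Real.exp (-3 * (j.succ : ℕ)) = Real.exp (-3) ^ (j + 1) := by
          rw [← Real.exp_nat_mul]; congr 1; push_cast; ring
        rw [e3, ← mul_pow, ← mul_pow, ht2]
        congr 1
        have : Real.exp (3 * B + 3) * Real.exp (-3) = Real.exp (3 * B) := by
          rw [← Real.exp_add]; congr 1; ring
        rw [mul_assoc _ (Real.exp (3 * B + 3)), this]; push_cast; ring
  have h2 := hb.trans (Finset.sum_le_sum fun i _ => hdeg i)
  rw [Finset.sum_const, Finset.card_univ, nsmul_eq_mul] at h2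
  rw [inv_mul_le_iff₀ (by positivity)]
  linarith

end SpectralMoment

/-! ### Perturbation of leading eigenvectors. -/

section SpectralPerturbation

set_option linter.unusedSectionVars false

variable {m κ : Type*} [Fintype m] [DecidableEq m]

lemma dotProduct_mulVec_comm_of_isSymm {S : Matrix m m ℝ} (hS : S.IsSymm) (x y : m → ℝ) :
    x ⬝ᵥ (S *ᵥ y) = y ⬝ᵥ (S *ᵥ x) := by
  rw [Matrix.dotProduct_mulVec, ← Matrix.mulVec_transpose, hS.eq, dotProduct_comm]

lemma dotProduct_self_nonneg (x : m → ℝ) : 0 ≤ x ⬝ᵥ x :=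
  Finset.sum_nonneg fun i _ => mul_self_nonneg (x i)

/-- Polarization with a free scaling parameter. -/
lemma two_mul_dotProduct_mulVec_le {S : Matrix m m ℝ} (hS : S.IsSymm) {w t : ℝ} (ht : 0 < t)
    {x y : m → ℝ}
    (h₁ : |(t • x + y) ⬝ᵥ (S *ᵥ (t • x + y))| ≤ w * ((t • x + y) ⬝ᵥ (t • x + y)))
    (h₂ : |(t • x - y) ⬝ᵥ (S *ᵥ (t • x - y))| ≤ w * ((t • x - y) ⬝ᵥ (t • x - y))) :
    2 * t * |x ⬝ᵥ (S *ᵥ y)| ≤ w * (t ^ 2 * (x ⬝ᵥ x) + y ⬝ᵥ y) := by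
  have hc := dotProduct_mulVec_comm_of_isSymm hS x y
  simp only [Matrix.mulVec_add, Matrix.mulVec_sub, Matrix.mulVec_smul, add_dotProduct,
    sub_dotProduct, dotProduct_add, dotProduct_sub, smul_dotProduct, dotProduct_smul,
    smul_eq_mul, ← hc, dotProduct_comm y x] at h₁ h₂
  rw [abs_le] at h₁ h₂
  have h3 : |x ⬝ᵥ (S *ᵥ y)| * (2 * t) = |2 * t * (x ⬝ᵥ (S *ᵥ y))| := by
    rw [abs_mul, abs_of_pos (by positivity : 0 < 2 * t)]; ring
  rw [mul_comm, h3, abs_le]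
  constructor <;> nlinarith [h₁.1, h₁.2, h₂.1, h₂.2]

variable {U : Matrix (Fin 2) m ℝ}

lemma mulVec_sub_proj (hU : U * Uᵀ = 1) (x : m → ℝ) : U *ᵥ (x - Uᵀ *ᵥ (U *ᵥ x)) = 0 := by
  rw [Matrix.mulVec_sub, Matrix.mulVec_mulVec, hU, Matrix.one_mulVec, sub_self]

lemma dotProduct_self_eq_add_proj (hU : U * Uᵀ = 1) (x : m → ℝ) :
    x ⬝ᵥ x = (x - Uᵀ *ᵥ (U *ᵥ x)) ⬝ᵥ (x - Uᵀ *ᵥ (U *ᵥ x)) + (U *ᵥ x) ⬝ᵥ (U *ᵥ x) := by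
  have h1 : ∀ (y : m → ℝ) (g : Fin 2 → ℝ), y ⬝ᵥ (Uᵀ *ᵥ g) = (U *ᵥ y) ⬝ᵥ g := by
    intro y g
    rw [Matrix.dotProduct_mulVec, Matrix.vecMul_transpose]
  have h2 : (Uᵀ *ᵥ (U *ᵥ x)) ⬝ᵥ x = (U *ᵥ x) ⬝ᵥ (U *ᵥ x) := by
    rw [dotProduct_comm, h1]
  have h3 : (Uᵀ *ᵥ (U *ᵥ x)) ⬝ᵥ (Uᵀ *ᵥ (U *ᵥ x)) = (U *ᵥ x) ⬝ᵥ (U *ᵥ x) := by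
    rw [h1, Matrix.mulVec_mulVec, hU, Matrix.one_mulVec]
  rw [sub_dotProduct, dotProduct_sub, dotProduct_sub, h1, h2, h3]
  ring

lemma mulVec_mulVec_eq_zero {S : Matrix m m ℝ} (hS : S.IsSymm) {ρ : Fin 2 → ℝ}
    (hρ : ∀ k, S *ᵥ U k = ρ k • U k) {x : m → ℝ} (hx : U *ᵥ x = 0) : U *ᵥ (S *ᵥ x) = 0 := by
  ext k
  have h1 : (U *ᵥ (S *ᵥ x)) k = U k ⬝ᵥ (S *ᵥ x) := rfl
  have h2 : U k ⬝ᵥ x = 0 := congrFun hx k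
  rw [h1, dotProduct_mulVec_comm_of_isSymm hS, hρ, dotProduct_smul, dotProduct_comm, h2]
  simp

/-- If all eigenvalues on the orthogonal complement of the rows of `U` are at most `w`, then so is
the quadratic form there. -/
lemma quadForm_le_of_eigenvalues_le {S : Matrix m m ℝ} (hS : S.IsSymm) (hU : U * Uᵀ = 1)
    {ρ : Fin 2 → ℝ} (hρ : ∀ k, S *ᵥ U k = ρ k • U k) {w : ℝ} (hw : 0 ≤ w)
    (h : ∀ (x : m → ℝ) (ν : ℝ), x ≠ 0 → U *ᵥ x = 0 → S *ᵥ x = ν • x → ν ≤ w)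
    {v : m → ℝ} (hv : U *ᵥ v = 0) : v ⬝ᵥ (S *ᵥ v) ≤ w * (v ⬝ᵥ v) := by
  -- `Q` projects onto the kernel of `U`. Eigenvectors of Q S Q with nonzero eigenvalue lie in that
  -- kernel and are eigenvectors of `S`; the eigenvalue 0 is covered by 0 ≤ w.
  set Q : Matrix m m ℝ := 1 - Uᵀ * U with hQ
  have hQx : ∀ x, Q *ᵥ x = x - Uᵀ *ᵥ (U *ᵥ x) := by
    intro x
    rw [hQ, Matrix.sub_mulVec, Matrix.one_mulVec, Matrix.mulVec_mulVec]
  have hQs : Qᵀ = Q := by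
    rw [hQ, Matrix.transpose_sub, Matrix.transpose_one, Matrix.transpose_mul,
      Matrix.transpose_transpose]
  have hXs : (Q * S * Q).IsSymm := by
    rw [Matrix.IsSymm, Matrix.transpose_mul, Matrix.transpose_mul, hQs, hS.eq, Matrix.mul_assoc]
  obtain ⟨V, d, hV1, hV2, hV⟩ := exists_orthogonal_diagonalization hXs
  have hX : Q * S * Q = V * Matrix.diagonal d * Vᵀ := by simpa using hV 1
  have hd : ∀ k, d k ≤ w := by
    intro k
    rcases eq_or_ne (d k) 0 with h0 | h0
    · rw [h0]; exact hw
    set x : m → ℝ := fun i => V i k with hx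
    have hxe : (Q * S * Q) *ᵥ x = d k • x := by
      have h1 : (Q * S * Q) * V = V * Matrix.diagonal d := by
        rw [hX, Matrix.mul_assoc, hV2, Matrix.mul_one]
      ext i
      have := congrFun (congrFun h1 i) k
      rw [Matrix.mul_diagonal, Matrix.mul_apply] at this
      simp only [Matrix.mulVec, dotProduct, Pi.smul_apply, smul_eq_mul]
      rw [this, mul_comm]
    have hxne : x ≠ 0 := by
      intro h1
      have h2 := congrFun (congrFun hV2 k) k
      rw [Matrix.mul_apply, Matrix.one_apply_eq] at h2
      have h3 : ∀ i, V i k = 0 := fun i => congrFun h1 i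
      simp [h3] at h2
    have hUx : U *ᵥ x = 0 := by
      have h1 : U *ᵥ ((Q * S * Q) *ᵥ x) = 0 := by
        rw [Matrix.mul_assoc, ← Matrix.mulVec_mulVec, hQx, mulVec_sub_proj hU]
      rw [hxe, Matrix.mulVec_smul] at h1
      exact (smul_eq_zero.1 h1).resolve_left h0
    have hQS : S *ᵥ x = d k • x := by
      rw [← hxe, ← Matrix.mulVec_mulVec, ← Matrix.mulVec_mulVec, hQx x, hUx, Matrix.mulVec_zero,
        sub_zero, hQx, mulVec_mulVec_eq_zero hS hρ hUx, Matrix.mulVec_zero, sub_zero]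
    exact h x (d k) hxne hUx hQS
  have hQv : Q *ᵥ v = v := by rw [hQx, hv, Matrix.mulVec_zero, sub_zero]
  have h1 : v ⬝ᵥ (S *ᵥ v) = v ⬝ᵥ ((Q * S * Q) *ᵥ v) := by
    rw [← Matrix.mulVec_mulVec, ← Matrix.mulVec_mulVec, hQv, hQx, mulVec_mulVec_eq_zero hS hρ hv,
      Matrix.mulVec_zero, sub_zero]
  have h2 : v ⬝ᵥ ((Q * S * Q) *ᵥ v) = ∑ l, d l * (Vᵀ *ᵥ v) l ^ 2 := by
    rw [hX, ← Matrix.mulVec_mulVec, ← Matrix.mulVec_mulVec, Matrix.dotProduct_mulVec,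
      ← Matrix.mulVec_transpose, dotProduct]
    refine Finset.sum_congr rfl fun l _ => ?_
    rw [Matrix.mulVec_diagonal]; ring
  have h3 : v ⬝ᵥ v = ∑ l, (Vᵀ *ᵥ v) l ^ 2 := by
    have : v ⬝ᵥ v = v ⬝ᵥ ((V * Vᵀ) *ᵥ v) := by rw [hV1, Matrix.one_mulVec]
    rw [this, ← Matrix.mulVec_mulVec, Matrix.dotProduct_mulVec, ← Matrix.mulVec_transpose,
      dotProduct]
    exact Finset.sum_congr rfl fun l _ => (sq _).symm
  rw [h1, h2, h3, Finset.mul_sum]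
  exact Finset.sum_le_sum fun l _ => mul_le_mul_of_nonneg_right (hd l) (sq_nonneg _)

/-- Weyl's inequality for the third eigenvalue: it is at most a bound of the quadratic form on a
subspace of codimension two. -/
lemma eigenvalue_le_of_quadForm_le_on_ker [Fintype κ] {S : Matrix m m ℝ}
    (hU : U * Uᵀ = 1) {ρ : Fin 2 → ℝ} (hρ : ∀ k, S *ᵥ U k = ρ k • U k) {x : m → ℝ} {ν : ℝ}
    (hx : x ≠ 0) (hUx : U *ᵥ x = 0) (hSx : S *ᵥ x = ν • x) (hν : ∀ k, ν ≤ ρ k)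
    {C : Matrix κ m ℝ} (hκ : Fintype.card κ < 3) {w : ℝ}
    (h : ∀ y, C *ᵥ y = 0 → y ⬝ᵥ (S *ᵥ y) ≤ w * (y ⬝ᵥ y)) : ν ≤ w := by
  -- Courant–Fischer: `C` has fewer than three rows, so it kills a nonzero combination of the three
  -- orthogonal eigenvectors, and there the quadratic form of `S` is at least ν times the squared
  -- norm.
  let f : (Fin 3 → ℝ) →ₗ[ℝ] (κ → ℝ) :=
    { toFun := fun a => C *ᵥ (a 0 • U 0 + a 1 • U 1 + a 2 • x)
      map_add' := fun a b => by
        rw [← Matrix.mulVec_add]; congr 1; simp only [Pi.add_apply, add_smul]; abel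
      map_smul' := fun t a => by
        rw [RingHom.id_apply, ← Matrix.mulVec_smul]; congr 1
        simp only [Pi.smul_apply, smul_eq_mul, smul_add, mul_smul] }
  have hker : LinearMap.ker f ≠ ⊥ := LinearMap.ker_ne_bot_of_finrank_lt (by simpa using hκ)
  obtain ⟨a, ha, ha0⟩ := Submodule.exists_mem_ne_zero_of_ne_bot hker
  have hfa : C *ᵥ (a 0 • U 0 + a 1 • U 1 + a 2 • x) = 0 := ha
  have hUU : ∀ k l, U k ⬝ᵥ U l = if k = l then 1 else 0 := by
    intro k l
    have := congrFun (congrFun hU k) l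
    rw [Matrix.mul_apply, Matrix.one_apply] at this
    exact this
  have h0x : ∀ k, U k ⬝ᵥ x = 0 := fun k => congrFun hUx k
  have hx0 : ∀ k, x ⬝ᵥ U k = 0 := fun k => by rw [dotProduct_comm]; exact h0x k
  have hq := h _ hfa
  have hxx : 0 < x ⬝ᵥ x := lt_of_le_of_ne (dotProduct_self_nonneg x) fun h0 =>
    hx (dotProduct_self_eq_zero.1 h0.symm)
  have e1 : (a 0 • U 0 + a 1 • U 1 + a 2 • x) ⬝ᵥ (a 0 • U 0 + a 1 • U 1 + a 2 • x)
      = a 0 ^ 2 + a 1 ^ 2 + a 2 ^ 2 * (x ⬝ᵥ x) := by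
    simp only [add_dotProduct, dotProduct_add, smul_dotProduct, dotProduct_smul, smul_eq_mul,
      hUU, h0x, hx0]
    simp; ring
  have e2 : (a 0 • U 0 + a 1 • U 1 + a 2 • x) ⬝ᵥ (S *ᵥ (a 0 • U 0 + a 1 • U 1 + a 2 • x))
      = ρ 0 * a 0 ^ 2 + ρ 1 * a 1 ^ 2 + ν * (a 2 ^ 2 * (x ⬝ᵥ x)) := by
    simp only [Matrix.mulVec_add, Matrix.mulVec_smul, hρ, hSx, add_dotProduct, dotProduct_add,
      smul_dotProduct, dotProduct_smul, smul_eq_mul, hUU, h0x, hx0]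
    simp; ring
  rw [e1, e2] at hq
  have hpos : 0 < a 0 ^ 2 + a 1 ^ 2 + a 2 ^ 2 * (x ⬝ᵥ x) := by
    by_contra hcon
    have p0 := sq_nonneg (a 0)
    have p1 := sq_nonneg (a 1)
    have p2 := mul_nonneg (sq_nonneg (a 2)) hxx.le
    have z0 : a 0 = 0 := pow_eq_zero_iff (two_ne_zero) |>.1 (by linarith)
    have z1 : a 1 = 0 := pow_eq_zero_iff (two_ne_zero) |>.1 (by linarith)
    have z2 : a 2 = 0 := by
      have : a 2 ^ 2 * (x ⬝ᵥ x) = 0 := by linarith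
      exact pow_eq_zero_iff two_ne_zero |>.1 ((mul_eq_zero.1 this).resolve_right hxx.ne')
    exact ha0 (by ext i; fin_cases i <;> simp [z0, z1, z2])
  have k0 := mul_le_mul_of_nonneg_right (hν 0) (sq_nonneg (a 0))
  have k1 := mul_le_mul_of_nonneg_right (hν 1) (sq_nonneg (a 1))
  refine le_of_mul_le_mul_right ?_ hpos
  nlinarith

/-- A Davis-Kahan bound: a vector in the range of a positive semidefinite matrix of rank at most
two is close to its projection to the leading eigenvectors of a perturbation of that matrix. -/
lemma proj_residual_le [Fintype κ] {S : Matrix m m ℝ} (hS : S.IsSymm) (hU : U * Uᵀ = 1)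
    {ρ : Fin 2 → ℝ} (hρ : ∀ k, S *ᵥ U k = ρ k • U k)
    (hlead : ∀ (v : m → ℝ) (ν : ℝ), v ≠ 0 → U *ᵥ v = 0 → S *ᵥ v = ν • v → ∀ k, ν ≤ ρ k)
    {C : Matrix κ m ℝ} (hκ : Fintype.card κ < 3) {G : Matrix κ κ ℝ} (hGs : G.IsSymm)
    (hG : ∀ y, 0 ≤ y ⬝ᵥ (G *ᵥ y)) {w : ℝ} (hw : 0 < w)
    (h : ∀ x, |x ⬝ᵥ ((S - Cᵀ * G * C) *ᵥ x)| ≤ w * (x ⬝ᵥ x)) {c y : m → ℝ}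
    (hy : (Cᵀ * G * C) *ᵥ y = c) :
    (c - Uᵀ *ᵥ (U *ᵥ c)) ⬝ᵥ (c - Uᵀ *ᵥ (U *ᵥ c)) ≤ 4 * w ^ 2 * (y ⬝ᵥ y) := by
  set P := Cᵀ * G * C with hP
  have hPx : ∀ x, x ⬝ᵥ (P *ᵥ x) = (C *ᵥ x) ⬝ᵥ (G *ᵥ (C *ᵥ x)) := by
    intro x
    rw [hP, ← Matrix.mulVec_mulVec, ← Matrix.mulVec_mulVec, Matrix.dotProduct_mulVec,
      Matrix.vecMul_transpose]
  have hPs : P.IsSymm := by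
    rw [Matrix.IsSymm, hP, Matrix.transpose_mul, Matrix.transpose_mul, hGs.eq,
      Matrix.transpose_transpose, Matrix.mul_assoc]
  have hSP : (S - P).IsSymm := hS.sub hPs
  -- The lower bound uses P ≥ 0; the upper bound uses that P vanishes on the kernel of `C`, whose
  -- codimension is at most two.
  have hker : ∀ v, U *ᵥ v = 0 → |v ⬝ᵥ (S *ᵥ v)| ≤ w * (v ⬝ᵥ v) := by
    intro v hv
    rw [abs_le]
    constructor
    · have h1 := (abs_le.1 (h v)).1
      rw [Matrix.sub_mulVec, dotProduct_sub, hPx] at h1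
      linarith [hG (C *ᵥ v)]
    · refine quadForm_le_of_eigenvalues_le hS hU hρ hw.le (fun x ν hx hUx hSx => ?_) hv
      refine eigenvalue_le_of_quadForm_le_on_ker hU hρ hx hUx hSx (hlead x ν hx hUx hSx) hκ
        (C := C) fun z hz => ?_
      have h1 := (abs_le.1 (h z)).2
      rw [Matrix.sub_mulVec, dotProduct_sub, hPx, hz] at h1
      simpa using h1
  set v := c - Uᵀ *ᵥ (U *ᵥ c) with hv
  set z := y - Uᵀ *ᵥ (U *ᵥ y) with hz
  have hUv : U *ᵥ v = 0 := mulVec_sub_proj hU c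
  have hUz : U *ᵥ z = 0 := mulVec_sub_proj hU y
  have e1 : v ⬝ᵥ v = v ⬝ᵥ c := by
    have : v ⬝ᵥ (Uᵀ *ᵥ (U *ᵥ c)) = 0 := by
      rw [Matrix.dotProduct_mulVec, Matrix.vecMul_transpose, hUv, zero_dotProduct]
    nth_rewrite 2 [hv]
    rw [dotProduct_sub, this, sub_zero]
  -- Write c = P y = S y − (S − P) y; the component of y in the row space of `U` drops out because
  -- `S` preserves that space. Both remaining pairings are small, and no spectral gap enters except
  -- through the size of y.
  have e2 : v ⬝ᵥ c = v ⬝ᵥ (S *ᵥ z) - v ⬝ᵥ ((S - P) *ᵥ y) := by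
    have : v ⬝ᵥ (S *ᵥ (Uᵀ *ᵥ (U *ᵥ y))) = 0 := by
      rw [dotProduct_mulVec_comm_of_isSymm hS, dotProduct_comm, Matrix.dotProduct_mulVec,
        Matrix.vecMul_transpose, mulVec_mulVec_eq_zero hS hρ hUv, zero_dotProduct]
    rw [hz, Matrix.mulVec_sub, dotProduct_sub, this, Matrix.sub_mulVec, dotProduct_sub, hy]
    ring
  -- With this scaling, the two polarized bounds together return half of ‖v‖², which is absorbed on
  -- the left.
  have ht : 0 < 1 / (2 * w) := by positivity
  have b1 := two_mul_dotProduct_mulVec_le hS ht (x := v) (y := z) (w := w)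
    (hker _ (by rw [Matrix.mulVec_add, Matrix.mulVec_smul, hUv, hUz]; simp))
    (hker _ (by rw [Matrix.mulVec_sub, Matrix.mulVec_smul, hUv, hUz]; simp))
  have b2 := two_mul_dotProduct_mulVec_le hSP ht (x := v) (y := y) (h _) (h _)
  have b3 : z ⬝ᵥ z ≤ y ⬝ᵥ y := by
    have := dotProduct_self_eq_add_proj hU y
    have := dotProduct_self_nonneg (U *ᵥ y)
    linarith
  have a1 := le_abs_self (v ⬝ᵥ (S *ᵥ z))
  have a2 := neg_abs_le (v ⬝ᵥ ((S - P) *ᵥ y))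
  have e3 : v ⬝ᵥ v ≤ |v ⬝ᵥ (S *ᵥ z)| + |v ⬝ᵥ ((S - P) *ᵥ y)| := by rw [e1, e2]; linarith
  have e4 : 2 * (1 / (2 * w)) * (v ⬝ᵥ v)
      ≤ w * ((1 / (2 * w)) ^ 2 * (v ⬝ᵥ v) + y ⬝ᵥ y) * 2 := by
    have := mul_le_mul_of_nonneg_left e3 (by positivity : 0 ≤ 2 * (1 / (2 * w)))
    have := mul_le_mul_of_nonneg_left b3 hw.le
    nlinarith
  have e5 := mul_le_mul_of_nonneg_left e4 (by positivity : 0 ≤ 2 * w)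
  have e6 : 2 * w * (2 * (1 / (2 * w)) * (v ⬝ᵥ v)) = 2 * (v ⬝ᵥ v) := by field_simp
  have e7 : 2 * w * (w * ((1 / (2 * w)) ^ 2 * (v ⬝ᵥ v) + y ⬝ᵥ y) * 2)
      = v ⬝ᵥ v + 4 * w ^ 2 * (y ⬝ᵥ y) := by field_simp; ring
  linarith

end SpectralPerturbation

/-! ### Extreme points of the projected cube and a competitor close to the true labels. -/

section Vertex

variable {n : ℕ}

lemma exists_unit_of_mem_extremePoints_Icc {t : ℝ}
    (ht : t ∈ Set.extremePoints ℝ (Set.Icc (-1 : ℝ) 1)) : ∃ u : ℤˣ, ((u : ℤ) : ℝ) = t := by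
  obtain ⟨⟨h1, h2⟩, h3⟩ := mem_extremePoints.1 ht
  by_contra hcon
  have n1 : t ≠ 1 := fun h => hcon ⟨1, by simp [h]⟩
  have n2 : t ≠ -1 := fun h => hcon ⟨-1, by simp [h]⟩
  have l1 : t < 1 := lt_of_le_of_ne h2 n1
  have l2 : -1 < t := lt_of_le_of_ne h1 (Ne.symm n2)
  have := (h3 (-1) (by simp) 1 (by simp) (by
    rw [openSegment_eq_Ioo (by norm_num : (-1 : ℝ) < 1)]; exact ⟨l2, l1⟩)).1
  exact n2 this.symm

/-- Every linear functional on a projected cube is maximized at the projection of some vertex that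
is an extreme point. -/
lemma exists_extremeLabels_dotProduct_ge (U : Matrix (Fin 2) (Fin n) ℝ) (g : Fin 2 → ℝ)
    (c : Labels n) : ∃ e ∈ extremeLabels U, g ⬝ᵥ (U *ᵥ c.toVec) ≤ g ⬝ᵥ (U *ᵥ e.toVec) := by
  let f : (Fin n → ℝ) →L[ℝ] (Fin 2 → ℝ) := LinearMap.toContinuousLinearMap (Matrix.mulVecLin U)
  have hf : ∀ v, f v = U *ᵥ v := fun v => rfl
  let l : StrongDual ℝ (Fin 2 → ℝ) := LinearMap.toContinuousLinearMap
    { toFun := fun y => g ⬝ᵥ y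
      map_add' := fun x y => dotProduct_add _ _ _
      map_smul' := fun t y => dotProduct_smul _ _ _ }
  have hl : ∀ y, l y = g ⬝ᵥ y := fun y => rfl
  set K := (fun v : Fin n → ℝ => U *ᵥ v) '' Set.Icc (-1 : Fin n → ℝ) 1 with hK
  have hKc : IsCompact K := isCompact_Icc.image f.continuous
  have hcK : U *ᵥ c.toVec ∈ K := by
    refine ⟨c.toVec, ⟨fun i => ?_, fun i => ?_⟩, rfl⟩ <;>
    · rcases Int.units_eq_one_or (c i) with h | h <;> simp [Labels.toVec, h]
  obtain ⟨y, hyK, hy⟩ := hKc.exists_isMaxOn ⟨_, hcK⟩ l.continuous.continuousOn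
  -- The maximizers of `l` form a compact exposed face. An extreme point of this face is extreme in
  -- K, and it lifts to an extreme point of the cube, that is, to a sign vector.
  have hex : IsExposed ℝ K (l.toExposed K) := ContinuousLinearMap.toExposed.isExposed
  obtain ⟨z, hz⟩ := (hex.isCompact hKc).extremePoints_nonempty ⟨y, hyK, fun x hx => hy hx⟩
  have hzK : z ∈ Set.extremePoints ℝ K := hex.isExtreme.extremePoints_subset_extremePoints hz
  obtain ⟨v, hv, hvz⟩ := surjOn_extremePoints_image (f.toContinuousAffineMap)
    (isCompact_Icc (a := (-1 : Fin n → ℝ)) (b := 1)) hzK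
  have hv' : ∀ i, ∃ u : ℤˣ, ((u : ℤ) : ℝ) = v i := by
    intro i
    rw [← Set.pi_univ_Icc, extremePoints_pi] at hv
    exact exists_unit_of_mem_extremePoints_Icc (hv i (Set.mem_univ i))
  choose e he using hv'
  have hev : Labels.toVec e = v := funext he
  have hUe : U *ᵥ Labels.toVec e = z := by rw [hev]; exact hvz
  refine ⟨e, ?_, ?_⟩
  · rw [← hUe] at hzK; exact hzK
  · rw [hUe]
    exact (extremePoints_subset hz).2 _ hcK

lemma abs_dotProduct_mulVec_le_opNorm (M : Matrix (Fin 2) (Fin n) ℝ) (g : Fin 2 → ℝ)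
    (d : Fin n → ℝ) :
    |g ⬝ᵥ (M *ᵥ d)| ≤ Real.sqrt (g ⬝ᵥ g) * (‖M‖ * Real.sqrt (d ⬝ᵥ d)) := by
  have hn : ∀ {ι : Type} [Fintype ι] (x : ι → ℝ),
      ‖(WithLp.toLp 2 x : EuclideanSpace ℝ ι)‖ = Real.sqrt (x ⬝ᵥ x) := by
    intro ι _ x
    rw [EuclideanSpace.norm_eq]
    congr 1
    exact Finset.sum_congr rfl fun i _ => by rw [Real.norm_eq_abs, sq_abs]; exact sq _
  have h1 : ‖(WithLp.toLp 2 (M *ᵥ d) : EuclideanSpace ℝ (Fin 2))‖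
      ≤ ‖M‖ * ‖(WithLp.toLp 2 d : EuclideanSpace ℝ (Fin n))‖ :=
    Matrix.l2_opNorm_mulVec M (WithLp.toLp 2 d)
  have h2 := abs_real_inner_le_norm (WithLp.toLp 2 g : EuclideanSpace ℝ (Fin 2))
    (WithLp.toLp 2 (M *ᵥ d))
  have h3 : inner ℝ (WithLp.toLp 2 g : EuclideanSpace ℝ (Fin 2)) (WithLp.toLp 2 (M *ᵥ d))
      = g ⬝ᵥ (M *ᵥ d) := by
    rw [EuclideanSpace.inner_toLp_toLp, dotProduct_comm]; simp
  rw [h3, hn] at h2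
  rw [hn d] at h1
  exact h2.trans (mul_le_mul_of_nonneg_left h1 (Real.sqrt_nonneg _))

lemma toVec_dotProduct_self (c : Labels n) : c.toVec ⬝ᵥ c.toVec = n := by
  have : ∀ i, c.toVec i * c.toVec i = 1 := by
    intro i
    rcases Int.units_eq_one_or (c i) with h | h <;> simp [Labels.toVec, h]
  simp [dotProduct, this]

lemma toVec_sub_dotProduct_self (c e : Labels n) :
    (c.toVec - e.toVec) ⬝ᵥ (c.toVec - e.toVec)
      = 4 * ((Finset.univ.filter fun i => e i ≠ c i).card : ℝ) := by
  rw [Finset.card_filter, Nat.cast_sum, Finset.mul_sum]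
  refine Finset.sum_congr rfl fun i _ => ?_
  rcases Int.units_eq_one_or (c i) with h | h <;> rcases Int.units_eq_one_or (e i) with h' | h' <;>
    simp [Labels.toVec, h, h'] <;> norm_num

/-- Some label vector at an extreme point of the projected cube is close to `c`, if `c` is close to
the row space of a matrix near the projection. -/
lemma exists_extremeLabels_card_ne_le {U : Matrix (Fin 2) (Fin n) ℝ} (hU : U * Uᵀ = 1)
    (U' : Matrix (Fin 2) (Fin n) ℝ) (c : Labels n) :
    ∃ e ∈ extremeLabels U', ((Finset.univ.filter fun i => e i ≠ c i).card : ℝ) ≤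
      2 * ((c.toVec - Uᵀ *ᵥ (U *ᵥ c.toVec)) ⬝ᵥ (c.toVec - Uᵀ *ᵥ (U *ᵥ c.toVec)))
        + 2 * ‖U' - U‖ ^ 2 * n := by
  set v := c.toVec - Uᵀ *ᵥ (U *ᵥ c.toVec) with hv
  set g := U *ᵥ c.toVec with hg
  obtain ⟨e, he, hge⟩ := exists_extremeLabels_dotProduct_ge U' g c
  refine ⟨e, he, ?_⟩
  set d := c.toVec - e.toVec with hd
  set ε := ‖U' - U‖ with hε
  have hcard := toVec_sub_dotProduct_self c e
  rw [← hd] at hcard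
  have hnn : g ⬝ᵥ g ≤ n := by
    have h1 := dotProduct_self_eq_add_proj hU c.toVec
    have h2 := dotProduct_self_nonneg v
    rw [toVec_dotProduct_self] at h1
    linarith
  have h1 : c.toVec ⬝ᵥ d = (d ⬝ᵥ d) / 2 := by
    have e1 := toVec_dotProduct_self c
    have e2 := toVec_dotProduct_self e
    simp only [hd, dotProduct_sub, sub_dotProduct, e1, e2, dotProduct_comm e.toVec c.toVec]
    ring
  -- Split c = v + Uᵀ g and replace `U` by `U'`. The middle term is at most 0 by the choice of `e`,
  -- which leaves ‖d‖²/2 ≤ (‖v‖ + √n ε)‖d‖.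
  have h2 : c.toVec ⬝ᵥ d = v ⬝ᵥ d + g ⬝ᵥ (U' *ᵥ d) - g ⬝ᵥ ((U' - U) *ᵥ d) := by
    have e1 : (Uᵀ *ᵥ g) ⬝ᵥ d = g ⬝ᵥ (U *ᵥ d) := by
      rw [dotProduct_comm, Matrix.dotProduct_mulVec, Matrix.vecMul_transpose, dotProduct_comm]
    have e2 : g ⬝ᵥ ((U' - U) *ᵥ d) = g ⬝ᵥ (U' *ᵥ d) - g ⬝ᵥ (U *ᵥ d) := by
      rw [Matrix.sub_mulVec, dotProduct_sub]
    have e3 : v ⬝ᵥ d = c.toVec ⬝ᵥ d - g ⬝ᵥ (U *ᵥ d) := by rw [hv, sub_dotProduct, e1]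
    rw [e2, e3]
    ring
  have h3 : g ⬝ᵥ (U' *ᵥ d) ≤ 0 := by
    rw [hd, Matrix.mulVec_sub, dotProduct_sub]; linarith
  have h4 := abs_dotProduct_mulVec_le_opNorm (U' - U) g d
  have h5 : v ⬝ᵥ d ≤ Real.sqrt (v ⬝ᵥ v) * Real.sqrt (d ⬝ᵥ d) := by
    rw [← Real.sqrt_mul (dotProduct_self_nonneg v)]
    refine Real.le_sqrt_of_sq_le ?_
    have := Finset.sum_mul_sq_le_sq_mul_sq Finset.univ v d
    simpa only [dotProduct, sq] using this
  have h6 : Real.sqrt (g ⬝ᵥ g) ≤ Real.sqrt n := Real.sqrt_le_sqrt hnn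
  set D := Real.sqrt (d ⬝ᵥ d)
  set V := Real.sqrt (v ⬝ᵥ v)
  have hD : D ^ 2 = d ⬝ᵥ d := Real.sq_sqrt (dotProduct_self_nonneg d)
  have hV : V ^ 2 = v ⬝ᵥ v := Real.sq_sqrt (dotProduct_self_nonneg v)
  have hD0 : 0 ≤ D := Real.sqrt_nonneg _
  have hV0 : 0 ≤ V := Real.sqrt_nonneg _
  have hε0 : 0 ≤ ε := norm_nonneg _
  have hN : Real.sqrt n ^ 2 = n := Real.sq_sqrt (Nat.cast_nonneg n)
  have hN0 : 0 ≤ Real.sqrt n := Real.sqrt_nonneg _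
  have h7 : D ^ 2 / 2 ≤ (V + Real.sqrt n * ε) * D := by
    have e1 := neg_abs_le (g ⬝ᵥ ((U' - U) *ᵥ d))
    have e2 : Real.sqrt (g ⬝ᵥ g) * (ε * D) ≤ Real.sqrt n * (ε * D) := by gcongr
    rw [hD]
    nlinarith
  have h8 : D ≤ 2 * (V + Real.sqrt n * ε) := by
    rcases hD0.eq_or_lt with h0 | h0
    · rw [← h0]; positivity
    · nlinarith
  have h9 : D ^ 2 ≤ (2 * (V + Real.sqrt n * ε)) ^ 2 := by gcongr
  have h10 : 0 ≤ (V - Real.sqrt n * ε) ^ 2 := sq_nonneg _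
  have h11 : (Real.sqrt n * ε) ^ 2 = ε ^ 2 * n := by rw [mul_pow, hN]; ring
  nlinarith

end Vertex

/-! ### Scalar inequalities for x log x. -/

section RealInequalities

/-- The Poisson divergence p log(p/μ) − p + μ dominates the Hellinger term (√p − √μ)², which is at
least (p − μ)²/(4B). The last hypothesis excludes the case where the convention `Real.log 0 = 0`
would break this. -/
lemma sub_add_sq_le_mul_log_sub_log {p μ B : ℝ} (hp : 0 ≤ p) (hμ : 0 ≤ μ) (hpB : p ≤ B)
    (hμB : μ ≤ B) (hB : 0 < B) (h : μ = 0 → p = 0) :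
    p - μ + (p - μ) ^ 2 / (4 * B) ≤ p * (Real.log p - Real.log μ) := by
  obtain ⟨s, hs, rfl⟩ : ∃ s, 0 ≤ s ∧ p = s ^ 2 := ⟨_, Real.sqrt_nonneg p, (Real.sq_sqrt hp).symm⟩
  obtain ⟨t, ht, rfl⟩ : ∃ t, 0 ≤ t ∧ μ = t ^ 2 := ⟨_, Real.sqrt_nonneg μ, (Real.sq_sqrt hμ).symm⟩
  have h1 : (s ^ 2 - t ^ 2) ^ 2 / (4 * B) ≤ (s - t) ^ 2 := by
    rw [div_le_iff₀ (by positivity)]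
    have e1 : (s ^ 2 - t ^ 2) ^ 2 = (s - t) ^ 2 * (s + t) ^ 2 := by ring
    rw [e1]
    refine mul_le_mul_of_nonneg_left ?_ (sq_nonneg _)
    nlinarith [sq_nonneg (s - t)]
  have h2 : 2 * s ^ 2 - 2 * s * t ≤ s ^ 2 * (Real.log (s ^ 2) - Real.log (t ^ 2)) := by
    rcases hs.eq_or_lt with h0 | h0
    · rw [← h0]; simp
    · have ht0 : 0 < t := by
        refine lt_of_le_of_ne ht fun h3 => ?_
        have := h (by rw [← h3]; simp)
        exact h0.ne' (pow_eq_zero_iff two_ne_zero |>.1 this)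
      have h4 := Real.log_le_sub_one_of_pos (div_pos ht0 h0)
      rw [Real.log_div ht0.ne' h0.ne'] at h4
      rw [Real.log_pow, Real.log_pow]
      have h5 := mul_le_mul_of_nonneg_left h4 (by positivity : 0 ≤ 2 * s ^ 2)
      have h6 : 2 * s ^ 2 * (t / s - 1) = 2 * s * t - 2 * s ^ 2 := by field_simp
      push_cast
      nlinarith
  nlinarith

lemma mul_log_div_le_sub {s M : ℝ} (hs : 0 < s) (hM : 0 < M) : s * Real.log (M / s) ≤ M - s := by
  have h := mul_le_mul_of_nonneg_left (Real.log_le_sub_one_of_pos (div_pos hM hs)) hs.le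
  have : s * (M / s - 1) = M - s := by field_simp
  linarith

/-- For t ≥ n⁻² the logarithm is at least −2L; for smaller t, t log t ≥ −2√t ≥ −2/n, which is at
least −2η. -/
lemma neg_le_mul_log {t η L : ℝ} {n : ℕ} (hn : 0 < n) (ht : 0 ≤ t) (htη : t ≤ η)
    (hη : 1 / (n : ℝ) ≤ η) (hL : L = Real.log n) (hL1 : 1 ≤ L) : -(4 * η * L) ≤ t * Real.log t := by
  have hn' : (0 : ℝ) < n := Nat.cast_pos.2 hn
  have hη0 : 0 < η := lt_of_lt_of_le (by positivity) hη
  rcases ht.eq_or_lt with h0 | h0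
  · rw [← h0]; simp; positivity
  rcases le_total (1 / (n : ℝ) ^ 2) t with h | h
  · have h1 : -(2 * L) ≤ Real.log t := by
      have := Real.log_le_log (by positivity) h
      rw [Real.log_div one_ne_zero (by positivity), Real.log_one, Real.log_pow] at this
      rw [hL]; push_cast at this; linarith
    have h2 := mul_le_mul_of_nonneg_left h1 ht
    have h3 := mul_le_mul_of_nonneg_right htη (by linarith : 0 ≤ L)
    have : 0 ≤ η * L := by positivity
    nlinarith
  · have hst : Real.sqrt t ≤ 1 / n := by
      rw [Real.sqrt_le_left (by positivity)]; rwa [div_pow, one_pow]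
    have hs0 : 0 < Real.sqrt t := Real.sqrt_pos.2 h0
    have h1 := Real.log_le_sub_one_of_pos (inv_pos.2 hs0)
    rw [Real.log_inv, Real.log_sqrt h0.le] at h1
    have h2 := mul_le_mul_of_nonneg_left h1 ht
    have h3 : t * (Real.sqrt t)⁻¹ = Real.sqrt t := by
      nth_rewrite 1 [← Real.mul_self_sqrt ht]; field_simp
    have : η ≤ η * L := le_mul_of_one_le_right hη0.le hL1
    nlinarith

/-- A modulus of continuity of `x log (x / m)` at the scale `1 / n`. -/
lemma abs_mul_log_div_sub_le {x y m η L B : ℝ} {n : ℕ} (hn : 0 < n) (hx : 0 ≤ x) (hy : 0 ≤ y)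
    (hxB : x ≤ B) (hyB : y ≤ B) (hxy : |x - y| ≤ η) (hη : 1 / (n : ℝ) ≤ η) (hL : L = Real.log n)
    (hL1 : 1 ≤ L) (hm : 1 / (n : ℝ) ^ 2 ≤ m) (hm1 : m ≤ 1) :
    |x * Real.log (x / m) - y * Real.log (y / m)| ≤ (B + 4) * η * L := by
  wlog h : x ≤ y generalizing x y
  · rw [abs_sub_comm] at hxy ⊢
    exact this hy hx hyB hxB hxy (le_of_not_ge h)
  have hn' : (0 : ℝ) < n := Nat.cast_pos.2 hn
  have hη0 : 0 < η := lt_of_lt_of_le (by positivity) hη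
  have hm0 : 0 < m := lt_of_lt_of_le (by positivity) hm
  have hB : 0 ≤ B := hx.trans hxB
  have hd : y - x ≤ η := by rw [abs_sub_comm] at hxy; exact (le_abs_self _).trans hxy
  rcases hy.eq_or_lt with h0 | hy0
  · have : x = 0 := le_antisymm (h.trans h0.ge) hx
    rw [this, ← h0]; simp; positivity
  have hlm : -(2 * L) ≤ Real.log m := by
    have := Real.log_le_log (by positivity) hm
    rw [Real.log_div one_ne_zero (by positivity), Real.log_one, Real.log_pow] at this
    rw [hL]; push_cast at this; linarith
  have hly : Real.log y ≤ B - 1 := (Real.log_le_sub_one_of_pos hy0).trans (by linarith)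
  have hdiv : Real.log (y / m) = Real.log y - Real.log m := Real.log_div hy0.ne' hm0.ne'
  -- With u = x log(y/x) the increment becomes (y − x) log(y/m) + u. Only the first term can be of
  -- logarithmic size.
  have hx' : ∃ u, 0 ≤ u ∧ u ≤ y - x ∧ x * Real.log (x / m) = x * Real.log (y / m) - u := by
    rcases hx.eq_or_lt with h0 | hx0
    · exact ⟨0, le_rfl, by linarith, by rw [← h0]; simp⟩
    · refine ⟨x * Real.log (y / x), ?_, mul_log_div_le_sub hx0 hy0, ?_⟩
      · exact mul_nonneg hx (Real.log_nonneg ((one_le_div hx0).2 h))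
      · rw [Real.log_div hx0.ne' hm0.ne', hdiv, Real.log_div hy0.ne' hx0.ne']; ring
  obtain ⟨u, hu0, hu1, hu⟩ := hx'
  have hlow : -(4 * η * L) ≤ (y - x) * Real.log (y / m) := by
    refine (neg_le_mul_log hn (sub_nonneg.2 h) hd hη hL hL1).trans ?_
    rcases (sub_nonneg.2 h).eq_or_lt with h0 | h0
    · rw [← h0]; simp
    · refine mul_le_mul_of_nonneg_left (Real.log_le_log h0 ?_) h0.le
      rw [le_div_iff₀ hm0]; nlinarith
  have hup : (y - x) * Real.log (y / m) + (y - x) ≤ η * ((B + 2) * L) := by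
    have h1 : Real.log (y / m) + 1 ≤ (B + 2) * L := by rw [hdiv]; nlinarith
    calc _ = (y - x) * (Real.log (y / m) + 1) := by ring
      _ ≤ (y - x) * ((B + 2) * L) := mul_le_mul_of_nonneg_left h1 (sub_nonneg.2 h)
      _ ≤ _ := by
        refine mul_le_mul_of_nonneg_right hd ?_
        have : 0 ≤ L := by linarith
        positivity
  have hηL : 0 ≤ η * L := by have : 0 ≤ L := by linarith
                             positivity
  have hBηL : 0 ≤ B * (η * L) := mul_nonneg hB hηL
  rw [hu, abs_le]
  constructor <;> nlinarith

end RealInequalities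

/-! ### The population likelihood: upper and lower bounds for its loss. -/

section PopulationLikelihood

variable {κ : Type*} [Fintype κ]

/-- The expected edge density between two classes of a labelling with confusion matrix `R`. -/
def confusedEdges (p R : κ → κ → ℝ) (k l : κ) : ℝ := ∑ q : κ × κ, R k q.1 * R l q.2 * p q.1 q.2

/-- The product of the sizes of two classes of a labelling with confusion matrix `R`. -/
def classProduct (R : κ → κ → ℝ) (k l : κ) : ℝ := (∑ a, R k a) * ∑ b, R l b

/-- The population profile likelihood of a labelling with confusion matrix `R`. -/
noncomputable def populationLik (p R : κ → κ → ℝ) : ℝ :=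
  ∑ k, ∑ l, confusedEdges p R k l * Real.log (confusedEdges p R k l / classProduct R k l)

/-- The population profile likelihood of the true labelling. -/
noncomputable def trueLik (p R : κ → κ → ℝ) : ℝ :=
  ∑ q : κ × κ, (∑ k, R k q.1) * (∑ l, R l q.2) * (p q.1 q.2 * Real.log (p q.1 q.2))

variable {p R : κ → κ → ℝ}

lemma classProduct_eq_sum (R : κ → κ → ℝ) (k l : κ) :
    classProduct R k l = ∑ q : κ × κ, R k q.1 * R l q.2 := by
  rw [classProduct, Finset.sum_mul_sum, Fintype.sum_prod_type]

/-- The loss is a sum of divergences of the true probabilities from their class averages, the form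
in which both bounds are proved. -/
lemma trueLik_sub_populationLik (p R : κ → κ → ℝ) :
    trueLik p R - populationLik p R = ∑ k, ∑ l, ∑ q : κ × κ, R k q.1 * R l q.2 *
      (p q.1 q.2 * (Real.log (p q.1 q.2) -
        Real.log (confusedEdges p R k l / classProduct R k l))) := by
  have h1 : trueLik p R = ∑ k, ∑ l, ∑ q : κ × κ, R k q.1 * R l q.2 *
      (p q.1 q.2 * Real.log (p q.1 q.2)) := by
    have : ∀ k, ∑ l, ∑ q : κ × κ, R k q.1 * R l q.2 * (p q.1 q.2 * Real.log (p q.1 q.2))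
        = ∑ q : κ × κ, ∑ l, R k q.1 * R l q.2 * (p q.1 q.2 * Real.log (p q.1 q.2)) :=
      fun k => Finset.sum_comm
    simp only [this]
    rw [Finset.sum_comm, trueLik]
    refine Finset.sum_congr rfl fun q _ => ?_
    rw [Finset.sum_mul_sum, Finset.sum_mul]
    refine Finset.sum_congr rfl fun k _ => ?_
    rw [Finset.sum_mul]
  rw [h1, populationLik, ← Finset.sum_sub_distrib]
  refine Finset.sum_congr rfl fun k _ => ?_
  rw [← Finset.sum_sub_distrib]
  refine Finset.sum_congr rfl fun l _ => ?_
  nth_rewrite 1 [confusedEdges]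
  rw [Finset.sum_mul, ← Finset.sum_sub_distrib]
  exact Finset.sum_congr rfl fun q _ => by ring

lemma classProduct_nonneg (hR : ∀ k a, 0 ≤ R k a) (k l : κ) : 0 ≤ classProduct R k l :=
  mul_nonneg (Finset.sum_nonneg fun _ _ => hR _ _) (Finset.sum_nonneg fun _ _ => hR _ _)

lemma confusedEdges_nonneg (hp : ∀ a b, 0 ≤ p a b) (hR : ∀ k a, 0 ≤ R k a) (k l : κ) :
    0 ≤ confusedEdges p R k l :=
  Finset.sum_nonneg fun _ _ => mul_nonneg (mul_nonneg (hR _ _) (hR _ _)) (hp _ _)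

lemma confusedEdges_le {B : ℝ} (hpB : ∀ a b, p a b ≤ B) (hR : ∀ k a, 0 ≤ R k a) (k l : κ) :
    confusedEdges p R k l ≤ B * classProduct R k l := by
  rw [classProduct_eq_sum, Finset.mul_sum]
  refine Finset.sum_le_sum fun q _ => ?_
  have := mul_le_mul_of_nonneg_left (hpB q.1 q.2) (mul_nonneg (hR k q.1) (hR l q.2))
  linarith

lemma mul_le_confusedEdges (hp : ∀ a b, 0 ≤ p a b) (hR : ∀ k a, 0 ≤ R k a) (k l a b : κ) :
    R k a * R l b * p a b ≤ confusedEdges p R k l :=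
  Finset.single_le_sum (f := fun q : κ × κ => R k q.1 * R l q.2 * p q.1 q.2)
    (fun _ _ => mul_nonneg (mul_nonneg (hR _ _) (hR _ _)) (hp _ _)) (Finset.mem_univ (a, b))

lemma mul_le_classProduct (hR : ∀ k a, 0 ≤ R k a) (k l a b : κ) :
    R k a * R l b ≤ classProduct R k l := by
  rw [classProduct_eq_sum]
  exact Finset.single_le_sum (f := fun q : κ × κ => R k q.1 * R l q.2)
    (fun _ _ => mul_nonneg (hR _ _) (hR _ _)) (Finset.mem_univ (a, b))

/-- The loss of population likelihood controls the variance of the connection probabilities within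
the classes. -/
lemma sum_sq_le_trueLik_sub_populationLik (hp : ∀ a b, 0 ≤ p a b) {B : ℝ} (hB : 0 < B)
    (hpB : ∀ a b, p a b ≤ B) (hR : ∀ k a, 0 ≤ R k a) :
    ∑ k, ∑ l, ∑ q : κ × κ, R k q.1 * R l q.2 *
      (p q.1 q.2 - confusedEdges p R k l / classProduct R k l) ^ 2 / (4 * B)
      ≤ trueLik p R - populationLik p R := by
  rw [trueLik_sub_populationLik]
  refine Finset.sum_le_sum fun k _ => Finset.sum_le_sum fun l _ => ?_
  set x := confusedEdges p R k l with hx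
  set M := classProduct R k l with hM
  have hM0 : 0 ≤ M := classProduct_nonneg hR k l
  have hx0 : 0 ≤ x := confusedEdges_nonneg hp hR k l
  -- x / M is the weighted mean of p over the block, so linear terms may be added for free and the
  -- scalar divergence bound applies termwise. An empty block has x = M = 0.
  have hzero : ∑ q : κ × κ, R k q.1 * R l q.2 * (p q.1 q.2 - x / M) = 0 := by
    have h1 : ∑ q : κ × κ, R k q.1 * R l q.2 * (p q.1 q.2 - x / M) = x - M * (x / M) := by
      rw [hM, classProduct_eq_sum, Finset.sum_mul, hx, confusedEdges, ← Finset.sum_sub_distrib]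
      exact Finset.sum_congr rfl fun q _ => by ring
    rw [h1]
    rcases hM0.eq_or_lt with h0 | h0
    · have : x ≤ B * M := confusedEdges_le hpB hR k l
      rw [← h0] at this ⊢
      linarith
    · field_simp; ring
  rw [← zero_add (∑ q : κ × κ, _), ← hzero, ← Finset.sum_add_distrib]
  refine Finset.sum_le_sum fun q _ => ?_
  rw [mul_div_assoc, ← mul_add]
  rcases (mul_nonneg (hR k q.1) (hR l q.2)).eq_or_lt with h0 | h0
  · rw [← h0, zero_mul, zero_mul]
  refine mul_le_mul_of_nonneg_left ?_ h0.le
  have hMpos : 0 < M := lt_of_lt_of_le h0 (mul_le_classProduct hR k l q.1 q.2)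
  refine sub_add_sq_le_mul_log_sub_log (hp _ _) (div_nonneg hx0 hM0) (hpB _ _) ?_ hB fun h => ?_
  · rw [div_le_iff₀ hMpos]; exact confusedEdges_le hpB hR k l
  · have hx00 : x = 0 := by
      rcases div_eq_zero_iff.1 h with h | h
      · exact h
      · exact absurd h hMpos.ne'
    have h2 := mul_le_confusedEdges hp hR k l q.1 q.2
    rw [← hx, hx00] at h2
    have h3 := hp q.1 q.2
    by_contra hne
    have := mul_pos h0 (lt_of_le_of_ne h3 (Ne.symm hne))
    linarith

/-- The loss of population likelihood of a labelling is at most of the order of the number of its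
errors, up to a logarithm. -/
lemma trueLik_sub_populationLik_le [DecidableEq κ] (hp : ∀ a b, 0 ≤ p a b) {B : ℝ} (hB : 0 < B)
    (hpB : ∀ a b, p a b ≤ B) (hR : ∀ k a, 0 ≤ R k a) (hsum : ∑ k, ∑ a, R k a = 1) {n : ℕ}
    (hn : 0 < n) (hRn : ∀ k a, R k a = 0 ∨ 1 / (n : ℝ) ≤ R k a) :
    trueLik p R - populationLik p R ≤ 2 * B * (1 + 2 * Real.log n) * (1 - ∑ k, R k k) := by
  have hn' : (0 : ℝ) < n := Nat.cast_pos.2 hn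
  have hlog : 0 ≤ Real.log n := Real.log_natCast_nonneg n
  have hcl1 : ∀ k, ∑ a, R k a ≤ 1 := fun k => by
    rw [← hsum]
    exact Finset.single_le_sum (f := fun k => ∑ a, R k a)
      (fun k _ => Finset.sum_nonneg fun a _ => hR k a) (Finset.mem_univ k)
  have hM1 : ∀ k l, classProduct R k l ≤ 1 := fun k l =>
    mul_le_one₀ (hcl1 k) (Finset.sum_nonneg fun _ _ => hR _ _) (hcl1 l)
  -- Each term is at most B s log(M/s). For the correctly labelled pair (k, l) the bound B(M − s) is
  -- used, and for the wrong pairs 2B s log n, since a nonzero s is at least n⁻². Both are linear in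
  -- the mass of wrong pairs.
  have hterm : ∀ k l, ∀ q : κ × κ, ∃ s M : ℝ, s = R k q.1 * R l q.2 ∧ M = classProduct R k l ∧
      s * (p q.1 q.2 * (Real.log (p q.1 q.2) -
        Real.log (confusedEdges p R k l / classProduct R k l))) ≤ B * (M - s) ∧
      s * (p q.1 q.2 * (Real.log (p q.1 q.2) -
        Real.log (confusedEdges p R k l / classProduct R k l))) ≤ 2 * B * Real.log n * s := by
    intro k l q
    refine ⟨_, _, rfl, rfl, ?_⟩
    set s := R k q.1 * R l q.2 with hs
    set M := classProduct R k l
    set x := confusedEdges p R k l with hx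
    have hs0 : 0 ≤ s := mul_nonneg (hR _ _) (hR _ _)
    have hsM : s ≤ M := mul_le_classProduct hR k l q.1 q.2
    have hP0 := hp q.1 q.2
    rcases hs0.eq_or_lt with h0 | h0
    · rw [← h0]; constructor
      · have : 0 ≤ M := h0.le.trans hsM
        simp; positivity
      · simp
    rcases hP0.eq_or_lt with h1 | h1
    · rw [← h1]; constructor
      · have := mul_nonneg hB.le (sub_nonneg.2 hsM)
        simpa using this
      · simp; positivity
    have hM0 : 0 < M := h0.trans_le hsM
    have hxs : s * p q.1 q.2 ≤ x := mul_le_confusedEdges hp hR k l q.1 q.2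
    have hx0 : 0 < x := (mul_pos h0 h1).trans_le hxs
    have hlogle : Real.log (p q.1 q.2) - Real.log (x / M) ≤ Real.log (M / s) := by
      rw [← Real.log_div h1.ne' (div_pos hx0 hM0).ne']
      refine Real.log_le_log (div_pos h1 (div_pos hx0 hM0)) ?_
      rw [div_le_div_iff₀ (div_pos hx0 hM0) h0]
      rw [mul_div_cancel₀ _ hM0.ne']
      linarith
    have hlog0 : 0 ≤ Real.log (M / s) := Real.log_nonneg ((one_le_div h0).2 hsM)
    have hb : s * (p q.1 q.2 * (Real.log (p q.1 q.2) - Real.log (x / M)))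
        ≤ B * (s * Real.log (M / s)) := by
      calc _ ≤ s * (p q.1 q.2 * Real.log (M / s)) := by gcongr
        _ ≤ s * (B * Real.log (M / s)) := by gcongr; exact hpB _ _
        _ = _ := by ring
    refine ⟨hb.trans (mul_le_mul_of_nonneg_left (mul_log_div_le_sub h0 hM0) hB.le), hb.trans ?_⟩
    have hsn : 1 / (n : ℝ) ^ 2 ≤ s := by
      have h2 : 1 / (n : ℝ) ≤ R k q.1 := (hRn _ _).resolve_left fun h => by
        rw [hs, h, zero_mul] at h0; exact lt_irrefl _ h0
      have h3 : 1 / (n : ℝ) ≤ R l q.2 := (hRn _ _).resolve_left fun h => by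
        rw [hs, h, mul_zero] at h0; exact lt_irrefl _ h0
      have h4 := mul_le_mul h2 h3 (by positivity) (hR _ _)
      calc _ = 1 / (n : ℝ) * (1 / n) := by ring
        _ ≤ _ := h4
    have h5 : Real.log (M / s) ≤ 2 * Real.log n := by
      have e : 2 * Real.log n = Real.log ((n : ℝ) ^ 2) := by rw [Real.log_pow]; push_cast; ring
      rw [e]
      refine Real.log_le_log (div_pos hM0 h0) ?_
      rw [div_le_iff₀ h0]
      rw [div_le_iff₀ (by positivity)] at hsn
      have := hM1 k l
      linarith
    calc _ ≤ B * (s * (2 * Real.log n)) := by gcongr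
      _ = _ := by ring
  have hkl : ∀ k l, ∑ q : κ × κ, R k q.1 * R l q.2 * (p q.1 q.2 * (Real.log (p q.1 q.2) -
        Real.log (confusedEdges p R k l / classProduct R k l)))
      ≤ B * (1 + 2 * Real.log n) * (classProduct R k l - R k k * R l l) := by
    intro k l
    have hM : R k k * R l l + ∑ q ∈ Finset.univ.erase (k, l), R k q.1 * R l q.2
        = classProduct R k l := by
      rw [classProduct_eq_sum]
      exact Finset.add_sum_erase _ (fun q : κ × κ => R k q.1 * R l q.2) (Finset.mem_univ (k, l))
    rw [← Finset.add_sum_erase _ _ (Finset.mem_univ (k, l))]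
    have hd : R k k * R l l * (p k l * (Real.log (p k l) -
        Real.log (confusedEdges p R k l / classProduct R k l)))
        ≤ B * (classProduct R k l - R k k * R l l) := by
      obtain ⟨s, M, rfl, rfl, h, -⟩ := hterm k l (k, l)
      exact h
    have ho : ∑ q ∈ Finset.univ.erase (k, l), R k q.1 * R l q.2 * (p q.1 q.2 *
        (Real.log (p q.1 q.2) - Real.log (confusedEdges p R k l / classProduct R k l)))
        ≤ 2 * B * Real.log n * ∑ q ∈ Finset.univ.erase (k, l), R k q.1 * R l q.2 := by
      rw [Finset.mul_sum]
      refine Finset.sum_le_sum fun q _ => ?_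
      obtain ⟨s, M, rfl, rfl, -, h⟩ := hterm k l q
      exact h
    have e : ∑ q ∈ Finset.univ.erase (k, l), R k q.1 * R l q.2
        = classProduct R k l - R k k * R l l := by linarith
    rw [e] at ho
    refine (add_le_add hd ho).trans (le_of_eq ?_)
    ring
  rw [trueLik_sub_populationLik]
  refine (Finset.sum_le_sum fun k _ => Finset.sum_le_sum fun l _ => hkl k l).trans ?_
  have e1 : ∑ k, ∑ l, B * (1 + 2 * Real.log n) * (classProduct R k l - R k k * R l l)
      = B * (1 + 2 * Real.log n) * (1 - (∑ k, R k k) ^ 2) := by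
    simp only [← Finset.mul_sum, Finset.sum_sub_distrib, classProduct]
    rw [← Finset.sum_mul, ← Finset.sum_mul, hsum]
    ring
  rw [e1]
  set D := ∑ k, R k k
  have : 1 - D ^ 2 ≤ 2 * (1 - D) := by nlinarith [sq_nonneg (1 - D)]
  calc _ ≤ B * (1 + 2 * Real.log n) * (2 * (1 - D)) := by gcongr
    _ = _ := by ring

lemma sum_units {M : Type*} [AddCommMonoid M] (f : ℤˣ → M) : ∑ k, f k = f 1 + f (-1) := by
  rw [UnitsInt.univ, Finset.sum_pair (by decide)]

/-- One number z, in the application a class average, cannot be close to both x and y. -/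
lemma min_mul_sq_le {s t x y z : ℝ} (hs : 0 ≤ s) (ht : 0 ≤ t) :
    min s t / 2 * (x - y) ^ 2 ≤ s * (x - z) ^ 2 + t * (y - z) ^ 2 := by
  have h0 : 0 ≤ min s t := le_min hs ht
  have h1 := mul_le_mul_of_nonneg_right (min_le_left s t) (sq_nonneg (x - z))
  have h2 := mul_le_mul_of_nonneg_right (min_le_right s t) (sq_nonneg (y - z))
  have h3 := mul_nonneg h0 (sq_nonneg ((x - z) + (y - z)))
  nlinarith

/-- For two communities, the loss of population likelihood is at least of the order of the number
of nodes in the minorities of the two classes. -/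
lemma sum_min_mul_le_trueLik_sub_populationLik {p R : ℤˣ → ℤˣ → ℝ} (hp : ∀ a b, 0 ≤ p a b)
    {B : ℝ} (hB : 0 < B) (hpB : ∀ a b, p a b ≤ B) (hR : ∀ k a, 0 ≤ R k a) :
    (∑ k, min (R k 1) (R k (-1))) * (∑ b, (∑ l, R l b) * (p 1 b - p (-1) b) ^ 2) / (8 * B)
      ≤ trueLik p R - populationLik p R := by
  refine le_trans ?_ (sum_sq_le_trueLik_sub_populationLik hp hB hpB hR)
  have h1 : (∑ k, min (R k 1) (R k (-1))) * (∑ b, (∑ l, R l b) * (p 1 b - p (-1) b) ^ 2) / (8 * B)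
      = ∑ k, ∑ l, (∑ b, R l b * (min (R k 1) (R k (-1)) / 2 * (p 1 b - p (-1) b) ^ 2)) / (4 * B) := by
    simp only [sum_units]
    field_simp
    ring
  rw [h1]
  refine Finset.sum_le_sum fun k _ => Finset.sum_le_sum fun l _ => ?_
  rw [← Finset.sum_div]
  refine div_le_div_of_nonneg_right ?_ (by positivity)
  rw [Fintype.sum_prod_type, Finset.sum_comm]
  refine Finset.sum_le_sum fun b _ => ?_
  rw [sum_units]
  have := mul_le_mul_of_nonneg_left (min_mul_sq_le (x := p 1 b) (y := p (-1) b)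
    (z := confusedEdges p R k l / classProduct R k l) (hR k 1) (hR k (-1))) (hR l b)
  simp only
  linarith

end PopulationLikelihood

/-! ### From the profile likelihood of a graph to the population likelihood. -/

section Likelihood

variable {n : ℕ}

/-- The confusion matrix of the labels `e` relative to the labels `c`: the fraction of nodes with
`e`-label `k` and `c`-label `a`. -/
noncomputable def confusion (c e : Labels n) (k a : ℤˣ) : ℝ :=
  (∑ i, if e i = k ∧ c i = a then 1 else 0) / n

lemma confusion_nonneg (c e : Labels n) (k a : ℤˣ) : 0 ≤ confusion c e k a :=
  div_nonneg (Finset.sum_nonneg fun i _ => by split_ifs <;> norm_num) (Nat.cast_nonneg n)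

lemma confusion_eq_zero_or_le (c e : Labels n) (k a : ℤˣ) :
    confusion c e k a = 0 ∨ 1 / (n : ℝ) ≤ confusion c e k a := by
  have h : confusion c e k a = ((Finset.univ.filter fun i => e i = k ∧ c i = a).card : ℝ) / n := by
    rw [confusion, Finset.card_filter]; push_cast; rfl
  rw [h]
  rcases Nat.eq_zero_or_pos (Finset.univ.filter fun i => e i = k ∧ c i = a).card with h0 | h0
  · left; rw [h0]; simp
  · right
    refine div_le_div_of_nonneg_right ?_ (Nat.cast_nonneg n)
    exact_mod_cast h0

lemma sum_confusion_right (c e : Labels n) (k : ℤˣ) : ∑ a, confusion c e k a = nodeCount e k / n := by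
  simp only [confusion, nodeCount]
  rw [← Finset.sum_div, Finset.sum_comm]
  congr 1
  refine Finset.sum_congr rfl fun i _ => ?_
  rcases Int.units_eq_one_or (c i) with h' | h' <;> by_cases h : e i = k <;> simp [h, h']

lemma sum_confusion_left (c e : Labels n) (a : ℤˣ) : ∑ k, confusion c e k a = nodeCount c a / n := by
  simp only [confusion, nodeCount]
  rw [← Finset.sum_div, Finset.sum_comm]
  congr 1
  refine Finset.sum_congr rfl fun i _ => ?_
  rcases Int.units_eq_one_or (e i) with h' | h' <;> by_cases h : c i = a <;> simp [h, h']

lemma sum_nodeCount (e : Labels n) : ∑ k, nodeCount e k = n := by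
  simp only [nodeCount]
  rw [Finset.sum_comm]
  simp only [Finset.sum_ite_eq, Finset.mem_univ, if_true, Finset.sum_const, Finset.card_univ,
    Fintype.card_fin, nsmul_eq_mul, mul_one]

lemma sum_confusion (hn : 0 < n) (c e : Labels n) : ∑ k, ∑ a, confusion c e k a = 1 := by
  simp only [sum_confusion_right]
  rw [← Finset.sum_div, sum_nodeCount, div_self (Nat.cast_ne_zero.2 hn.ne')]

lemma classProduct_confusion (hn : 0 < n) (c e : Labels n) (k l : ℤˣ) :
    nodeCount e k * nodeCount e l = (n : ℝ) ^ 2 * classProduct (confusion c e) k l := by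
  have : (n : ℝ) ≠ 0 := Nat.cast_ne_zero.2 hn.ne'
  rw [classProduct, sum_confusion_right, sum_confusion_right]
  field_simp

/-- Block counts of a matrix constant on communities depend on `e` only through its confusion
matrix. -/
lemma edgeCount_block (hn : 0 < n) (c e : Labels n) (p : ℤˣ → ℤˣ → ℝ) (ρ : ℝ) (k l : ℤˣ) :
    edgeCount (Matrix.of fun i j => ρ * p (c i) (c j)) e k l
      = (n : ℝ) ^ 2 * ρ * confusedEdges p (confusion c e) k l := by
  have hn' : (n : ℝ) ≠ 0 := Nat.cast_ne_zero.2 hn.ne'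
  have h1 : ∀ q : ℤˣ × ℤˣ, (n : ℝ) ^ 2 * ρ * (confusion c e k q.1 * confusion c e l q.2 * p q.1 q.2)
      = ∑ i, ∑ j, (if e i = k ∧ c i = q.1 then 1 else 0) * (if e j = l ∧ c j = q.2 then 1 else 0) *
        (ρ * p q.1 q.2) := by
    intro q
    simp only [← Finset.sum_mul, ← Finset.mul_sum, confusion]
    field_simp
  rw [confusedEdges, Finset.mul_sum]
  simp only [h1]
  rw [Finset.sum_comm, edgeCount]
  refine Finset.sum_congr rfl fun i _ => ?_
  rw [Finset.sum_comm]
  refine Finset.sum_congr rfl fun j _ => ?_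
  rw [Finset.sum_eq_single (c i, c j)]
  · by_cases h : e i = k <;> by_cases h' : e j = l <;> simp [h, h']
  · intro q _ hq
    by_cases h : c i = q.1
    · by_cases h' : c j = q.2
      · exact absurd (Prod.ext h h').symm hq
      · simp [h']
    · simp [h]
  · simp

lemma edgeCount_eq_zero (A : Matrix (Fin n) (Fin n) ℝ) (e : Labels n) {k l : ℤˣ}
    (h : nodeCount e k * nodeCount e l = 0) : edgeCount A e k l = 0 := by
  have hz : ∀ k, nodeCount e k = 0 → ∀ i, e i ≠ k := by
    intro k hk i hi
    rw [nodeCount, Finset.sum_eq_zero_iff_of_nonneg] at hk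
    · have := hk i (Finset.mem_univ i)
      simp [hi] at this
    · intro i _; split_ifs <;> norm_num
  refine Finset.sum_eq_zero fun i _ => Finset.sum_eq_zero fun j _ => if_neg ?_
  rintro ⟨hi, hj⟩
  rcases mul_eq_zero.1 h with h | h
  · exact hz k h i hi
  · exact hz l h j hj

lemma sum_edgeCount (A : Matrix (Fin n) (Fin n) ℝ) (e : Labels n) :
    ∑ k, ∑ l, edgeCount A e k l = ∑ i, ∑ j, A i j := by
  have h1 : ∀ k, ∑ l, edgeCount A e k l = ∑ i, ∑ j, if e i = k then A i j else 0 := by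
    intro k
    simp only [edgeCount]
    rw [Finset.sum_comm]
    refine Finset.sum_congr rfl fun i _ => ?_
    rw [Finset.sum_comm]
    refine Finset.sum_congr rfl fun j _ => ?_
    rcases Int.units_eq_one_or (e j) with h' | h' <;> by_cases h : e i = k <;> simp [h, h']
  simp only [h1]
  rw [Finset.sum_comm]
  refine Finset.sum_congr rfl fun i _ => ?_
  rw [Finset.sum_comm]
  simp only [Finset.sum_ite_eq, Finset.mem_univ, if_true]

/-- Normalizing the counts by n²ρ costs log ρ times the total count, which is the same for every
labelling and cancels in comparisons. -/
lemma profileLogLik_eq (hn : 0 < n) (A : Matrix (Fin n) (Fin n) ℝ) (c e : Labels n) {ρ : ℝ}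
    (hρ : 0 < ρ) :
    profileLogLik A e = (n : ℝ) ^ 2 * ρ * (∑ k, ∑ l, edgeCount A e k l / ((n : ℝ) ^ 2 * ρ) *
      Real.log (edgeCount A e k l / ((n : ℝ) ^ 2 * ρ) / classProduct (confusion c e) k l))
      + Real.log ρ * ∑ i, ∑ j, A i j := by
  have hn' : (n : ℝ) ≠ 0 := Nat.cast_ne_zero.2 hn.ne'
  rw [← sum_edgeCount A e, Finset.mul_sum, Finset.mul_sum, ← Finset.sum_add_distrib, profileLogLik]
  refine Finset.sum_congr rfl fun k _ => ?_
  rw [Finset.mul_sum, Finset.mul_sum, ← Finset.sum_add_distrib]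
  refine Finset.sum_congr rfl fun l _ => ?_
  rcases eq_or_ne (edgeCount A e k l) 0 with h0 | h0
  · rw [h0]; simp
  have hM : classProduct (confusion c e) k l ≠ 0 := by
    intro h
    refine h0 (edgeCount_eq_zero A e ?_)
    rw [classProduct_confusion hn c, h, mul_zero]
  have h1 : edgeCount A e k l / (nodeCount e k * nodeCount e l)
      = ρ * (edgeCount A e k l / ((n : ℝ) ^ 2 * ρ) / classProduct (confusion c e) k l) := by
    rw [classProduct_confusion hn c]
    field_simp
  rw [h1, Real.log_mul hρ.ne' (by positivity)]
  field_simp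
  ring

/-- The modulus of continuity is applied to each of the four blocks: a nonempty class has mass at
least 1/n, so M ≥ n⁻², and empty blocks contribute zero on both sides. -/
lemma abs_sum_sub_populationLik_le (hn : 0 < n) (hlog : 1 ≤ Real.log n) {p : ℤˣ → ℤˣ → ℝ}
    (hp : ∀ a b, 0 ≤ p a b) {B : ℝ} (hpB : ∀ a b, p a b ≤ B) (hB : 0 ≤ B) (c e : Labels n)
    {X : ℤˣ → ℤˣ → ℝ} (hX : ∀ k l, 0 ≤ X k l)
    (hX0 : ∀ k l, classProduct (confusion c e) k l = 0 → X k l = 0) {η : ℝ} (hη : 1 / (n : ℝ) ≤ η)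
    (hη1 : η ≤ 1) (h : ∀ k l, |X k l - confusedEdges p (confusion c e) k l| ≤ η) :
    |(∑ k, ∑ l, X k l * Real.log (X k l / classProduct (confusion c e) k l))
      - populationLik p (confusion c e)| ≤ 4 * (B + 5) * η * Real.log n := by
  have hn' : (0 : ℝ) < n := Nat.cast_pos.2 hn
  have hη0 : 0 < η := lt_of_lt_of_le (by positivity) hη
  have hR := confusion_nonneg c e
  have hterm : ∀ k l, |X k l * Real.log (X k l / classProduct (confusion c e) k l) -
      confusedEdges p (confusion c e) k l * Real.log (confusedEdges p (confusion c e) k l /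
        classProduct (confusion c e) k l)| ≤ (B + 5) * η * Real.log n := by
    intro k l
    have hx0 := confusedEdges_nonneg hp hR k l
    have hxB := confusedEdges_le hpB hR k l
    have hM0 := classProduct_nonneg hR k l
    have hcl : ∀ k, ∑ a, confusion c e k a ≤ 1 := fun k => by
      rw [← sum_confusion hn c e]
      exact Finset.single_le_sum (f := fun k => ∑ a, confusion c e k a)
        (fun k _ => Finset.sum_nonneg fun a _ => hR k a) (Finset.mem_univ k)
    have hM1 : classProduct (confusion c e) k l ≤ 1 :=
      mul_le_one₀ (hcl k) (Finset.sum_nonneg fun _ _ => hR _ _) (hcl l)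
    set x := confusedEdges p (confusion c e) k l
    set M := classProduct (confusion c e) k l with hM
    rcases hM0.eq_or_lt with h0 | h0
    · have e1 : X k l = 0 := hX0 k l h0.symm
      have e2 : x = 0 := le_antisymm (by rw [← h0, mul_zero] at hxB; exact hxB) hx0
      rw [e1, e2]; simp; positivity
    have hxB' : x ≤ B + 1 := by nlinarith
    have hXB : X k l ≤ B + 1 := by
      have := (abs_le.1 (h k l)).2
      nlinarith
    have hMn : 1 / (n : ℝ) ^ 2 ≤ M := by
      have hs : ∀ k, 0 < ∑ a, confusion c e k a → 1 / (n : ℝ) ≤ ∑ a, confusion c e k a := by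
        intro k hk
        obtain ⟨a, -, ha⟩ := Finset.exists_lt_of_sum_lt (s := Finset.univ) (f := fun _ => (0 : ℝ))
          (g := fun a => confusion c e k a) (by simpa using hk)
        refine ((confusion_eq_zero_or_le c e k a).resolve_left ha.ne').trans ?_
        exact Finset.single_le_sum (f := fun a => confusion c e k a)
          (fun a _ => hR k a) (Finset.mem_univ a)
      have hk0 : 0 ≤ ∑ a, confusion c e k a := Finset.sum_nonneg fun _ _ => hR _ _
      have hl0 : 0 ≤ ∑ a, confusion c e l a := Finset.sum_nonneg fun _ _ => hR _ _
      have hkl : 0 < (∑ a, confusion c e k a) * ∑ a, confusion c e l a := h0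
      have h1 := hs k (pos_of_mul_pos_left hkl hl0)
      have h2 := hs l (pos_of_mul_pos_right hkl hk0)
      calc 1 / (n : ℝ) ^ 2 = 1 / n * (1 / n) := by ring
        _ ≤ _ := mul_le_mul h1 h2 (by positivity) hk0
    have := abs_mul_log_div_sub_le hn (hX k l) hx0 hXB hxB' (h k l) hη rfl hlog hMn hM1
    calc _ ≤ (B + 1 + 4) * η * Real.log n := this
      _ = _ := by ring
  rw [populationLik, ← Finset.sum_sub_distrib]
  simp only [← Finset.sum_sub_distrib]
  calc _ ≤ ∑ k : ℤˣ, ∑ l : ℤˣ, (B + 5) * η * Real.log n :=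
        (Finset.abs_sum_le_sum_abs _ _).trans (Finset.sum_le_sum fun k _ =>
          (Finset.abs_sum_le_sum_abs _ _).trans (Finset.sum_le_sum fun l _ => hterm k l))
    _ = _ := by simp only [sum_units]; ring

lemma card_ne_div_eq (c e : Labels n) :
    ((Finset.univ.filter fun i => e i ≠ c i).card : ℝ) / n
      = confusion c e 1 (-1) + confusion c e (-1) 1 := by
  rw [confusion, confusion, ← add_div, ← Finset.sum_add_distrib, Finset.card_filter, Nat.cast_sum]
  congr 1
  refine Finset.sum_congr rfl fun i _ => ?_
  rcases Int.units_eq_one_or (c i) with h | h <;> rcases Int.units_eq_one_or (e i) with h' | h' <;>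
    simp [h, h']

lemma card_neg_ne_div_eq (c e : Labels n) :
    ((Finset.univ.filter fun i => -e i ≠ c i).card : ℝ) / n
      = confusion c e 1 1 + confusion c e (-1) (-1) := by
  rw [confusion, confusion, ← add_div, ← Finset.sum_add_distrib, Finset.card_filter, Nat.cast_sum]
  congr 1
  refine Finset.sum_congr rfl fun i _ => ?_
  rcases Int.units_eq_one_or (c i) with h | h <;> rcases Int.units_eq_one_or (e i) with h' | h' <;>
    simp [h, h']

lemma misclusteredFraction_eq (c e : Labels n) :
    misclusteredFraction c e = min (confusion c e 1 (-1) + confusion c e (-1) 1)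
      (confusion c e 1 1 + confusion c e (-1) (-1)) := by
  rw [← card_ne_div_eq, ← card_neg_ne_div_eq, misclusteredFraction, Nat.cast_min,
    min_div_div_right (Nat.cast_nonneg n)]

lemma misclusteredFraction_nonneg (c e : Labels n) : 0 ≤ misclusteredFraction c e :=
  div_nonneg (Nat.cast_nonneg _) (Nat.cast_nonneg _)

lemma misclusteredFraction_le_one (c e : Labels n) : misclusteredFraction c e ≤ 1 := by
  refine div_le_one_of_le₀ ?_ (Nat.cast_nonneg _)
  refine Nat.cast_le.2 ((min_le_left _ _).trans ((Finset.card_le_univ _).trans ?_))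
  simp

/-- If the two classes have different majorities, their minorities are the errors for one of the two
namings. If they share a majority, the minorities make up the whole other community, of mass at
least π₀. -/
lemma misclusteredFraction_mul_le {c e : Labels n} {π₀ : ℝ} (h0 : 0 ≤ π₀) (h1 : π₀ ≤ 1)
    (hπ : ∀ a, π₀ ≤ ∑ k, confusion c e k a) :
    misclusteredFraction c e * π₀ ≤ ∑ k, min (confusion c e k 1) (confusion c e k (-1)) := by
  have hm0 := misclusteredFraction_nonneg c e
  have hm1 := misclusteredFraction_le_one c e
  have ha := hπ 1
  have hb := hπ (-1)
  rw [sum_units] at ha hb ⊢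
  have hl : misclusteredFraction c e * π₀ ≤ π₀ := mul_le_of_le_one_left h0 hm1
  have hm : misclusteredFraction c e * π₀ ≤ misclusteredFraction c e := mul_le_of_le_one_right hm0 h1
  have e1 := misclusteredFraction_eq c e
  have e2 := min_le_left (confusion c e 1 (-1) + confusion c e (-1) 1)
      (confusion c e 1 1 + confusion c e (-1) (-1))
  have e3 := min_le_right (confusion c e 1 (-1) + confusion c e (-1) 1)
      (confusion c e 1 1 + confusion c e (-1) (-1))
  rcases min_cases (confusion c e 1 1) (confusion c e 1 (-1)) with ⟨h, -⟩ | ⟨h, -⟩ <;>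
  rcases min_cases (confusion c e (-1) 1) (confusion c e (-1) (-1)) with ⟨h', -⟩ | ⟨h', -⟩ <;>
  rw [h, h'] <;> linarith

lemma edgeCount_nonneg {A : Matrix (Fin n) (Fin n) ℝ} (hA : ∀ i j, 0 ≤ A i j) (e : Labels n)
    (k l : ℤˣ) : 0 ≤ edgeCount A e k l :=
  Finset.sum_nonneg fun i _ => Finset.sum_nonneg fun j _ => by
    split_ifs
    · exact hA i j
    · exact le_rfl

/-- If the edge counts of a graph are close to those of the block model and the profile
log-likelihood at `e` is at least that at some `e'` close to `c`, then `e` is close to `c`. -/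
lemma misclusteredFraction_le (hn : 0 < n) (hlog : 1 ≤ Real.log n) {p : ℤˣ → ℤˣ → ℝ}
    (hp : ∀ a b, 0 ≤ p a b) {B : ℝ} (hpB : ∀ a b, p a b ≤ B) (hB : 0 < B) {ρ : ℝ} (hρ : 0 < ρ)
    {A : Matrix (Fin n) (Fin n) ℝ} (hA : ∀ i j, 0 ≤ A i j) {c e e' : Labels n} {π₀ : ℝ}
    (h0 : 0 ≤ π₀) (h1 : π₀ ≤ 1) (hπ : ∀ a, π₀ * n ≤ nodeCount c a) {η τ : ℝ}
    (hη : 1 / (n : ℝ) ≤ η) (hη1 : η ≤ 1)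
    (hdev : ∀ e k l, |edgeCount A e k l -
      edgeCount (Matrix.of fun i j => ρ * p (c i) (c j)) e k l| ≤ (n : ℝ) ^ 2 * ρ * η)
    (hτ : ((Finset.univ.filter fun i => e' i ≠ c i).card : ℝ) ≤ τ * n)
    (hQ : profileLogLik A e' ≤ profileLogLik A e) :
    misclusteredFraction c e * (π₀ ^ 2 * ∑ b, (p 1 b - p (-1) b) ^ 2) ≤
      8 * B * (2 * B * (1 + 2 * Real.log n) * τ + 8 * (B + 5) * η * Real.log n) := by
  have hn' : (0 : ℝ) < n := Nat.cast_pos.2 hn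
  have hnρ : 0 < (n : ℝ) ^ 2 * ρ := by positivity
  have hlik : ∀ e, |(∑ k, ∑ l, edgeCount A e k l / ((n : ℝ) ^ 2 * ρ) *
      Real.log (edgeCount A e k l / ((n : ℝ) ^ 2 * ρ) / classProduct (confusion c e) k l))
      - populationLik p (confusion c e)| ≤ 4 * (B + 5) * η * Real.log n := by
    intro e
    refine abs_sum_sub_populationLik_le hn hlog hp hpB hB.le c e
      (fun k l => div_nonneg (edgeCount_nonneg hA e k l) hnρ.le) (fun k l h => ?_) hη hη1
      fun k l => ?_
    · rw [edgeCount_eq_zero A e, zero_div]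
      rw [classProduct_confusion hn c, h, mul_zero]
    · have := hdev e k l
      rw [edgeCount_block hn] at this
      have e1 : edgeCount A e k l / ((n : ℝ) ^ 2 * ρ) - confusedEdges p (confusion c e) k l
          = (edgeCount A e k l - (n : ℝ) ^ 2 * ρ * confusedEdges p (confusion c e) k l)
            / ((n : ℝ) ^ 2 * ρ) := by field_simp
      rw [e1, abs_div, abs_of_pos hnρ, div_le_iff₀ hnρ]
      linarith
  rw [profileLogLik_eq hn A c e' hρ, profileLogLik_eq hn A c e hρ] at hQ
  have hQ' := le_of_mul_le_mul_left (le_of_add_le_add_right hQ) hnρ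
  -- The true likelihood depends only on the community sizes, so the losses of e and e' refer to a
  -- common maximum.
  have htrue : trueLik p (confusion c e) = trueLik p (confusion c e') := by
    simp only [trueLik, sum_confusion_left]
  have hup := trueLik_sub_populationLik_le hp hB hpB (confusion_nonneg c e') (sum_confusion hn c e')
    hn (confusion_eq_zero_or_le c e')
  have hlow := sum_min_mul_le_trueLik_sub_populationLik hp hB hpB (confusion_nonneg c e)
  have hτ' : 1 - ∑ k, confusion c e' k k ≤ τ := by
    have e1 := sum_confusion hn c e'
    simp only [sum_units] at e1 ⊢
    have e2 := card_ne_div_eq c e'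
    have e3 := (div_le_iff₀ hn').2 hτ
    linarith
  have hgap : trueLik p (confusion c e) - populationLik p (confusion c e)
      ≤ 2 * B * (1 + 2 * Real.log n) * τ + 8 * (B + 5) * η * Real.log n := by
    have e1 := (abs_le.1 (hlik e)).2
    have e2 := (abs_le.1 (hlik e')).1
    have e3 : 2 * B * (1 + 2 * Real.log n) * (1 - ∑ k, confusion c e' k k)
        ≤ 2 * B * (1 + 2 * Real.log n) * τ := by
      have : 0 ≤ Real.log n := by linarith
      gcongr
    linarith
  have hπ' : ∀ a, π₀ ≤ ∑ k, confusion c e k a := fun a => by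
    rw [sum_confusion_left, le_div_iff₀ hn']; exact hπ a
  have hmis := misclusteredFraction_mul_le h0 h1 hπ'
  have hS : π₀ * ∑ b, (p 1 b - p (-1) b) ^ 2
      ≤ ∑ b, (∑ l, confusion c e l b) * (p 1 b - p (-1) b) ^ 2 := by
    rw [Finset.mul_sum]
    exact Finset.sum_le_sum fun b _ => mul_le_mul_of_nonneg_right (hπ' b) (sq_nonneg _)
  have hS0 : 0 ≤ π₀ * ∑ b, (p 1 b - p (-1) b) ^ 2 :=
    mul_nonneg h0 (Finset.sum_nonneg fun _ _ => sq_nonneg _)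
  have hprod := mul_le_mul hmis hS hS0
    ((mul_nonneg (misclusteredFraction_nonneg c e) h0).trans hmis)
  rw [div_le_iff₀ (by positivity)] at hlow
  have hfin := mul_le_mul_of_nonneg_right hgap (by positivity : 0 ≤ 8 * B)
  calc _ = misclusteredFraction c e * π₀ * (π₀ * ∑ b, (p 1 b - p (-1) b) ^ 2) := by ring
    _ ≤ _ := by linarith

end Likelihood

/-! ### Concentration of the adjacency matrix and of all block counts. -/

section Concentration

variable {n : ℕ}

/-- The pairs of nodes, including loops, that index the edges of an undirected graph. -/
abbrev EdgeIndex (n : ℕ) : Type := {q : Fin n × Fin n // q.2 ≤ q.1}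

/-- The adjacency matrix of the graph with a single edge. -/
def edgeMatrix (q : EdgeIndex n) : Matrix (Fin n) (Fin n) ℝ :=
  Matrix.of fun i j => if (i, j) = q.1 ∨ (j, i) = q.1 then 1 else 0

lemma edgeMatrix_apply (q : EdgeIndex n) (i j : Fin n) :
    edgeMatrix q i j = if (i, j) = q.1 ∨ (j, i) = q.1 then 1 else 0 := rfl

lemma edgeMatrix_nonneg (q : EdgeIndex n) (i j : Fin n) : 0 ≤ edgeMatrix q i j := by
  rw [edgeMatrix_apply]; split_ifs <;> norm_num

lemma edgeMatrix_isSymm (q : EdgeIndex n) : (edgeMatrix q).IsSymm := by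
  ext i j
  rw [Matrix.transpose_apply, edgeMatrix_apply, edgeMatrix_apply]
  simp only [or_comm]

lemma edgeMatrix_unique {q : EdgeIndex n} {i j j' : Fin n}
    (h : (i, j) = q.1 ∨ (j, i) = q.1) (h' : (i, j') = q.1 ∨ (j', i) = q.1) : j = j' := by
  simp only [Prod.ext_iff] at h h'
  rcases h with ⟨h1, h2⟩ | ⟨h1, h2⟩ <;> rcases h' with ⟨h3, h4⟩ | ⟨h3, h4⟩
  · rw [h2, h4]
  · rw [h2, h3, ← h1, ← h4]
  · rw [h1, h4, ← h3, ← h2]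
  · rw [h1, h3]

lemma sum_edgeMatrix_le_one (q : EdgeIndex n) (i : Fin n) : ∑ j, edgeMatrix q i j ≤ 1 := by
  by_cases h : ∃ j, (i, j) = q.1 ∨ (j, i) = q.1
  · obtain ⟨j, hj⟩ := h
    rw [Finset.sum_eq_single j]
    · rw [edgeMatrix_apply, if_pos hj]
    · intro j' _ hne
      rw [edgeMatrix_apply, if_neg fun h' => hne (edgeMatrix_unique h' hj)]
    · simp
  · rw [Finset.sum_eq_zero]
    · norm_num
    · intro j _
      rw [edgeMatrix_apply, if_neg fun h' => h ⟨j, h'⟩]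

/-- Each row has at most one nonzero entry. Diagonality of the square is what the trace moment bound
needs; its entries mark the endpoints of the edge. -/
lemma edgeMatrix_mul_self (q : EdgeIndex n) :
    edgeMatrix q * edgeMatrix q = Matrix.diagonal fun i => ∑ j, edgeMatrix q i j := by
  ext i k
  rw [Matrix.mul_apply]
  rcases eq_or_ne i k with rfl | h
  · rw [Matrix.diagonal_apply_eq]
    refine Finset.sum_congr rfl fun j _ => ?_
    rw [(edgeMatrix_isSymm q).apply i j, edgeMatrix_apply]
    split_ifs <;> norm_num
  · rw [Matrix.diagonal_apply_ne _ h]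
    refine Finset.sum_eq_zero fun j _ => ?_
    rw [edgeMatrix_apply, edgeMatrix_apply]
    by_cases h1 : (i, j) = q.1 ∨ (j, i) = q.1
    · by_cases h2 : (j, k) = q.1 ∨ (k, j) = q.1
      · exact absurd (edgeMatrix_unique h1.symm h2) h
      · rw [if_neg h2, mul_zero]
    · rw [if_neg h1, zero_mul]

/-- Every entry is covered by exactly one index; the disjunction in `edgeMatrix` counts a loop once.
-/
lemma sum_smul_edgeMatrix {a : Matrix (Fin n) (Fin n) ℝ} (ha : a.IsSymm) :
    ∑ q : EdgeIndex n, a q.1.1 q.1.2 • edgeMatrix q = a := by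
  ext i j
  rw [Matrix.sum_apply]
  have key : ∀ q : EdgeIndex n, ((i, j) = q.1 ∨ (j, i) = q.1) →
      ∑ q : EdgeIndex n, (a q.1.1 q.1.2 • edgeMatrix q) i j = a q.1.1 q.1.2 := by
    intro q hq
    rw [Finset.sum_eq_single q]
    · rw [Matrix.smul_apply, edgeMatrix_apply, if_pos hq, smul_eq_mul, mul_one]
    · intro q' _ hne
      rw [Matrix.smul_apply, edgeMatrix_apply, if_neg, smul_zero]
      intro hq'
      apply hne
      have l1 := q.2
      have l2 := q'.2
      apply Subtype.ext
      rcases hq with hq | hq <;> rcases hq' with hq' | hq'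
      · rw [← hq, ← hq']
      · rw [← hq] at l1 ⊢; rw [← hq'] at l2 ⊢
        have : i = j := le_antisymm l2 l1
        rw [this]
      · rw [← hq] at l1 ⊢; rw [← hq'] at l2 ⊢
        have : i = j := le_antisymm l1 l2
        rw [this]
      · rw [← hq, ← hq']
    · simp
  rcases le_total j i with h | h
  · rw [key ⟨(i, j), h⟩ (Or.inl rfl)]
  · rw [key ⟨(j, i), h⟩ (Or.inr rfl)]
    exact ha.apply i j

lemma edgeCount_sum_smul {ι : Type*} (s : Finset ι) (a : ι → ℝ)
    (M : ι → Matrix (Fin n) (Fin n) ℝ) (e : Labels n) (k l : ℤˣ) :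
    edgeCount (∑ q ∈ s, a q • M q) e k l = ∑ q ∈ s, a q * edgeCount (M q) e k l := by
  simp only [edgeCount, Finset.mul_sum]
  symm
  rw [Finset.sum_comm]
  refine Finset.sum_congr rfl fun i _ => ?_
  rw [Finset.sum_comm]
  refine Finset.sum_congr rfl fun j _ => ?_
  split_ifs
  · rw [Matrix.sum_apply]; rfl
  · simp

lemma edgeCount_sub (M M' : Matrix (Fin n) (Fin n) ℝ) (e : Labels n) (k l : ℤˣ) :
    edgeCount (M - M') e k l = edgeCount M e k l - edgeCount M' e k l := by
  simp only [edgeCount, ← Finset.sum_sub_distrib]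
  refine Finset.sum_congr rfl fun i _ => Finset.sum_congr rfl fun j _ => ?_
  split_ifs
  · rfl
  · simp

lemma edgeCount_le_sum {M : Matrix (Fin n) (Fin n) ℝ} (hM : ∀ i j, 0 ≤ M i j) (e : Labels n)
    (k l : ℤˣ) : edgeCount M e k l ≤ ∑ i, ∑ j, M i j :=
  Finset.sum_le_sum fun i _ => Finset.sum_le_sum fun j _ => by
    split_ifs
    · exact le_rfl
    · exact hM i j

lemma sum_sum_edgeMatrix_le (q : EdgeIndex n) : ∑ i, ∑ j, edgeMatrix q i j ≤ 2 := by
  have h1 : ∀ i j, edgeMatrix q i j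
      ≤ (if (i, j) = q.1 then 1 else 0) + (if (j, i) = q.1 then 1 else 0) := by
    intro i j
    rw [edgeMatrix_apply]
    by_cases h1 : (i, j) = q.1 <;> by_cases h2 : (j, i) = q.1 <;> simp [h1, h2]
  have h2 : ∑ i, ∑ j, (if (i, j) = q.1 then (1 : ℝ) else 0) = 1 := by
    rw [← Fintype.sum_prod_type' (f := fun i j => if (i, j) = q.1 then (1 : ℝ) else 0)]
    simp
  calc _ ≤ ∑ i, ∑ j, ((if (i, j) = q.1 then (1 : ℝ) else 0) + (if (j, i) = q.1 then 1 else 0)) :=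
        Finset.sum_le_sum fun i _ => Finset.sum_le_sum fun j _ => h1 i j
    _ = 1 + 1 := by
      simp only [Finset.sum_add_distrib]
      rw [h2]
      congr 1
      rw [Finset.sum_comm, h2]
    _ = 2 := by norm_num

open Classical in
/-- A Chernoff bound for the two tails of a linear combination of Bernoulli variables. -/
lemma bernExp_abs_gt_le {ι : Type*} [Fintype ι] [DecidableEq ι] {p : ι → ℝ}
    (h0 : ∀ e, 0 ≤ p e) (h1 : ∀ e, p e ≤ 1) {a : ι → ℝ} {θ s t : ℝ} (hθ : 0 ≤ θ) (ha : ∀ e, |θ * a e| ≤ 1)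
    (hs : ∑ e, p e * a e ^ 2 ≤ s) :
    bernExp p (fun b => if ¬ |∑ e, a e * (boolVal (b e) - p e)| ≤ t then 1 else 0)
      ≤ 2 * Real.exp (θ ^ 2 * s - θ * t) := by
  have hone : ∀ σ : ℝ, σ ^ 2 = θ ^ 2 → |σ| = θ → bernExp p (fun b =>
      Real.exp (-(θ * t)) * Real.exp (∑ e, (σ * a e) * (boolVal (b e) - p e)))
      ≤ Real.exp (θ ^ 2 * s - θ * t) := by
    intro σ hσ hσ'
    rw [bernExp_const_mul, sub_eq_neg_add, Real.exp_add]
    refine mul_le_mul_of_nonneg_left ?_ (Real.exp_pos _).le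
    refine (bernExp_exp_le h0 h1 (a := fun e => σ * a e) fun e => ?_).trans
      (Real.exp_le_exp.2 ?_)
    · have := ha e
      rw [abs_mul, abs_of_nonneg hθ] at this
      rwa [abs_mul, hσ']
    · calc _ = θ ^ 2 * ∑ e, p e * a e ^ 2 := by
            rw [Finset.mul_sum]
            exact Finset.sum_congr rfl fun e _ => by rw [mul_pow, hσ]; ring
        _ ≤ _ := by gcongr
  have h2 := hone θ rfl (abs_of_nonneg hθ)
  have h3 := hone (-θ) (by ring) (by rw [abs_neg, abs_of_nonneg hθ])
  have hpt : ∀ b : ι → Bool, (if ¬ |∑ e, a e * (boolVal (b e) - p e)| ≤ t then (1 : ℝ) else 0)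
      ≤ Real.exp (-(θ * t)) * Real.exp (∑ e, (θ * a e) * (boolVal (b e) - p e))
      + Real.exp (-(θ * t)) * Real.exp (∑ e, (-θ * a e) * (boolVal (b e) - p e)) := by
    intro b
    have e1 : ∀ σ : ℝ, ∑ e, (σ * a e) * (boolVal (b e) - p e)
        = σ * ∑ e, a e * (boolVal (b e) - p e) := fun σ => by
      rw [Finset.mul_sum]; exact Finset.sum_congr rfl fun e _ => by ring
    rw [e1, e1, ← Real.exp_add, ← Real.exp_add]
    set S := ∑ e, a e * (boolVal (b e) - p e)
    by_cases h : |S| ≤ t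
    · rw [if_neg (not_not.2 h)]; positivity
    · rw [if_pos h]
      rw [not_le, lt_abs] at h
      rcases h with h | h
      · have : 1 ≤ Real.exp (-(θ * t) + θ * S) := Real.one_le_exp (by nlinarith)
        have := Real.exp_pos (-(θ * t) + -θ * S)
        linarith
      · have : 1 ≤ Real.exp (-(θ * t) + -θ * S) := Real.one_le_exp (by nlinarith)
        have := Real.exp_pos (-(θ * t) + θ * S)
        linarith
  have h4 := bernExp_mono h0 h1 hpt
  rw [bernExp_add] at h4
  linarith

lemma three_le_of_one_le_log (hlog : 1 ≤ Real.log n) : 3 ≤ n := by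
  by_contra h
  have h1 : (n : ℝ) ≤ 2 := by exact_mod_cast (by omega : n ≤ 2)
  rcases Nat.eq_zero_or_pos n with h0 | h0
  · rw [h0] at hlog; simp at hlog; linarith
  · have h2 := Real.log_le_log (Nat.cast_pos.2 h0) h1
    have := Real.log_two_lt_d9
    linarith

/-- The parameters of the edges of a random graph. -/
def edgeParam (p : Fin n → Fin n → ℝ) (q : EdgeIndex n) : ℝ := p q.1.1 q.1.2

lemma sum_edgeParam_smul {p : Fin n → Fin n → ℝ} (hps : ∀ i j, p i j = p j i) :
    ∑ q, edgeParam p q • edgeMatrix q = Matrix.of p :=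
  sum_smul_edgeMatrix (a := Matrix.of p) (by ext i j; exact hps j i)

lemma edgeCount_bernSeries (p : Fin n → Fin n → ℝ) (b : EdgeIndex n → Bool) (e : Labels n)
    (k l : ℤˣ) : edgeCount (bernSeries (edgeParam p) edgeMatrix b) e k l
      = ∑ q, edgeCount (edgeMatrix q) e k l * (boolVal (b q) - edgeParam p q) := by
  rw [bernSeries, edgeCount_sum_smul]
  exact Finset.sum_congr rfl fun q _ => mul_comm _ _

lemma sub_eq_bernSeries {M : Matrix (Fin n) (Fin n) ℝ} (hM : M.IsSymm)
    (h01 : ∀ i j, M i j = 0 ∨ M i j = 1) {p : Fin n → Fin n → ℝ} (hps : ∀ i j, p i j = p j i) :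
    M - Matrix.of p
      = bernSeries (edgeParam p) edgeMatrix (fun q => decide (M q.1.1 q.1.2 = 1)) := by
  have h1 : ∀ q : EdgeIndex n, boolVal (decide (M q.1.1 q.1.2 = 1)) = M q.1.1 q.1.2 := by
    intro q
    rcases h01 q.1.1 q.1.2 with h | h <;> rw [h] <;> simp [boolVal]
  simp only [bernSeries, sub_smul, Finset.sum_sub_distrib, h1]
  rw [sum_edgeParam_smul hps, sum_smul_edgeMatrix hM]

section

variable {p : Fin n → Fin n → ℝ} {lam B : ℝ}

-- The moment order is K = ⌈log n⌉: large enough that exp(−3K) ≤ n⁻³ beats the dimension factor n,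
-- and at most 2 log n ≤ λ, as the degree moments require.
open Classical in
lemma bernExp_not_quadForm_bound (hlog : 1 ≤ Real.log n) (hlam : 2 * Real.log n ≤ lam)
    (hp0 : ∀ i j, 0 ≤ p i j) (hp1 : ∀ i j, p i j ≤ 1)
    (hps : ∀ i j, p i j = p j i) (hpB : ∀ i j, p i j ≤ B * (lam / n)) :
    bernExp (edgeParam p) (fun b => if ¬ ∀ y,
      |y ⬝ᵥ (bernSeries (edgeParam p) edgeMatrix b *ᵥ y)| ≤
        Real.sqrt (8 * Real.exp (3 * B + 3) * Real.log n * lam) * (y ⬝ᵥ y) then 1 else 0)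
      ≤ 1 / (2 * n) := by
  have hn3 := three_le_of_one_le_log hlog
  have hn0 : (0 : ℝ) < n := by positivity
  have hn3' : (3 : ℝ) ≤ n := by exact_mod_cast hn3
  have hlam0 : 0 < lam := by linarith
  set K := ⌈Real.log n⌉₊ with hK
  have hK1 : Real.log n ≤ K := Nat.le_ceil _
  have hK2 : (K : ℝ) ≤ 2 * Real.log n := by
    have := (Nat.ceil_lt_add_one (by linarith : 0 ≤ Real.log n)).le
    linarith
  have hK0 : K ≠ 0 := by
    intro h; rw [h] at hK1; simp at hK1; linarith
  have hrow : ∀ i, ∑ q, edgeParam p q * ∑ j, edgeMatrix q i j ≤ B * lam := by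
    intro i
    have e1 : ∑ q, edgeParam p q * ∑ j, edgeMatrix q i j = ∑ j, p i j := by
      simp only [Finset.mul_sum]
      rw [Finset.sum_comm]
      refine Finset.sum_congr rfl fun j _ => ?_
      have := congrFun (congrFun (sum_edgeParam_smul hps) i) j
      rw [Matrix.sum_apply] at this
      exact this
    rw [e1]
    calc _ ≤ ∑ _j : Fin n, B * (lam / n) := Finset.sum_le_sum fun j _ => hpB i j
      _ = _ := by
        rw [Finset.sum_const, Finset.card_univ, Fintype.card_fin, nsmul_eq_mul]; field_simp
  have hspec := bernExp_quadForm_bound (p := edgeParam p) (fun q => hp0 _ _) (fun q => hp1 _ _)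
    (fun q => edgeMatrix_isSymm q) (c := fun q i => ∑ j, edgeMatrix q i j)
    (fun q i => Finset.sum_nonneg fun j _ => edgeMatrix_nonneg q i j) sum_edgeMatrix_le_one
    edgeMatrix_mul_self hrow hK0 (hK2.trans hlam)
  have ht₁le : Real.sqrt (4 * K * lam * Real.exp (3 * B + 3))
      ≤ Real.sqrt (8 * Real.exp (3 * B + 3) * Real.log n * lam) := by
    refine Real.sqrt_le_sqrt ?_
    have := mul_le_mul_of_nonneg_right hK2 (by positivity : 0 ≤ 4 * lam * Real.exp (3 * B + 3))
    nlinarith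
  have hspec' : (Fintype.card (Fin n) : ℝ) * Real.exp (-3 * K) ≤ 1 / (2 * n) := by
    have e1 : Real.exp (-3 * K) ≤ ((n : ℝ) ^ 3)⁻¹ := by
      rw [← Real.exp_log (by positivity : 0 < ((n : ℝ) ^ 3)⁻¹), Real.log_inv, Real.log_pow]
      refine Real.exp_le_exp.2 ?_
      push_cast; linarith
    rw [Fintype.card_fin]
    calc _ ≤ (n : ℝ) * ((n : ℝ) ^ 3)⁻¹ := by gcongr
      _ = 1 / (n * n : ℝ) := by field_simp
      _ ≤ _ := by
        refine one_div_le_one_div_of_le (by positivity) ?_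
        nlinarith
  refine le_trans (bernExp_mono (fun q => hp0 _ _) (fun q => hp1 _ _) fun b => ?_)
    (hspec.trans hspec')
  by_cases h : ∀ y, |y ⬝ᵥ (bernSeries (edgeParam p) edgeMatrix b *ᵥ y)| ≤
      Real.sqrt (4 * K * lam * Real.exp (3 * B + 3)) * (y ⬝ᵥ y)
  · rw [if_neg, if_neg (not_not.2 h)]
    exact not_not.2 fun y =>
      (h y).trans (mul_le_mul_of_nonneg_right ht₁le (dotProduct_self_nonneg y))
  · rw [if_pos h]
    split_ifs <;> norm_num

/-- Chernoff with θ = 1/(2√λ): the coefficients are at most 2, the variance proxy is at most 2nBλ,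
and the exponent nB/2 − (B + 8)n/2 = −4n leaves room for a union over all labellings. -/
lemma bernExp_not_edgeCount_bound (hn : 0 < n) (hB : 0 ≤ B) (hlam : 1 ≤ lam)
    (hp0 : ∀ i j, 0 ≤ p i j) (hp1 : ∀ i j, p i j ≤ 1)
    (hps : ∀ i j, p i j = p j i) (hpB : ∀ i j, p i j ≤ B * (lam / n)) (e : Labels n) (k l : ℤˣ) :
    bernExp (edgeParam p) (fun b => if ¬ |∑ q, edgeCount (edgeMatrix q) e k l *
      (boolVal (b q) - edgeParam p q)| ≤ (B + 8) * n * Real.sqrt lam then 1 else 0)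
      ≤ 2 * Real.exp (-4 * n) := by
  have hn0 : (0 : ℝ) < n := Nat.cast_pos.2 hn
  have hlam0 : 0 < lam := by linarith
  have hs0 : 0 < Real.sqrt lam := Real.sqrt_pos.2 hlam0
  have hs1 : 1 ≤ Real.sqrt lam := Real.one_le_sqrt.2 hlam
  have ha0 : ∀ q : EdgeIndex n, 0 ≤ edgeCount (edgeMatrix q) e k l := fun q =>
    edgeCount_nonneg (edgeMatrix_nonneg q) e k l
  have ha2 : ∀ q : EdgeIndex n, edgeCount (edgeMatrix q) e k l ≤ 2 := fun q =>
    (edgeCount_le_sum (edgeMatrix_nonneg q) e k l).trans (sum_sum_edgeMatrix_le q)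
  have hsum : ∑ q, edgeParam p q * edgeCount (edgeMatrix q) e k l ^ 2 ≤ 2 * (n * (B * lam)) := by
    have e1 : ∑ q, edgeParam p q * edgeCount (edgeMatrix q) e k l
        = edgeCount (Matrix.of p) e k l := by
      rw [← sum_edgeParam_smul hps, edgeCount_sum_smul]
    have e2 : edgeCount (Matrix.of p) e k l ≤ n * (B * lam) := by
      refine (edgeCount_le_sum hp0 e k l).trans ?_
      calc _ ≤ ∑ _i : Fin n, ∑ _j : Fin n, B * (lam / n) :=
            Finset.sum_le_sum fun i _ => Finset.sum_le_sum fun j _ => hpB i j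
        _ = _ := by
          simp only [Finset.sum_const, Finset.card_univ, Fintype.card_fin, nsmul_eq_mul]
          field_simp
    calc _ ≤ ∑ q, 2 * (edgeParam p q * edgeCount (edgeMatrix q) e k l) := by
          refine Finset.sum_le_sum fun q _ => ?_
          have := mul_le_mul_of_nonneg_left (ha2 q)
            (mul_nonneg (show 0 ≤ edgeParam p q from hp0 q.1.1 q.1.2) (ha0 q))
          change edgeParam p q * _ * _ ≤ edgeParam p q * _ * _ at this
          nlinarith
      _ = 2 * edgeCount (Matrix.of p) e k l := by rw [← Finset.mul_sum, e1]
      _ ≤ _ := by linarith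
  have hθ : 0 < 1 / (2 * Real.sqrt lam) := by positivity
  refine (bernExp_abs_gt_le (p := edgeParam p) (fun q => hp0 _ _) (fun q => hp1 _ _)
    (a := fun q => edgeCount (edgeMatrix q) e k l) (θ := 1 / (2 * Real.sqrt lam))
    hθ.le (fun q => ?_) hsum).trans ?_
  · rw [abs_mul, abs_of_pos hθ, abs_of_nonneg (ha0 q), div_mul_eq_mul_div, one_mul,
      div_le_one (by positivity)]
    linarith [ha2 q]
  · refine mul_le_mul_of_nonneg_left (Real.exp_le_exp.2 (le_of_eq ?_)) (by norm_num)
    have e1 : Real.sqrt lam ^ 2 = lam := Real.sq_sqrt hlam0.le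
    have e2 : (1 / (2 * Real.sqrt lam)) ^ 2 * (2 * (n * (B * lam))) = n * B / 2 := by
      rw [div_pow, mul_pow, e1]; field_simp
    have e3 : 1 / (2 * Real.sqrt lam) * ((B + 8) * n * Real.sqrt lam) = (B + 8) * n / 2 := by
      field_simp
    rw [e2, e3]; ring

lemma card_mul_exp_le (hn3 : 3 ≤ n) :
    (Fintype.card (Labels n × ℤˣ × ℤˣ) : ℝ) * (2 * Real.exp (-4 * n)) ≤ 1 / (2 * n) := by
  have hn0 : (0 : ℝ) < n := by positivity
  have hn3' : (3 : ℝ) ≤ n := by exact_mod_cast hn3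
  have e1 : (Fintype.card (Labels n × ℤˣ × ℤˣ) : ℝ) = 4 * 2 ^ n := by
    rw [Fintype.card_prod, Fintype.card_prod, Fintype.card_fun, Fintype.card_fin]
    have : Fintype.card ℤˣ = 2 := rfl
    rw [this]; push_cast; ring
  have e2 : (2 : ℝ) ^ n ≤ Real.exp n := by
    have : (2 : ℝ) ≤ Real.exp 1 := by have := Real.add_one_le_exp (1 : ℝ); linarith
    calc (2 : ℝ) ^ n ≤ Real.exp 1 ^ n := by gcongr
      _ = _ := by rw [← Real.exp_nat_mul, mul_one]
  have e3 : Real.exp (-4 * n) = Real.exp (-n) * Real.exp (-(3 * n)) := by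
    rw [← Real.exp_add]; congr 1; ring
  have e4 : ((n : ℝ) + 1) ^ 3 ≤ Real.exp (3 * n) := by
    have h1 := Real.add_one_le_exp (n : ℝ)
    have h2 : Real.exp (3 * n) = Real.exp n ^ 3 := by
      rw [← Real.exp_nat_mul]; norm_num
    rw [h2]; gcongr
  have e5 : 16 * (n : ℝ) ≤ Real.exp (3 * n) := by
    have h1 : (16 : ℝ) ≤ ((n : ℝ) + 1) ^ 2 := by nlinarith
    have h2 := mul_le_mul_of_nonneg_right h1 (by linarith : 0 ≤ (n : ℝ) + 1)
    nlinarith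
  rw [e1, e3]
  have e6 : (2 : ℝ) ^ n * Real.exp (-n) ≤ 1 := by
    calc _ ≤ Real.exp n * Real.exp (-n) := by gcongr
      _ = 1 := by rw [← Real.exp_add]; simp
  have e7 : Real.exp (-(3 * (n : ℝ))) ≤ 1 / (16 * n) := by
    rw [Real.exp_neg, inv_eq_one_div]
    exact one_div_le_one_div_of_le (by positivity) e5
  calc _ = 8 * ((2 ^ n * Real.exp (-n)) * Real.exp (-(3 * (n : ℝ)))) := by ring
    _ ≤ 8 * (1 * (1 / (16 * n))) := by gcongr
    _ = _ := by field_simp; norm_num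

end

-- A pointwise union bound; its expectation bounds the probability of the good event from below.
open Classical in
lemma one_le_ite_add_ite_add_sum {κ : Type*} [Fintype κ] (P : Prop) (Q : κ → Prop) :
    (1 : ℝ) ≤ ((if P ∧ ∀ z, Q z then 1 else 0) + (if ¬ P then 1 else 0)) +
      ∑ z, if ¬ Q z then 1 else 0 := by
  have hnn : ∀ z, (0 : ℝ) ≤ if ¬ Q z then 1 else 0 := fun z => by split_ifs <;> norm_num
  have hsnn := Finset.sum_nonneg fun z (_ : z ∈ Finset.univ) => hnn z
  by_cases h1 : P
  · rw [if_neg (not_not.2 h1)]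
    by_cases h2 : ∀ z, Q z
    · rw [if_pos ⟨h1, h2⟩]; linarith
    · rw [if_neg fun h => h2 h.2]
      obtain ⟨z, hz⟩ := not_forall.1 h2
      have := Finset.single_le_sum (fun z _ => hnn z) (Finset.mem_univ z)
      rw [if_pos hz] at this
      linarith
  · rw [if_neg fun h => h1 h.1, if_pos h1]; linarith

open Classical in
/-- The edge counts of a random graph and the quadratic form of its adjacency matrix concentrate,
the former uniformly over all labellings. -/
lemma random_adjacency_concentration {Ω : Type*} [MeasurableSpace Ω] {μ : Measure Ω}
    [IsProbabilityMeasure μ] {A : Ω → Matrix (Fin n) (Fin n) ℝ} {p : Fin n → Fin n → ℝ}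
    (hA : IsRandomAdjacency μ A p) (hlog : 1 ≤ Real.log n) {lam B : ℝ} (hB : 0 ≤ B)
    (hlam : 2 * Real.log n ≤ lam) (hp0 : ∀ i j, 0 ≤ p i j) (hp1 : ∀ i j, p i j ≤ 1)
    (hps : ∀ i j, p i j = p j i) (hpB : ∀ i j, p i j ≤ B * (lam / n)) :
    1 - 1 / (n : ℝ) ≤ μ.real {x |
      (∀ y, |y ⬝ᵥ ((A x - Matrix.of p) *ᵥ y)| ≤
        Real.sqrt (8 * Real.exp (3 * B + 3) * Real.log n * lam) * (y ⬝ᵥ y)) ∧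
      ∀ e k l, |edgeCount (A x) e k l - edgeCount (Matrix.of p) e k l| ≤
        (B + 8) * n * Real.sqrt lam} := by
  have hn3 := three_le_of_one_le_log hlog
  have hn0 : (0 : ℝ) < n := by positivity
  have h0 : ∀ q, 0 ≤ edgeParam p q := fun q => hp0 _ _
  have h1 : ∀ q, edgeParam p q ≤ 1 := fun q => hp1 _ _
  let P : (EdgeIndex n → Bool) → Prop := fun b =>
    ∀ y, |y ⬝ᵥ (bernSeries (edgeParam p) edgeMatrix b *ᵥ y)| ≤
      Real.sqrt (8 * Real.exp (3 * B + 3) * Real.log n * lam) * (y ⬝ᵥ y)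
  let Q : (EdgeIndex n → Bool) → Labels n × ℤˣ × ℤˣ → Prop := fun b z =>
    |∑ q, edgeCount (edgeMatrix q) z.1 z.2.1 z.2.2 * (boolVal (b q) - edgeParam p q)|
      ≤ (B + 8) * n * Real.sqrt lam
  have hmeas := measureReal_eq_bernExp (μ := μ) (p := edgeParam p)
    (Y := fun (q : EdgeIndex n) x => A x q.1.1 q.1.2) (fun q => hA.measurable _ _) hA.indep
    (fun q => hA.prob_one _ _) (fun b => P b ∧ ∀ z, Q b z)
  have htot := bernExp_mono h0 h1 fun b => one_le_ite_add_ite_add_sum (P b) (Q b)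
  rw [bernExp_const, bernExp_add, bernExp_add, bernExp_sum, ← hmeas] at htot
  have hspec : bernExp (edgeParam p) (fun b => if ¬ P b then 1 else 0) ≤ 1 / (2 * n) :=
    bernExp_not_quadForm_bound hlog hlam hp0 hp1 hps hpB
  have hcut : ∀ z, bernExp (edgeParam p) (fun b => if ¬ Q b z then 1 else 0)
      ≤ 2 * Real.exp (-4 * n) := fun z => by
    convert bernExp_not_edgeCount_bound (by omega) hB (by linarith) hp0 hp1 hps hpB z.1 z.2.1 z.2.2
  have hsum := Finset.sum_le_sum fun z (_ : z ∈ Finset.univ) => hcut z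
  rw [Finset.sum_const, Finset.card_univ, nsmul_eq_mul] at hsum
  have hlow : 1 - 1 / (n : ℝ) ≤ μ.real {x | P (fun q => decide (A x q.1.1 q.1.2 = 1)) ∧
      ∀ z, Q (fun q => decide (A x q.1.1 q.1.2 = 1)) z} := by
    have e : 1 / (n : ℝ) = 1 / (2 * n) + 1 / (2 * n) := by field_simp; norm_num
    have := hsum.trans (card_mul_exp_le hn3)
    linarith
  refine hlow.trans (measureReal_mono fun x hx => ?_)
  obtain ⟨g1, g2⟩ := hx
  have hser := sub_eq_bernSeries (hA.isSymm x) (hA.zero_or_one x) hps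
  refine ⟨fun y => ?_, fun e k l => ?_⟩
  · rw [hser]
    exact g1 y
  · rw [← edgeCount_sub, hser, edgeCount_bernSeries]
    exact g2 (e, k, l)

lemma integral_eq_of_isRandomAdjacency {Ω : Type*} [MeasurableSpace Ω] {μ : Measure Ω}
    {A : Ω → Matrix (Fin n) (Fin n) ℝ} {p : Fin n → Fin n → ℝ}
    (hA : IsRandomAdjacency μ A p) : expectedMatrix μ A = Matrix.of p := by
  ext i j
  rw [expectedMatrix, Matrix.of_apply, Matrix.of_apply, ← hA.prob_one i j]
  have h1 : (fun x => A x i j) = Set.indicator {x | A x i j = 1} 1 := by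
    ext x
    rcases hA.zero_or_one x i j with h | h <;> simp [Set.indicator, h]
  rw [h1, integral_indicator_one]
  exact hA.measurable i j (measurableSet_singleton 1)

end Concentration

/-! ### The block model: spectral structure, self-loops and the deterministic error bound. -/

section BlockModel

variable {n : ℕ} {r w : ℝ}

lemma blockProb_eq_mul (ρ r w : ℝ) (k l : ℤˣ) : blockProb ρ r w k l = ρ * blockProb 1 r w k l := by
  simp [blockProb]

lemma blockProb_symm (ρ r w : ℝ) (k l : ℤˣ) : blockProb ρ r w k l = blockProb ρ r w l k := by
  unfold blockProb
  split_ifs <;> rfl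

lemma blockProb_one_nonneg (hr : 0 ≤ r) (hw : 0 ≤ w) (k l : ℤˣ) : 0 ≤ blockProb 1 r w k l := by
  unfold blockProb
  split_ifs <;> simp [hr, hw]

lemma blockProb_one_le (hr : 0 ≤ r) (hw : 0 ≤ w) (k l : ℤˣ) : blockProb 1 r w k l ≤ 1 + r + w := by
  unfold blockProb
  split_ifs <;> linarith

/-- The edge probabilities of the block model with loops. -/
def blockMatrix (c : Labels n) (ρ r w : ℝ) : Matrix (Fin n) (Fin n) ℝ :=
  Matrix.of fun i j => ρ * blockProb 1 r w (c i) (c j)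

/-- The membership matrix of the communities. -/
def memberMatrix (c : Labels n) : Matrix ℤˣ (Fin n) ℝ := Matrix.of fun a i => if c i = a then 1 else 0

/-- The matrix of connection probabilities of the communities. -/
def communityMatrix (ρ r w : ℝ) : Matrix ℤˣ ℤˣ ℝ := Matrix.of fun a b => ρ * blockProb 1 r w a b

lemma blockMatrix_eq (c : Labels n) (ρ r w : ℝ) :
    (memberMatrix c)ᵀ * communityMatrix ρ r w * memberMatrix c = blockMatrix c ρ r w := by
  ext i j
  have h1 : ∀ b, ((memberMatrix c)ᵀ * communityMatrix ρ r w) i b = communityMatrix ρ r w (c i) b := by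
    intro b
    rw [Matrix.mul_apply, Finset.sum_eq_single (c i)]
    · simp [memberMatrix]
    · intro a _ ha
      simp [memberMatrix, ha.symm]
    · exact fun h => absurd (Finset.mem_univ _) h
  rw [Matrix.mul_apply, Finset.sum_eq_single (c j)]
  · rw [h1]; simp [memberMatrix, communityMatrix, blockMatrix]
  · intro a _ ha
    simp [memberMatrix, ha.symm]
  · exact fun h => absurd (Finset.mem_univ _) h

lemma communityMatrix_isSymm (ρ r w : ℝ) : (communityMatrix ρ r w).IsSymm := by
  ext a b
  simp only [communityMatrix, Matrix.transpose_apply, Matrix.of_apply]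
  rw [blockProb_symm]

/-- Completing the square; here r² < ω makes both communities visible in the top of the spectrum. -/
lemma communityMatrix_posSemidef {ρ : ℝ} (hρ : 0 ≤ ρ) (hw : r ^ 2 < w) (y : ℤˣ → ℝ) :
    0 ≤ y ⬝ᵥ (communityMatrix ρ r w *ᵥ y) := by
  have hne : ¬ ((-1 : ℤˣ) = 1) := by decide
  have h : y ⬝ᵥ (communityMatrix ρ r w *ᵥ y)
      = ρ * ((y 1 + r * y (-1)) ^ 2 + (w - r ^ 2) * y (-1) ^ 2) := by
    simp only [dotProduct, Matrix.mulVec, sum_units, communityMatrix, Matrix.of_apply, blockProb,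
      if_neg hne, if_true]
    ring
  rw [h]
  have : 0 ≤ w - r ^ 2 := by linarith
  positivity

lemma sum_eq_sum_nodeCount_mul (c : Labels n) (f : ℤˣ → ℝ) :
    ∑ i, f (c i) = ∑ a, nodeCount c a * f a := by
  simp only [nodeCount, Finset.sum_mul]
  rw [Finset.sum_comm]
  refine Finset.sum_congr rfl fun i _ => ?_
  simp only [ite_mul, one_mul, zero_mul, Finset.sum_ite_eq, Finset.mem_univ, if_true]

/-- The label vector is the image of a small vector under the block matrix. -/
lemma exists_blockMatrix_mulVec_eq (hr : 0 ≤ r) (hw : r ^ 2 < w) {ρ π₀ : ℝ} (hρ : 0 < ρ)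
    (hn : 0 < n) (hπ₀ : 0 < π₀) {c : Labels n} (hπ : ∀ a, π₀ * n ≤ nodeCount c a) :
    ∃ y, blockMatrix c ρ r w *ᵥ y = c.toVec ∧
      y ⬝ᵥ y ≤ n * ((1 + r + w) / ((w - r ^ 2) * π₀)) ^ 2 / (n * ρ) ^ 2 := by
  have hn0 : (0 : ℝ) < n := Nat.cast_pos.2 hn
  have hD : 0 < w - r ^ 2 := by linarith
  have hw0 : 0 < w := by nlinarith [sq_nonneg r]
  have hne : ¬ ((-1 : ℤˣ) = 1) := by decide
  have hN : ∀ a, 0 < nodeCount c a := fun a => lt_of_lt_of_le (by positivity) (hπ a)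
  have hN1 := (hN 1).ne'
  have hN2 := (hN (-1)).ne'
  -- Cramer's rule for the 2 × 2 system ρ(N₁f₁ + r N₂f₂) = 1, ρ(r N₁f₁ + ω N₂f₂) = −1, where N₁, N₂
  -- are the community sizes.
  let f : ℤˣ → ℝ := fun a =>
    (if a = 1 then w + r else -(1 + r)) / (ρ * (w - r ^ 2) * nodeCount c a)
  refine ⟨fun i => f (c i), ?_, ?_⟩
  · ext i
    have h1 : (blockMatrix c ρ r w *ᵥ fun i => f (c i)) i
        = ∑ a, nodeCount c a * (ρ * blockProb 1 r w (c i) a * f a) :=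
      sum_eq_sum_nodeCount_mul c fun a => ρ * blockProb 1 r w (c i) a * f a
    rw [h1, sum_units]
    simp only [f, blockProb, if_neg hne, if_true, Labels.toVec]
    rcases Int.units_eq_one_or (c i) with h | h
    · rw [h]
      simp only [if_true]
      field_simp
      push_cast
      ring
    · rw [h]
      simp only [if_neg hne]
      field_simp
      push_cast
      ring
  · have hf : ∀ a, f a * f a ≤ ((1 + r + w) / ((w - r ^ 2) * π₀)) ^ 2 / (n * ρ) ^ 2 := by
      intro a
      have h1 : |f a| ≤ (1 + r + w) / ((w - r ^ 2) * π₀) / (n * ρ) := by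
        have hden : 0 < ρ * (w - r ^ 2) * nodeCount c a := by have := hN a; positivity
        rw [abs_div, abs_of_pos hden, div_div]
        refine div_le_div₀ (by positivity) ?_ (by positivity) ?_
        · split_ifs
          · rw [abs_of_nonneg (by positivity)]; linarith
          · rw [abs_neg, abs_of_nonneg (by positivity)]; linarith
        · have := mul_le_mul_of_nonneg_left (hπ a) (by positivity : 0 ≤ ρ * (w - r ^ 2))
          linarith
      calc f a * f a = |f a| ^ 2 := by rw [sq_abs]; ring
        _ ≤ _ := by rw [← div_pow]; gcongr
    calc _ ≤ ∑ _i : Fin n, ((1 + r + w) / ((w - r ^ 2) * π₀)) ^ 2 / (n * ρ) ^ 2 :=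
          Finset.sum_le_sum fun i _ => hf (c i)
      _ = _ := by
        rw [Finset.sum_const, Finset.card_univ, Fintype.card_fin, nsmul_eq_mul]; ring

/-- A projection near the leading eigenvectors of a perturbation of the block matrix has an extreme
point with few errors. -/
lemma exists_extremeLabels_few_errors (hr : 0 ≤ r) (hw : r ^ 2 < w) {ρ π₀ : ℝ} (hρ : 0 < ρ)
    (hn : 0 < n) (hπ₀ : 0 < π₀) {c : Labels n} (hπ : ∀ a, π₀ * n ≤ nodeCount c a)
    {S : Matrix (Fin n) (Fin n) ℝ} (hS : S.IsSymm) {U : Matrix (Fin 2) (Fin n) ℝ}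
    (hU : IsLeadingEigenvectors S U) {s : ℝ} (hs : 0 < s)
    (h : ∀ x, |x ⬝ᵥ ((S - blockMatrix c ρ r w) *ᵥ x)| ≤ s * (x ⬝ᵥ x))
    (U' : Matrix (Fin 2) (Fin n) ℝ) :
    ∃ e ∈ extremeLabels U', ((Finset.univ.filter fun i => e i ≠ c i).card : ℝ) ≤
      (8 * ((1 + r + w) / ((w - r ^ 2) * π₀)) ^ 2 * (s ^ 2 / (n * ρ) ^ 2) + 2 * ‖U' - U‖ ^ 2) * n := by
  obtain ⟨hUU, σ, hσ, hlead⟩ := hU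
  obtain ⟨y, hy, hyy⟩ := exists_blockMatrix_mulVec_eq hr hw hρ hn hπ₀ hπ
  obtain ⟨e, he, hcard⟩ := exists_extremeLabels_card_ne_le hUU U' c
  refine ⟨e, he, hcard.trans ?_⟩
  rw [← blockMatrix_eq] at h hy
  have h1 := proj_residual_le hS hUU hσ hlead (C := memberMatrix c) (by decide)
    (communityMatrix_isSymm ρ r w) (communityMatrix_posSemidef hρ.le hw) hs h hy
  have h2 := mul_le_mul_of_nonneg_left hyy (by positivity : 0 ≤ 4 * s ^ 2)
  have h3 : 4 * s ^ 2 * (n * ((1 + r + w) / ((w - r ^ 2) * π₀)) ^ 2 / (n * ρ) ^ 2) * 2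
      = 8 * ((1 + r + w) / ((w - r ^ 2) * π₀)) ^ 2 * (s ^ 2 / (n * ρ) ^ 2) * n := by ring
  linarith

lemma sqDist_eq (c e : Labels n) : sqDist c e = 4 * (n * misclusteredFraction c e) := by
  have hnorm : ∀ e : Labels n, ‖(WithLp.toLp 2 (c.toVec - e.toVec) : EuclideanSpace ℝ (Fin n))‖ ^ 2
      = 4 * ((Finset.univ.filter fun i => e i ≠ c i).card : ℝ) := by
    intro e
    rw [← toVec_sub_dotProduct_self, EuclideanSpace.norm_sq_eq]
    exact Finset.sum_congr rfl fun i _ => by rw [Real.norm_eq_abs, sq_abs]; exact sq _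
  have hneg : c.toVec + e.toVec = c.toVec - Labels.toVec (fun i => -e i) := by
    ext i; simp [Labels.toVec]
  rw [sqDist, hneg, hnorm, hnorm, ← mul_min_of_nonneg _ _ (by norm_num : (0 : ℝ) ≤ 4),
    misclusteredFraction, Nat.cast_min]
  congr 1
  rcases Nat.eq_zero_or_pos n with rfl | hn
  · simp
  · have : (n : ℝ) ≠ 0 := Nat.cast_ne_zero.2 hn.ne'
    field_simp

lemma edgeProb_symm (loops : Bool) (c : Labels n) (ρ r w : ℝ) (i j : Fin n) :
    edgeProb loops c (blockProb ρ r w) i j = edgeProb loops c (blockProb ρ r w) j i := by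
  unfold edgeProb
  rw [blockProb_symm]
  simp only [eq_comm]

/-- Forbidding loops changes only the diagonal, hence costs O(ρ) in the quadratic form and O(nρ) in
block counts. This treats both conventions at once. -/
lemma abs_edgeProb_sub_le (loops : Bool) (c : Labels n) {ρ : ℝ} (hρ : 0 ≤ ρ) (hr : 0 ≤ r)
    (hw : 0 ≤ w) (i j : Fin n) :
    |edgeProb loops c (blockProb ρ r w) i j - blockMatrix c ρ r w i j|
      ≤ if i = j then (1 + r + w) * ρ else 0 := by
  have h1 : blockMatrix c ρ r w i j = ρ * blockProb 1 r w (c i) (c j) := rfl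
  have h2 := blockProb_one_nonneg hr hw (c i) (c j)
  have h3 := blockProb_one_le hr hw (c i) (c j)
  rw [h1, edgeProb, blockProb_eq_mul]
  by_cases hij : i = j
  · rw [if_pos hij]
    split_ifs
    · rw [zero_sub, abs_neg, abs_of_nonneg (by positivity)]
      nlinarith
    · rw [sub_self, abs_zero]; positivity
  · simp [hij]

lemma edgeProb_nonneg (loops : Bool) (c : Labels n) {ρ : ℝ} (hρ : 0 ≤ ρ) (hr : 0 ≤ r)
    (hw : 0 ≤ w) (i j : Fin n) : 0 ≤ edgeProb loops c (blockProb ρ r w) i j := by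
  rw [edgeProb, blockProb_eq_mul]
  split_ifs
  · exact le_rfl
  · exact mul_nonneg hρ (blockProb_one_nonneg hr hw _ _)

lemma edgeProb_le (loops : Bool) (c : Labels n) {ρ : ℝ} (hρ : 0 ≤ ρ) (hr : 0 ≤ r)
    (hw : 0 ≤ w) (i j : Fin n) :
    edgeProb loops c (blockProb ρ r w) i j ≤ (1 + r + w) * ρ := by
  rw [edgeProb, blockProb_eq_mul]
  split_ifs
  · positivity
  · have := mul_le_mul_of_nonneg_left (blockProb_one_le hr hw (c i) (c j)) hρ
    linarith

lemma abs_quadForm_edgeProb_sub_le (loops : Bool) (c : Labels n) {ρ : ℝ} (hρ : 0 ≤ ρ)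
    (hr : 0 ≤ r) (hw : 0 ≤ w) (y : Fin n → ℝ) :
    |y ⬝ᵥ ((Matrix.of (edgeProb loops c (blockProb ρ r w)) - blockMatrix c ρ r w) *ᵥ y)|
      ≤ (1 + r + w) * ρ * (y ⬝ᵥ y) := by
  have h1 : ∀ i, |(Matrix.of (edgeProb loops c (blockProb ρ r w)) - blockMatrix c ρ r w).mulVec y i|
      ≤ (1 + r + w) * ρ * |y i| := by
    intro i
    rw [Matrix.mulVec, dotProduct]
    refine (Finset.abs_sum_le_sum_abs _ _).trans ?_
    calc _ ≤ ∑ j, (if i = j then (1 + r + w) * ρ else 0) * |y j| := by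
          refine Finset.sum_le_sum fun j _ => ?_
          rw [abs_mul]
          exact mul_le_mul_of_nonneg_right (abs_edgeProb_sub_le loops c hρ hr hw i j) (abs_nonneg _)
      _ = _ := by simp
  rw [dotProduct, dotProduct, Finset.mul_sum]
  refine (Finset.abs_sum_le_sum_abs _ _).trans (Finset.sum_le_sum fun i _ => ?_)
  rw [abs_mul]
  have := mul_le_mul_of_nonneg_left (h1 i) (abs_nonneg (y i))
  have e : |y i| * ((1 + r + w) * ρ * |y i|) = (1 + r + w) * ρ * (y i * y i) := by
    rw [← abs_mul_abs_self (y i)]; ring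
  linarith

lemma abs_edgeCount_edgeProb_sub_le (loops : Bool) (c : Labels n) {ρ : ℝ} (hρ : 0 ≤ ρ)
    (hr : 0 ≤ r) (hw : 0 ≤ w) (e : Labels n) (k l : ℤˣ) :
    |edgeCount (Matrix.of (edgeProb loops c (blockProb ρ r w))) e k l -
      edgeCount (blockMatrix c ρ r w) e k l| ≤ n * ((1 + r + w) * ρ) := by
  have hB : 0 ≤ (1 + r + w) * ρ := by positivity
  rw [← edgeCount_sub]
  refine (Finset.abs_sum_le_sum_abs _ _).trans ?_
  calc _ ≤ ∑ i : Fin n, ∑ j, if i = j then (1 + r + w) * ρ else 0 := by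
        refine Finset.sum_le_sum fun i _ => (Finset.abs_sum_le_sum_abs _ _).trans
          (Finset.sum_le_sum fun j _ => ?_)
        by_cases h : e i = k ∧ e j = l
        · rw [if_pos h]; exact abs_edgeProb_sub_le loops c hρ hr hw i j
        · rw [if_neg h, abs_zero]; split_ifs
          · exact hB
          · exact le_rfl
    _ = _ := by simp

/-- The factor 2 in front of π₀ leaves room for the rounding error, since 1 ≤ π₀ n. -/
lemma le_nodeCount_trueLabels {n₁ : ℕ} {π₁ π₀ : ℝ} (hn₁ : |(n₁ : ℝ) - π₁ * n| < 1)
    (h₀ : 2 * π₀ ≤ π₁) (h₁ : 2 * π₀ ≤ 1 - π₁) (hn : 1 ≤ π₀ * n) (a : ℤˣ) :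
    π₀ * n ≤ nodeCount (trueLabels n n₁) a := by
  have hne : ¬ ((-1 : ℤˣ) = 1) := by decide
  have hn0 : (0 : ℝ) ≤ n := Nat.cast_nonneg n
  obtain ⟨l1, l2⟩ := abs_lt.1 hn₁
  have hlt : (n₁ : ℝ) ≤ n := by nlinarith
  have hle : n₁ ≤ n := by exact_mod_cast hlt
  have h1 : nodeCount (trueLabels n n₁) 1 = n₁ := by
    have e1 : nodeCount (trueLabels n n₁) 1
        = ((Finset.univ.filter fun i : Fin n => i.val < n₁).card : ℝ) := by
      rw [nodeCount, Finset.card_filter, Nat.cast_sum]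
      refine Finset.sum_congr rfl fun i _ => ?_
      by_cases h : i.val < n₁ <;> simp [trueLabels, h, hne]
    rw [e1, Fin.card_filter_val_lt, min_eq_right hle]
  have h2 := sum_nodeCount (trueLabels n n₁)
  rw [sum_units, h1] at h2
  rcases Int.units_eq_one_or a with rfl | rfl
  · rw [h1]; nlinarith
  · nlinarith

/-- The error of the maximizer, for a projection near the leading eigenvectors of a perturbation of
the block matrix. -/
lemma misclusteredFraction_le_of_concentration (hr : 0 ≤ r) (hw : r ^ 2 < w) {lam π₀ : ℝ}
    (hlam : 1 ≤ lam) (hlamn : lam ≤ n) (hlog : 1 ≤ Real.log n) (hπ₀ : 0 < π₀) (hπ₁ : π₀ ≤ 1)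
    {c : Labels n} (hπ : ∀ a, π₀ * n ≤ nodeCount c a)
    (hlarge : 2 * (1 + r + w) + 8 ≤ Real.sqrt lam)
    {A : Matrix (Fin n) (Fin n) ℝ} (hA : ∀ i j, 0 ≤ A i j)
    (hcut : ∀ e k l, |edgeCount A e k l - edgeCount (blockMatrix c (lam / n) r w) e k l| ≤
      (2 * (1 + r + w) + 8) * n * Real.sqrt lam)
    {S : Matrix (Fin n) (Fin n) ℝ} (hS : S.IsSymm) {U : Matrix (Fin 2) (Fin n) ℝ}
    (hU : IsLeadingEigenvectors S U) {s : ℝ} (hs : 0 < s)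
    (h : ∀ x, |x ⬝ᵥ ((S - blockMatrix c (lam / n) r w) *ᵥ x)| ≤ s * (x ⬝ᵥ x))
    {U' : Matrix (Fin 2) (Fin n) ℝ} {e : Labels n} (he : IsProjectionMaximizer A U' e) :
    misclusteredFraction c e * (π₀ ^ 2 * ((1 - r) ^ 2 + (r - w) ^ 2)) ≤
      8 * (1 + r + w) * (6 * (1 + r + w) + 8 * (1 + r + w + 5) * (2 * (1 + r + w) + 8)) *
        (Real.log n * (8 * ((1 + r + w) / ((w - r ^ 2) * π₀)) ^ 2 * (s ^ 2 / lam ^ 2)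
          + 2 * ‖U' - U‖ ^ 2 + 1 / Real.sqrt lam)) := by
  have hn3 := three_le_of_one_le_log hlog
  have hn : 0 < n := by omega
  have hn0 : (0 : ℝ) < n := Nat.cast_pos.2 hn
  have hlam0 : 0 < lam := by linarith
  have hw0 : 0 ≤ w := by nlinarith [sq_nonneg r]
  have hne : ¬ ((-1 : ℤˣ) = 1) := by decide
  set B := 1 + r + w with hB
  have hB1 : 1 ≤ B := by linarith
  have hs0 : 0 < Real.sqrt lam := Real.sqrt_pos.2 hlam0
  have hss : Real.sqrt lam * Real.sqrt lam = lam := Real.mul_self_sqrt hlam0.le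
  have hs1 : 1 ≤ Real.sqrt lam := Real.one_le_sqrt.2 hlam
  have hnρ : n * (lam / n) = lam := by field_simp
  obtain ⟨e', he', hcard⟩ := exists_extremeLabels_few_errors hr hw (by positivity : 0 < lam / n) hn
    hπ₀ hπ hS hU hs h U'
  rw [hnρ] at hcard
  set τ := 8 * (B / ((w - r ^ 2) * π₀)) ^ 2 * (s ^ 2 / lam ^ 2) + 2 * ‖U' - U‖ ^ 2 with hτ
  have hτ0 : 0 ≤ τ := by positivity
  -- The count deviation (2B + 8) n √λ divided by n²ρ = nλ.
  set η := (2 * B + 8) / Real.sqrt lam with hη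
  have hη1 : η ≤ 1 := (div_le_one hs0).2 hlarge
  have hηn : 1 / (n : ℝ) ≤ η := by
    refine div_le_div₀ (by positivity) (by linarith) hs0 ?_
    calc Real.sqrt lam ≤ Real.sqrt lam * Real.sqrt lam := le_mul_of_one_le_left hs0.le hs1
      _ ≤ n := by rw [hss]; exact hlamn
  have hmain := misclusteredFraction_le hn hlog (p := blockProb 1 r w)
    (fun a b => blockProb_one_nonneg hr hw0 a b) (fun a b => blockProb_one_le hr hw0 a b)
    (by linarith) (by positivity : 0 < lam / n) hA hπ₀.le hπ₁ hπ hηn hη1 (fun e k l => by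
      refine (hcut e k l).trans (le_of_eq ?_)
      have e1 : (n : ℝ) ^ 2 * (lam / n) * η = n * (Real.sqrt lam * Real.sqrt lam) * η := by
        rw [hss]; field_simp
      rw [e1, hη]; field_simp) hcard (he.2 e' he')
  have hsum : ∑ b, (blockProb 1 r w 1 b - blockProb 1 r w (-1) b) ^ 2
      = (1 - r) ^ 2 + (r - w) ^ 2 := by
    rw [sum_units]; simp [blockProb, hne]
  rw [hsum, ← hB] at hmain
  refine hmain.trans ?_
  rw [mul_assoc (8 * B)]
  refine mul_le_mul_of_nonneg_left ?_ (by positivity)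
  have hL : 0 ≤ Real.log n := by linarith
  have e1 : 2 * B * (1 + 2 * Real.log n) * τ ≤ 6 * B * (Real.log n * τ) := by
    have : 1 + 2 * Real.log n ≤ 3 * Real.log n := by linarith
    calc _ ≤ 2 * B * (3 * Real.log n) * τ := by gcongr
      _ = _ := by ring
  have e2 : 8 * (B + 5) * η * Real.log n
      = 8 * (B + 5) * (2 * B + 8) * (Real.log n * (1 / Real.sqrt lam)) := by rw [hη]; ring
  have e3 : 0 ≤ 8 * (B + 5) * (2 * B + 8) * (Real.log n * τ) := by positivity
  have e4 : 0 ≤ 6 * B * (Real.log n * (1 / Real.sqrt lam)) := by positivity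
  rw [e2, mul_add (Real.log n)]
  nlinarith

end BlockModel

/-! ### Both error bounds on the concentration event, with one constant. -/

section Consistency

variable {n : ℕ} {r w : ℝ}

/-- The error bounds of the projection method on the event where the adjacency matrix concentrates,
with an explicit constant. -/
lemma projection_error_bounds (hr : 0 ≤ r) (hw : r ^ 2 < w) {lam π₀ : ℝ}
    (hlamn : lam ≤ n) (hlog : 1 ≤ Real.log n) (hπ₀ : 0 < π₀) (hπ₁ : π₀ ≤ 1)
    {c : Labels n} (hπ : ∀ a, π₀ * n ≤ nodeCount c a)
    (hlarge : 2 * (1 + r + w) + 8 ≤ Real.sqrt lam) (hlogle : Real.log n ≤ Real.sqrt lam)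
    (loops : Bool) {A : Matrix (Fin n) (Fin n) ℝ} (hAs : A.IsSymm) (hA : ∀ i j, 0 ≤ A i j)
    (hspec : ∀ y, |y ⬝ᵥ ((A - Matrix.of (edgeProb loops c (blockProb (lam / n) r w))) *ᵥ y)| ≤
        Real.sqrt (8 * Real.exp (3 * (1 + r + w) + 3) * Real.log n * lam) * (y ⬝ᵥ y))
    (hcut : ∀ e k l, |edgeCount A e k l -
        edgeCount (Matrix.of (edgeProb loops c (blockProb (lam / n) r w))) e k l| ≤
        (1 + r + w + 8) * n * Real.sqrt lam)
    {C : ℝ} (hC : C = 8 * (1 + r + w) * (6 * (1 + r + w) + 8 * (1 + r + w + 5) *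
        (2 * (1 + r + w) + 8)) / (π₀ ^ 2 * ((1 - r) ^ 2 + (r - w) ^ 2)) *
        (16 * ((1 + r + w) / ((w - r ^ 2) * π₀)) ^ 2 *
          (8 * Real.exp (3 * (1 + r + w) + 3) + (1 + r + w) ^ 2) + 2)) :
    (∀ (UE U : Matrix (Fin 2) (Fin n) ℝ) (e : Labels n),
      IsLeadingEigenvectors (Matrix.of (edgeProb loops c (blockProb (lam / n) r w))) UE →
      IsProjectionMaximizer A U e → ‖U - UE‖ ≤ 1 →
      misclusteredFraction c e ≤ C * (Real.log n * (1 / Real.sqrt lam + ‖U - UE‖))) ∧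
    (∀ (U : Matrix (Fin 2) (Fin n) ℝ) (e : Labels n),
      IsLeadingEigenvectors A U → IsProjectionMaximizer A U e →
      misclusteredFraction c e ≤ C * (Real.log n * (1 / Real.sqrt lam))) := by
  have hn3 := three_le_of_one_le_log hlog
  have hn : 0 < n := by omega
  have hn0 : (0 : ℝ) < n := Nat.cast_pos.2 hn
  have hw0 : 0 ≤ w := by nlinarith [sq_nonneg r]
  set B := 1 + r + w with hB
  have hB1 : 1 ≤ B := by linarith
  have hs8 : 8 ≤ Real.sqrt lam := by linarith
  have hlam0 : 0 < lam := Real.sqrt_pos.1 (by linarith)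
  have hss : Real.sqrt lam * Real.sqrt lam = lam := Real.mul_self_sqrt hlam0.le
  have hlam1 : 1 ≤ lam := Real.one_le_sqrt.1 (by linarith)
  have hs0 : 0 < Real.sqrt lam := by linarith
  have hsle : Real.sqrt lam ≤ lam := by
    nth_rewrite 2 [← hss]
    exact le_mul_of_one_le_left hs0.le (by linarith)
  have hsn : Real.sqrt lam ≤ n := hsle.trans hlamn
  have hρ0 : 0 ≤ lam / n := by positivity
  have hρ1 : lam / n ≤ 1 := (div_le_one hn0).2 hlamn
  have hL : 0 ≤ Real.log n := by linarith
  set L := Real.log n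
  set E := Real.exp (3 * B + 3)
  have hE : 0 < E := Real.exp_pos _
  set κ := (B / ((w - r ^ 2) * π₀)) ^ 2 with hκ
  have hκ0 : 0 ≤ κ := sq_nonneg _
  -- The communities are distinguishable: equal rows would force r = ω = 1, contradicting r² < ω.
  have hΔ : 0 < (1 - r) ^ 2 + (r - w) ^ 2 := by
    by_contra hcon
    have h1 := sq_nonneg (1 - r)
    have h2 := sq_nonneg (r - w)
    have h3 : 1 - r = 0 := pow_eq_zero_iff two_ne_zero |>.1 (by linarith)
    have h4 : r - w = 0 := pow_eq_zero_iff two_ne_zero |>.1 (by linarith)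
    have h5 : r = 1 := by linarith
    have h6 : w = 1 := by linarith
    rw [h5, h6] at hw
    norm_num at hw
  set C₁ := 8 * B * (6 * B + 8 * (B + 5) * (2 * B + 8)) with hC₁
  have hC₁0 : 0 ≤ C₁ := by positivity
  set Z := π₀ ^ 2 * ((1 - r) ^ 2 + (r - w) ^ 2) with hZ
  have hZ0 : 0 < Z := by positivity
  have hcut' : ∀ e k l, |edgeCount A e k l - edgeCount (blockMatrix c (lam / n) r w) e k l| ≤
      (2 * B + 8) * n * Real.sqrt lam := by
    intro e k l
    refine (abs_sub_le _ _ _).trans ((add_le_add (hcut e k l)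
      (abs_edgeCount_edgeProb_sub_le loops c hρ0 hr hw0 e k l)).trans ?_)
    rw [← hB]
    have e1 : (n : ℝ) * (B * (lam / n)) = B * (Real.sqrt lam * Real.sqrt lam) := by
      rw [hss]; field_simp
    have e2 : B * (Real.sqrt lam * Real.sqrt lam) ≤ B * (n * Real.sqrt lam) := by gcongr
    rw [e1]
    linarith
  have hquad := abs_quadForm_edgeProb_sub_le loops c hρ0 hr hw0
  rw [← hB] at hquad
  have hquad' : ∀ y, |y ⬝ᵥ ((Matrix.of (edgeProb loops c (blockProb (lam / n) r w)) -
      blockMatrix c (lam / n) r w) *ᵥ y)| ≤ B * (y ⬝ᵥ y) := fun y => by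
    refine (hquad y).trans (mul_le_mul_of_nonneg_right ?_ (dotProduct_self_nonneg y))
    exact mul_le_of_le_one_right (by linarith) hρ1
  have hinv : 1 / lam ^ 2 ≤ 1 / Real.sqrt lam := by
    exact one_div_le_one_div_of_le hs0 (hsle.trans (le_self_pow₀ hlam1 two_ne_zero))
  have hfin : ∀ m T : ℝ, m * Z ≤ C₁ * (L * T) → ∀ T', T ≤ (16 * κ * (8 * E + B ^ 2) + 2) * T' →
      m ≤ C * (L * T') := by
    intro m T hm T' hT
    have e1 : C = C₁ / Z * (16 * κ * (8 * E + B ^ 2) + 2) := hC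
    rw [e1, ← mul_le_mul_iff_left₀ hZ0]
    refine hm.trans ?_
    calc C₁ * (L * T) ≤ C₁ * (L * ((16 * κ * (8 * E + B ^ 2) + 2) * T')) := by gcongr
      _ = _ := by field_simp
  have hinv0 : 0 < 1 / Real.sqrt lam := by positivity
  have hκE : 0 ≤ κ * E := by positivity
  have hκB : 0 ≤ κ * B ^ 2 := by positivity
  -- For (i), S = E[A] differs from the block matrix by at most B in norm. For (ii), S = A is
  -- perturbed by O(√(λ log n)), and the projection is compared with itself.
  refine ⟨fun UE U e hUE he hε => ?_, fun U e hU he => ?_⟩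
  · have hsymm : (Matrix.of (edgeProb loops c (blockProb (lam / n) r w))).IsSymm := by
      ext i j; exact edgeProb_symm loops c _ r w j i
    have h1 := misclusteredFraction_le_of_concentration hr hw hlam1 hlamn hlog hπ₀ hπ₁ hπ hlarge hA
      hcut' hsymm hUE (by linarith : 0 < B) hquad' he
    refine hfin _ _ h1 _ ?_
    have hε0 := norm_nonneg (U - UE)
    have e1 : ‖U - UE‖ ^ 2 ≤ ‖U - UE‖ := pow_le_of_le_one hε0 hε two_ne_zero
    have e2 : 8 * κ * (B ^ 2 / lam ^ 2) ≤ 8 * (κ * B ^ 2) * (1 / Real.sqrt lam) := by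
      calc _ = 8 * (κ * B ^ 2) * (1 / lam ^ 2) := by ring
        _ ≤ _ := by gcongr
    have p1 := mul_nonneg hκE hinv0.le
    have p2 := mul_nonneg hκB hinv0.le
    have p3 := mul_nonneg hκE hε0
    have p4 := mul_nonneg hκB hε0
    change 8 * κ * (B ^ 2 / lam ^ 2) + 2 * ‖U - UE‖ ^ 2 + 1 / Real.sqrt lam ≤ _
    linarith
  · set t := Real.sqrt (8 * E * L * lam) with ht
    have ht0 : 0 ≤ t := Real.sqrt_nonneg _
    have ht2 : t ^ 2 = 8 * E * L * lam := Real.sq_sqrt (by positivity)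
    have h1 := misclusteredFraction_le_of_concentration hr hw hlam1 hlamn hlog hπ₀ hπ₁ hπ hlarge hA
      hcut' hAs hU (by linarith : 0 < t + B) (fun y => by
        have e1 : A - blockMatrix c (lam / n) r w
            = (A - Matrix.of (edgeProb loops c (blockProb (lam / n) r w))) +
              (Matrix.of (edgeProb loops c (blockProb (lam / n) r w)) -
                blockMatrix c (lam / n) r w) := by abel
        rw [e1, Matrix.add_mulVec, dotProduct_add, add_mul]
        exact (abs_add_le _ _).trans (add_le_add (hspec y) (hquad' y))) he
    refine hfin _ _ h1 _ ?_
    have e0 : (t + B) ^ 2 ≤ 2 * (t ^ 2 + B ^ 2) := add_sq_le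
    -- The squared perturbation over λ² is of order log n/λ; log n ≤ √λ makes it no larger than the
    -- count fluctuation.
    have e1 : L / lam ≤ 1 / Real.sqrt lam := by
      rw [div_le_div_iff₀ hlam0 hs0, one_mul]
      nth_rewrite 2 [← hss]
      exact mul_le_mul_of_nonneg_right hlogle hs0.le
    have e2 : (t + B) ^ 2 / lam ^ 2 ≤ 2 * (8 * E * (1 / Real.sqrt lam) +
        B ^ 2 * (1 / Real.sqrt lam)) := by
      calc _ ≤ 2 * (t ^ 2 + B ^ 2) / lam ^ 2 := by gcongr
        _ = 2 * (8 * E * (L / lam) + B ^ 2 * (1 / lam ^ 2)) := by rw [ht2]; field_simp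
        _ ≤ _ := by gcongr
    have e3 := mul_le_mul_of_nonneg_left e2 (by positivity : 0 ≤ 8 * κ)
    change 8 * κ * ((t + B) ^ 2 / lam ^ 2) + 2 * ‖U - U‖ ^ 2 + 1 / Real.sqrt lam ≤ _
    rw [sub_self, norm_zero]
    linarith

end Consistency

end CommunityDetection

/-! ### The main theorem: choice of the constant and reduction to large degree. -/

theorem theorem3 (r w π₁ δ : ℝ) (hr : 0 ≤ r) (hw : r ^ 2 < w) (hπ₀ : 0 < π₁) (hπ₁ : π₁ < 1)
    (hδ₀ : 0 < δ) (hδ₁ : δ < 1) :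
    ∃ M : ℝ, 0 < M ∧
      ∀ lam : ℕ → ℝ,
        (∃ C : ℝ, 0 < C ∧ ∀ᶠ n : ℕ in atTop, C * Real.log n ^ 2 ≤ lam n) →
      ∀ (n n₁ : ℕ), 0 < n → |(n₁ : ℝ) - π₁ * n| < 1 →
        0 < lam n →
        (∀ k l : ℤˣ, CommunityDetection.blockProb (lam n / n) r w k l ≤ 1) →
      ∀ (loops : Bool) {Ω : Type*} [MeasurableSpace Ω] (μ : Measure Ω) [IsProbabilityMeasure μ]
        (A : Ω → Matrix (Fin n) (Fin n) ℝ),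
        CommunityDetection.IsRandomAdjacency μ A
          (CommunityDetection.edgeProb loops (CommunityDetection.trueLabels n n₁)
            (CommunityDetection.blockProb (lam n / n) r w)) →
      ∀ UE : Matrix (Fin 2) (Fin n) ℝ,
        CommunityDetection.IsLeadingEigenvectors (CommunityDetection.expectedMatrix μ A) UE →
        1 - (n : ℝ) ^ (-δ) ≤ μ.real {x |
          (∀ (UA : Matrix (Fin 2) (Fin n) ℝ) (e : CommunityDetection.Labels n),
            CommunityDetection.IsProjectionMaximizer (A x) UA e →
            1 / (n : ℝ) * CommunityDetection.sqDist (CommunityDetection.trueLabels n n₁) e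
              ≤ M * Real.log n * ((lam n) ^ (-(1 / 2) : ℝ) + ‖UA - UE‖)) ∧
          (∀ (UA : Matrix (Fin 2) (Fin n) ℝ) (e : CommunityDetection.Labels n),
            CommunityDetection.IsLeadingEigenvectors (A x) UA →
            CommunityDetection.IsProjectionMaximizer (A x) UA e →
            CommunityDetection.misclusteredFraction (CommunityDetection.trueLabels n n₁) e
              ≤ M * Real.log n / Real.sqrt (lam n))} := by
  open CommunityDetection in
  have hw0 : 0 ≤ w := by nlinarith [sq_nonneg r]
  obtain ⟨π₀, hp0, hp1, hp2⟩ : ∃ π₀ : ℝ, 0 < π₀ ∧ 2 * π₀ ≤ π₁ ∧ 2 * π₀ ≤ 1 - π₁ := by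
    refine ⟨min π₁ (1 - π₁) / 2, half_pos (lt_min hπ₀ (by linarith)), ?_, ?_⟩
    · linarith [min_le_left π₁ (1 - π₁)]
    · linarith [min_le_right π₁ (1 - π₁)]
  obtain ⟨C, hC⟩ : ∃ C : ℝ, C = 8 * (1 + r + w) * (6 * (1 + r + w) + 8 * (1 + r + w + 5) *
      (2 * (1 + r + w) + 8)) / (π₀ ^ 2 * ((1 - r) ^ 2 + (r - w) ^ 2)) *
      (16 * ((1 + r + w) / ((w - r ^ 2) * π₀)) ^ 2 *
        (8 * Real.exp (3 * (1 + r + w) + 3) + (1 + r + w) ^ 2) + 2) := ⟨_, rfl⟩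
  have hC0 : 0 ≤ C := by rw [hC]; positivity
  set K := 2 * (1 + r + w) + 8 + 4 / π₀ with hK
  have hπinv : 0 < 4 / π₀ := by positivity
  have hK10 : 10 ≤ K := by linarith
  -- The part 4C converts the fraction of errors to squared distance, which is 4n times larger; the
  -- part 4K makes the claim trivial unless √λ > K log n.
  refine ⟨4 * K + 4 * C, by linarith, ?_⟩
  intro lam _ n n₁ hn hn₁ hlam0 hP loops Ω _ μ _ A hA UE hUE
  set M := 4 * K + 4 * C with hM
  have hM0 : 0 < M := by linarith
  have hn0 : (0 : ℝ) < n := Nat.cast_pos.2 hn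
  have hL0 : 0 ≤ Real.log n := Real.log_natCast_nonneg n
  have hs0 : 0 < Real.sqrt (lam n) := Real.sqrt_pos.2 hlam0
  have hss : Real.sqrt (lam n) * Real.sqrt (lam n) = lam n := Real.mul_self_sqrt hlam0.le
  have hrpow : (lam n) ^ (-(1 / 2) : ℝ) = 1 / Real.sqrt (lam n) := by
    rw [Real.rpow_neg hlam0.le, ← Real.sqrt_eq_rpow, one_div]
  have hsq : ∀ e : Labels n, 1 / (n : ℝ) * sqDist (trueLabels n n₁) e
      = 4 * misclusteredFraction (trueLabels n n₁) e := by
    intro e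
    rw [sqDist_eq]; field_simp
  simp only [hrpow, hsq]
  have hδn : (n : ℝ) ^ (-(1 : ℝ)) ≤ (n : ℝ) ^ (-δ) :=
    Real.rpow_le_rpow_of_exponent_le (by exact_mod_cast hn) (by linarith)
  rw [Real.rpow_neg_one, inv_eq_one_div] at hδn
  -- If the right side is at least 4, both bounds hold for every outcome, because fractions are at
  -- most 1.
  rcases le_or_gt (4 * Real.sqrt (lam n)) (M * Real.log n) with hbig | hsmall
  · have hrhs : 4 ≤ M * Real.log n / Real.sqrt (lam n) := (le_div_iff₀ hs0).2 hbig
    have huniv : {x | (∀ (UA : Matrix (Fin 2) (Fin n) ℝ) (e : Labels n),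
        IsProjectionMaximizer (A x) UA e → 4 * misclusteredFraction (trueLabels n n₁) e
          ≤ M * Real.log n * (1 / Real.sqrt (lam n) + ‖UA - UE‖)) ∧
        (∀ (UA : Matrix (Fin 2) (Fin n) ℝ) (e : Labels n), IsLeadingEigenvectors (A x) UA →
          IsProjectionMaximizer (A x) UA e → misclusteredFraction (trueLabels n n₁) e
          ≤ M * Real.log n / Real.sqrt (lam n))} = Set.univ := by
      refine Set.eq_univ_of_forall fun x => ⟨fun UA e _ => ?_, fun UA e _ _ => ?_⟩
      · have h1 := misclusteredFraction_le_one (trueLabels n n₁) e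
        have h2 : 0 ≤ M * Real.log n * ‖UA - UE‖ := by positivity
        have h3 : M * Real.log n * (1 / Real.sqrt (lam n) + ‖UA - UE‖)
            = M * Real.log n / Real.sqrt (lam n) + M * Real.log n * ‖UA - UE‖ := by ring
        linarith
      · have h1 := misclusteredFraction_le_one (trueLabels n n₁) e
        linarith
    rw [huniv, probReal_univ]
    have := Real.rpow_nonneg hn0.le (-δ)
    linarith
  rcases Nat.lt_or_ge n 2 with hn2 | hn2
  · have h1 : n = 1 := by omega
    have h2 : (n : ℝ) ^ (-δ) = 1 := by rw [h1]; simp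
    rw [h2, sub_self]
    exact measureReal_nonneg
  have hKs : K * Real.log n ≤ Real.sqrt (lam n) := by
    have : 4 * K * Real.log n ≤ M * Real.log n := by gcongr; linarith
    linarith
  have hlog2 : 1 / 2 ≤ Real.log n := by
    have h1 := Real.log_le_log (by norm_num : (0 : ℝ) < 2) (by exact_mod_cast hn2 : (2 : ℝ) ≤ n)
    have := Real.log_two_gt_d9
    linarith
  have hlamn : lam n ≤ n := by
    have h1 := hP 1 1
    rw [blockProb, if_pos rfl, if_pos rfl, mul_one, div_le_one hn0] at h1
    exact h1
  have hsK : K / 2 ≤ Real.sqrt (lam n) := by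
    have := mul_le_mul_of_nonneg_left hlog2 (by linarith : 0 ≤ K)
    linarith
  -- Since λ ≤ n, a large λ forces a large n: n ≥ K²/4 ≥ 2K by K ≥ 10. Hence log n ≥ 1 and π₀ n ≥ 1.
  have hnK : K * 2 ≤ n := by
    have h1 := mul_le_mul hsK hsK (by linarith) hs0.le
    have h2 := mul_le_mul_of_nonneg_right hK10 (by linarith : 0 ≤ K)
    linarith
  have hlog1 : 1 ≤ Real.log n := by
    rw [Real.le_log_iff_exp_le hn0]
    have := Real.exp_one_lt_d9
    linarith
  have hKs' : K ≤ Real.sqrt (lam n) :=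
    (le_mul_of_one_le_right (by linarith) hlog1).trans hKs
  have hlogs : 10 * Real.log n ≤ Real.sqrt (lam n) :=
    (mul_le_mul_of_nonneg_right hK10 hL0).trans hKs
  have hslam : Real.sqrt (lam n) ≤ lam n := by
    nth_rewrite 2 [← hss]
    exact le_mul_of_one_le_left hs0.le (by linarith)
  have hπn : 1 ≤ π₀ * n := by
    have h1 : 4 / π₀ ≤ n := by linarith
    rw [div_le_iff₀ hp0] at h1
    linarith
  have hπ := le_nodeCount_trueLabels hn₁ hp1 hp2 hπn
  have hρ0 : 0 ≤ lam n / n := by positivity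
  rw [integral_eq_of_isRandomAdjacency hA] at hUE
  have hconc := random_adjacency_concentration hA hlog1 (by linarith : 0 ≤ 1 + r + w)
    (by linarith : 2 * Real.log n ≤ lam n) (fun i j => edgeProb_nonneg loops _ hρ0 hr hw0 i j)
    (fun i j => by
      rw [edgeProb]
      split_ifs
      · norm_num
      · exact hP _ _)
    (fun i j => edgeProb_symm loops _ _ r w i j) (fun i j => edgeProb_le loops _ hρ0 hr hw0 i j)
  have hstep : 1 - (n : ℝ) ^ (-δ) ≤ 1 - 1 / (n : ℝ) := by linarith
  -- Monotonicity holds for arbitrary sets, so measurability of the event quantified over all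
  -- projections is not needed.
  refine (hstep.trans hconc).trans (measureReal_mono fun x hx => ?_)
  obtain ⟨hspec, hcut⟩ := hx
  have hbounds := projection_error_bounds hr hw hlamn hlog1 hp0 (by linarith) hπ (by linarith)
    (by linarith : Real.log n ≤ Real.sqrt (lam n)) loops (hA.isSymm x)
    (fun i j => by rcases hA.zero_or_one x i j with h | h <;> simp [h]) hspec hcut hC
  refine ⟨fun UA e he => ?_, fun UA e hUA he => ?_⟩
  · rcases le_or_gt ‖UA - UE‖ 1 with hε | hε
    · have h1 := hbounds.1 UE UA e hUE he hε
      have h2 : 0 ≤ Real.log n * (1 / Real.sqrt (lam n) + ‖UA - UE‖) := by positivity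
      have h3 := mul_nonneg (by linarith : 0 ≤ 4 * K) h2
      rw [hM]
      linarith
    · have h1 := misclusteredFraction_le_one (trueLabels n n₁) e
      have h2 : 4 ≤ M * Real.log n := by
        have := mul_le_mul (by linarith : 4 ≤ M) hlog1 zero_le_one hM0.le
        linarith
      have h3 : 1 ≤ 1 / Real.sqrt (lam n) + ‖UA - UE‖ := by
        have : 0 < 1 / Real.sqrt (lam n) := by positivity
        linarith
      have h4 := mul_le_mul h2 h3 zero_le_one (by linarith)
      linarith
  · have h1 := hbounds.2 UA e hUA he
    have h2 : 0 ≤ Real.log n * (1 / Real.sqrt (lam n)) := by positivity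
    have h3 := mul_nonneg (by linarith : 0 ≤ 4 * K + 3 * C) h2
    have h4 : M * Real.log n / Real.sqrt (lam n)
        = M * (Real.log n * (1 / Real.sqrt (lam n))) := by ring
    rw [h4, hM]
    linarith
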